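/- **Setting.** For $n\in\mathbb N$ let $V=\{x_1,\dots,x_n\}$ be the variables and $\pi\in S_n$ an order on them (put $\pi(x_i)=\pi(i)$). Write $x^1=x$, $x^0=\bar x$. A *clause* is a set of literals containing no variable together with its negation, $0$ is the empty clause, and a *CNF* is a set of clauses. A *resolution refutation* of a CNF $\tau$ is a sequence of clauses containing $0$, in which each clause is in $\tau$ or follows from two earlier ones by the rule $C\vee x^a,\ D\vee x^{1-a}\vdash C\vee D$; its size is its number of lines. It is *$\pi$-ordered* if in each application of the rule every variable $y$ of $C\vee D$ satisfies $\pi(y)<\pi(x)$. A *trail* is a list $t$ of assignments $x\stackrel{d}{=}a$ (decisions) and $x\stackrel{u}{=}a$ (unit propagations) with pairwise distinct variables; $C|_t$ is the restriction of the clause $C$, $t[\le k]$ is the prefix of length $k$, and $\Lambda$ is the empty trail. A *state* is a pair $S=(\mathbb C,t)$ of a CNF and a trail; it is *terminal* if $C|_t\equiv 1$ for all $C\in\mathbb C$ or $0\in\mathbb C$. Let $r$ be the length of $t$ and let $t$ assign $y_k=a_k$ at its $k$-th place. Let $\mathbb C_{r+1}(S)=\{D\in\mathbb C: D|_t=0\}$.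 For $k=r,\dots,1$, if the $k$-th assignment is a decision, let $\mathbb C_k(S)=\mathbb C_{k+1}(S)$; otherwise $\mathbb C_k(S)$ consists of all $D\in\mathbb C_{k+1}(S)$ not containing $y_k^{1-a_k}$, together with all resolvents on $y_k$ of some $D\in\mathbb C_{k+1}(S)$ containing $y_k^{1-a_k}$ with some $C\in\mathbb C$ such that $C|_{t[\le k-1]}=y_k^{a_k}$. Let $\mathbb C(S)=\bigcup_{k=1}^r\mathbb C_k(S)$. The basic CDCL model allows the following actions in a nonterminal state $S=(\mathbb C,t)$: (D) append $x\stackrel{d}{=}a$ to $t$, for an unassigned variable $x$; (U) append $x\stackrel{u}{=}a$ to $t$, if $C|_t=x^a$ for some $C\in\mathbb C$; (L) if $0\in\mathbb C(S)$, go to $(\mathbb C\cup\{0\},\Lambda)$; if $0\notin\mathbb C(S)$, go to $(\mathbb C\cup\{C\},t^*)$ for any $C\in\mathbb C(S)\setminus\mathbb C$ and any prefix $t^*$ of $t$ with $C|_{t^*}\ne0$. The amendment **DECISION-L** allows only clauses of $\mathbb C_1(S)$ to be learned in (L). The amendment **$\pi$-D** allows only the $\pi$-smallest unassigned variable to be chosen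 in (D). A proof in $\mathsf{CDCL}(\text{DECISION-L},\pi\text{-D})$ of the unsatisfiability of a contradictory CNF $\tau$ is a sequence of actions, none of them forbidden by these amendments, that leads from $(\tau,\Lambda)$ to a terminal state; its size is its number of actions. **Theorem 2.2.** For every order $\pi$ on the variables, $\mathsf{CDCL}(\text{DECISION-L},\pi\text{-D})$ and $\pi$-ordered resolution are polynomially equivalent, that is, they $p$-simulate each other. In detail, for each of the two directions there are one algorithm and one polynomial $q$ that work for all $n$, all $\pi\in S_n$ and all contradictory CNFs $\tau$ in $n$ variables: given $n$, $\pi$, $\tau$ and a refutation of $\tau$ of size $s$ in one system, the algorithm outputs a refutation of $\tau$ in the other system, in time at most $q$ of the length of its input, and the size of the output is at most $q(n+s)$. In particular, $\mathsf{CDCL}(\text{DECISION-L},\pi\text{-D})$ does not simulate general resolution, whatever the orders are: for every sequence of orders $\pi_n\in S_n$ $(n\in\mathbb N)$ there is no polynomial $q$ such that, for every $n$, every contradictory CNF $\tau$ in $n$ variables with a resolution refutation of size $s$ has a proof of size at most $q(n+|\tau|+s)$ in $\mathsf{CDCL}(\text{DECISION-L},\pi_n\text{-D})$, where $|\tau|$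 is the number of clauses of $\tau$. -/

import Mathlib

namespace OrderedCDCL

/-! ### Literals, clauses, CNFs -/

/-- The literal `x_var ^ sign`: the variable itself if `sign = true`, its negation otherwise.
The same data describe the assignment `x_var = sign`, which satisfies that literal. -/
@[ext]
structure Literal (n : ℕ) where
  var : Fin n
  sign : Bool
deriving DecidableEq

/-- The complementary literal. -/
def Literal.neg {n : ℕ} (l : Literal n) : Literal n := ⟨l.var, !l.sign⟩

/-- A clause is a set of literals in which no variable appears together with its negation. -/
abbrev Clause (n : ℕ) : Type := {s : Finset (Literal n) // ∀ l ∈ s, l.neg ∉ s}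

/-- The empty clause `0`. -/
def Clause.zero (n : ℕ) : Clause n := ⟨∅, by simp⟩

/-- A CNF is a (finite) set of clauses. -/
abbrev CNF (n : ℕ) : Type := Finset (Clause n)

/-- No Boolean assignment satisfies all the clauses. -/
def CNF.Contradictory {n : ℕ} (τ : CNF n) : Prop :=
  ¬ ∃ v : Fin n → Bool, ∀ C ∈ τ, ∃ l ∈ C.1, v l.var = l.sign

/-! ### Resolution and ordered resolution -/

/-- `R = Res(E, F)`, where `E = C ∨ l`, `F = D ∨ ¬l` and `R = C ∨ D`
(which has to be a clause, that is, it contains no complementary literals). -/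
def IsResolvent {n : ℕ} (E F : Clause n) (l : Literal n) (R : Clause n) : Prop :=
  l ∈ E.1 ∧ l.neg ∈ F.1 ∧ R.1 = E.1.erase l ∪ F.1.erase l.neg

/-- A sequence of clauses in which every clause belongs to `τ` or follows from two earlier
clauses by the resolution rule on a literal `l`, with conclusion `R`, such that `side l R`. -/
def IsDerivation {n : ℕ} (side : Literal n → Clause n → Prop) (τ : CNF n)
    (P : List (Clause n)) : Prop :=
  ∀ (k : ℕ) (hk : k < P.length), P[k] ∈ τ ∨
    ∃ (i j : ℕ) (hi : i < k) (hj : j < k) (l : Literal n),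
      IsResolvent P[i] P[j] l P[k] ∧ side l P[k]

/-- A resolution refutation of `τ`. -/
def IsResRefutation {n : ℕ} (τ : CNF n) (P : List (Clause n)) : Prop :=
  IsDerivation (fun _ _ => True) τ P ∧ Clause.zero n ∈ P

/-- A `π`-ordered resolution refutation of `τ`: the resolved variable is larger, with respect to
`π`, than all the variables of the conclusion. -/
def IsOrderedRefutation {n : ℕ} (π : Equiv.Perm (Fin n)) (τ : CNF n)
    (P : List (Clause n)) : Prop :=
  IsDerivation (fun l R => ∀ m ∈ R.1, π m.var < π l.var) τ P ∧ Clause.zero n ∈ P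

/-! ### Trails, states and actions of CDCL -/

/-- An annotated assignment `x = a`: a decision (`d`) or a unit propagation (`u`). -/
inductive Ann
  | d
  | u
deriving DecidableEq

@[ext]
structure AnnAssignment (n : ℕ) where
  lit : Literal n
  ann : Ann
deriving DecidableEq

/-- A trail is an ordered list of annotated assignments. The variables of a trail are
pairwise distinct in every state that can be reached from an empty trail, because
decisions and unit propagations only assign variables that are unassigned so far. -/
abbrev Trail (n : ℕ) : Type := List (AnnAssignment n)

/-- The variable `x` appears in the trail `t`. -/
def Trail.Assigns {n : ℕ} (t : Trail n) (x : Fin n) : Prop := ∃ e ∈ t, e.lit.var = x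

/-- The literals satisfied by the trail. -/
def Trail.lits {n : ℕ} (t : Trail n) : List (Literal n) := t.map AnnAssignment.lit

/-- The restriction `C|_t`: `none` stands for the constant `1` (some literal of `C` is satisfied),
otherwise the falsified literals are removed. -/
def Clause.restrict {n : ℕ} (C : Clause n) (t : Trail n) : Option (Finset (Literal n)) :=
  if ∃ l ∈ C.1, l ∈ t.lits then none else some (C.1.filter fun l => l.neg ∉ t.lits)

/-- A state `(ℂ, t)`. -/
structure State (n : ℕ) where
  clauses : CNF n
  trail : Trail n

/-- A state is terminal if all its clauses are satisfied by its trail, or if it contains `0`. -/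
def State.Terminal {n : ℕ} (S : State n) : Prop :=
  (∀ C ∈ S.clauses, C.restrict S.trail = none) ∨ Clause.zero n ∈ S.clauses

/-- One step of conflict analysis at the annotated assignment `e` that follows the prefix `p`
of the trail. -/
def backStep {n : ℕ} (K : CNF n) (p : Trail n) (e : AnnAssignment n) (X : Set (Clause n)) :
    Set (Clause n) :=
  match e.ann with
  | Ann.d => X
  | Ann.u => {D | D ∈ X ∧ e.lit.neg ∉ D.1} ∪
      {R | ∃ D ∈ X, e.lit.neg ∈ D.1 ∧
        ∃ C ∈ K, C.restrict p = some {e.lit} ∧ IsResolvent C D e.lit R}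

/-- The clauses that can be learned from `(K, p ++ s)` by backtracking up to `p`. -/
def learnableBack {n : ℕ} (K : CNF n) : Trail n → Trail n → Set (Clause n)
  | p, [] => {D | D ∈ K ∧ D.restrict p = some ∅}
  | p, e :: s => backStep K p e (learnableBack K (p ++ [e]) s)

/-- The set `ℂ_k(S)`, for `1 ≤ k ≤ r + 1`, where `r` is the length of the trail. -/
def State.learnableAt {n : ℕ} (S : State n) (k : ℕ) : Set (Clause n) :=
  learnableBack S.clauses (S.trail.take (k - 1)) (S.trail.drop (k - 1))

/-- The set `ℂ(S)`, the union of the sets `ℂ_k(S)` for `1 ≤ k ≤ r`. -/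
def State.learnable {n : ℕ} (S : State n) : Set (Clause n) :=
  {D | ∃ k, 1 ≤ k ∧ k ≤ S.trail.length ∧ D ∈ S.learnableAt k}

/-- `decide l` and `propagate l` make the assignment that satisfies `l`; `learn C t` adds `C` to
the clauses and backtracks to the trail `t`. -/
inductive Action (n : ℕ)
  | decide (l : Literal n)
  | propagate (l : Literal n)
  | learn (C : Clause n) (t : Trail n)

/-- The actions available in the state `S` in the basic model. -/
def State.actions {n : ℕ} (S : State n) : Set (Action n) :=
  {A | match A with
    | .decide l => ¬ S.trail.Assigns l.var
    | .propagate l => ∃ C ∈ S.clauses, C.restrict S.trail = some {l}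
    | .learn C t =>
        (Clause.zero n ∈ S.learnable ∧ C = Clause.zero n ∧ t = []) ∨
        (Clause.zero n ∉ S.learnable ∧ C ∈ S.learnable ∧ C ∉ S.clauses ∧
          t <+: S.trail ∧ C.restrict t ≠ some ∅)}

/-- The transition function. -/
def State.transition {n : ℕ} (S : State n) : Action n → State n
  | .decide l => ⟨S.clauses, S.trail ++ [⟨l, Ann.d⟩]⟩
  | .propagate l => ⟨S.clauses, S.trail ++ [⟨l, Ann.u⟩]⟩
  | .learn C t => ⟨insert C S.clauses, t⟩

/-- An amendment prescribes, for every state, a set of actions that are removed. -/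
abbrev Amendment (n : ℕ) : Type := State n → Set (Action n)

/-- `DECISION-L`: only the clauses in `ℂ_1(S)` may be learned. (The empty clause is in `ℂ(S)` if
and only if the trail is not empty and the empty clause is in `ℂ_1(S)`.) -/
def decisionL (n : ℕ) : Amendment n :=
  fun S => {A | ∃ C t, A = Action.learn C t ∧ C ∉ S.learnableAt 1}

/-- `π-D`: only the `π`-smallest unassigned variable may be decided. -/
def orderedD {n : ℕ} (π : Equiv.Perm (Fin n)) : Amendment n :=
  fun S => {A | ∃ l, A = Action.decide l ∧ ∃ y, ¬ S.trail.Assigns y ∧ π y < π l.var}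

/-- The sequence of actions leads from the first state to the second one, through states that
are nonterminal (except possibly the last one), by actions not removed by any amendment. -/
def IsRun {n : ℕ} (am : List (Amendment n)) : State n → List (Action n) → State n → Prop
  | S, [], T => S = T
  | S, A :: As, T =>
      ¬ S.Terminal ∧ A ∈ S.actions ∧ (∀ a ∈ am, A ∉ a S) ∧ IsRun am (S.transition A) As T

/-- A successful run on `τ`: from `(τ, Λ)` to a terminal state. -/
def IsSuccessfulRun {n : ℕ} (am : List (Amendment n)) (τ : CNF n) (R : List (Action n)) : Prop :=
  ∃ T, IsRun am ⟨τ, []⟩ R T ∧ T.Terminal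

/-! ### Algorithms and their running time -/

/-- Binary trees, the data of our algorithms. -/
inductive Data
  | nil
  | cons (a b : Data)
deriving DecidableEq

namespace Data

/-- The number of nodes and leaves. -/
def size : Data → ℕ
  | nil => 1
  | cons a b => a.size + b.size + 1

def hd : Data → Data
  | nil => nil
  | cons a _ => a

def tl : Data → Data
  | nil => nil
  | cons _ b => b

def ofBool : Bool → Data
  | false => nil
  | true => cons nil nil

/-- Natural numbers are written in unary. -/
def ofNat : ℕ → Data
  | 0 => nil
  | k + 1 => cons nil (ofNat k)

def ofList {α : Type} (f : α → Data) : List α → Data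
  | [] => nil
  | a :: l => cons (f a) (ofList f l)

end Data

/-- Programs of a WHILE language that computes with binary trees. A program maps a
tree to a tree; `eq` compares the two subtrees of its input. -/
inductive Prog
  | id
  | nil
  | hd
  | tl
  | eq
  | cons (f g : Prog)
  | comp (g f : Prog)
  | ite (b f g : Prog)
  | while (b f : Prog)

/-- `Eval p x y c`: the program `p`, started on `x`, halts with the result `y` at cost `c`.
An elementary operation costs the size of the tree that it reads and `cons` also costs the size
of the tree that it builds, so that the trees that occur in a computation are, up to an additive
constant, no larger than its cost. Hence the cost is, up to a polynomial, the running time on a Turing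
machine. The tree `nil` is the truth value false, all the others are true. -/
inductive Prog.Eval : Prog → Data → Data → ℕ → Prop
  | id (x : Data) : Eval Prog.id x x x.size
  | nil (x : Data) : Eval Prog.nil x Data.nil x.size
  | hd (x : Data) : Eval Prog.hd x x.hd x.size
  | tl (x : Data) : Eval Prog.tl x x.tl x.size
  | eq (x : Data) : Eval Prog.eq x (Data.ofBool (decide (x.hd = x.tl))) x.size
  | cons {f g : Prog} {x y z : Data} {c d : ℕ} :
      Eval f x y c → Eval g x z d → Eval (Prog.cons f g) x (Data.cons y z)
        (c + d + (Data.cons y z).size)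
  | comp {f g : Prog} {x y z : Data} {c d : ℕ} :
      Eval f x y c → Eval g y z d → Eval (Prog.comp g f) x z (c + d + 1)
  | iteTrue {b f g : Prog} {x y z : Data} {c d : ℕ} :
      Eval b x y c → y ≠ Data.nil → Eval f x z d → Eval (Prog.ite b f g) x z (c + d + 1)
  | iteFalse {b f g : Prog} {x z : Data} {c d : ℕ} :
      Eval b x Data.nil c → Eval g x z d → Eval (Prog.ite b f g) x z (c + d + 1)
  | whileTrue {b f : Prog} {x v y z : Data} {c d e : ℕ} :
      Eval b x v c → v ≠ Data.nil → Eval f x y d → Eval (Prog.while b f) y z e →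
        Eval (Prog.while b f) x z (c + d + e + 1)
  | whileFalse {b f : Prog} {x : Data} {c : ℕ} :
      Eval b x Data.nil c → Eval (Prog.while b f) x x (c + 1)

/-! ### Encodings -/

/-- A clause is the list, over all the variables, of the way in which the variable occurs:
`0` if it does not occur, `1` if it occurs negated, `2` if it occurs unnegated. -/
def Clause.encode {n : ℕ} (C : Clause n) : Data :=
  Data.ofList Data.ofNat (List.ofFn fun i : Fin n =>
    if ⟨i, true⟩ ∈ C.1 then 2 else if ⟨i, false⟩ ∈ C.1 then 1 else 0)

def Literal.encode {n : ℕ} (l : Literal n) : Data :=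
  Data.cons (Data.ofNat l.var) (Data.ofBool l.sign)

def AnnAssignment.encode {n : ℕ} (e : AnnAssignment n) : Data :=
  Data.cons e.lit.encode (Data.ofBool (decide (e.ann = Ann.u)))

def Action.encode {n : ℕ} : Action n → Data
  | .decide l => Data.cons (Data.ofNat 0) l.encode
  | .propagate l => Data.cons (Data.ofNat 1) l.encode
  | .learn C t => Data.cons (Data.ofNat 2)
      (Data.cons C.encode (Data.ofList AnnAssignment.encode t))

theorem Data.ofBool_injective : Function.Injective Data.ofBool := by
  intro a b h
  cases a <;> cases b <;> simp_all [Data.ofBool]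

theorem Data.ofNat_injective : Function.Injective Data.ofNat := by
  intro a
  induction a with
  | zero => intro b h; cases b <;> simp_all [Data.ofNat]
  | succ a ih =>
    intro b h
    cases b with
    | zero => simp [Data.ofNat] at h
    | succ b => simp only [Data.ofNat, Data.cons.injEq, true_and] at h; rw [ih h]

theorem Data.ofList_injective {α : Type} {f : α → Data} (hf : Function.Injective f) :
    Function.Injective (Data.ofList f) := by
  intro a
  induction a with
  | nil => intro b h; cases b <;> simp_all [Data.ofList]
  | cons a l ih =>
    intro b h
    cases b with
    | nil => simp [Data.ofList] at h
    | cons b m =>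
      simp only [Data.ofList, Data.cons.injEq] at h
      rw [hf h.1, ih h.2]

theorem Clause.encode_injective {n : ℕ} : Function.Injective (Clause.encode (n := n)) := by
  intro C D h
  have h1 := List.ofFn_injective (Data.ofList_injective Data.ofNat_injective h)
  apply Subtype.ext
  ext ⟨i, s⟩
  have h2 := congrFun h1 i
  have hC := C.2 ⟨i, true⟩
  have hD := D.2 ⟨i, true⟩
  simp only [Literal.neg, Bool.not_true] at hC hD
  cases s <;> split_ifs at h2 <;> simp_all

theorem Literal.encode_injective {n : ℕ} : Function.Injective (Literal.encode (n := n)) := by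
  intro a b h
  simp only [Literal.encode, Data.cons.injEq] at h
  exact Literal.ext (Fin.ext (Data.ofNat_injective h.1)) (Data.ofBool_injective h.2)

theorem AnnAssignment.encode_injective {n : ℕ} :
    Function.Injective (AnnAssignment.encode (n := n)) := by
  rintro ⟨a, s⟩ ⟨b, t⟩ h
  simp only [AnnAssignment.encode, Data.cons.injEq] at h
  have h1 := Literal.encode_injective h.1
  have h2 := Data.ofBool_injective h.2
  cases s <;> cases t <;> simp_all

theorem Action.encode_injective {n : ℕ} : Function.Injective (Action.encode (n := n)) := by
  intro A B h
  cases A <;> cases B <;> simp only [Action.encode, Data.ofNat, Data.cons.injEq] at h <;>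
    simp_all
  · exact Literal.encode_injective h
  · exact Literal.encode_injective h
  · exact ⟨Clause.encode_injective h.1,
      Data.ofList_injective AnnAssignment.encode_injective h.2⟩

/-! ### Proof systems and simulations -/

/-- A system for refuting CNFs in `n` variables: its proofs, the relation of being a refutation
of a CNF, the size of a proof, and the way in which proofs are presented to algorithms. -/
structure RefutationSystem (n : ℕ) where
  Proof : Type
  IsRefutation : CNF n → Proof → Prop
  size : Proof → ℕ
  encode : Proof → Data
  encode_injective : Function.Injective encode

/-- General resolution. The size of a proof is the number of its lines. -/
def resolution (n : ℕ) : RefutationSystem n where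
  Proof := List (Clause n)
  IsRefutation := IsResRefutation
  size := List.length
  encode := Data.ofList Clause.encode
  encode_injective := Data.ofList_injective Clause.encode_injective

/-- `π`-ordered resolution. The size of a proof is the number of its lines. -/
def orderedResolution {n : ℕ} (π : Equiv.Perm (Fin n)) : RefutationSystem n where
  Proof := List (Clause n)
  IsRefutation := IsOrderedRefutation π
  size := List.length
  encode := Data.ofList Clause.encode
  encode_injective := Data.ofList_injective Clause.encode_injective

/-- `CDCL(am)`: the proofs are the successful runs, given by their actions (which, together
with the initial CNF, determine the states). The size is the number of actions. -/
def cdcl {n : ℕ} (am : List (Amendment n)) : RefutationSystem n where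
  Proof := List (Action n)
  IsRefutation := IsSuccessfulRun am
  size := List.length
  encode := Data.ofList Action.encode
  encode_injective := Data.ofList_injective Action.encode_injective

/-- The input of a simulation: the number of variables, the order `π`, a list of the clauses
of the CNF, and an encoded proof. -/
def simulationInput {n : ℕ} (π : Equiv.Perm (Fin n)) (τ : List (Clause n)) (P : Data) : Data :=
  Data.cons (Data.ofNat n) (Data.cons (Data.ofList (fun i : Fin n => Data.ofNat i) (List.ofFn π))
    (Data.cons (Data.ofList Clause.encode τ) P))

/-- `P` `p`-simulates `Q`, where `P` and `Q` are systems for every number of variables `n`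
and every order `π`: some polynomial time algorithm transforms every `Q`-refutation of
a contradictory CNF into a `P`-refutation of the same CNF; moreover, the size of the result is
polynomial in `n` and in the size of the given refutation alone. -/
def PSimulates (P Q : ∀ n : ℕ, Equiv.Perm (Fin n) → RefutationSystem n) : Prop :=
  ∃ (M : Prog) (q : Polynomial ℕ), ∀ (n : ℕ) (π : Equiv.Perm (Fin n)) (τ : List (Clause n)),
    CNF.Contradictory τ.toFinset →
    ∀ A : (Q n π).Proof, (Q n π).IsRefutation τ.toFinset A →
      ∃ B : (P n π).Proof, (P n π).IsRefutation τ.toFinset B ∧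
        (∃ c : ℕ, M.Eval (simulationInput π τ ((Q n π).encode A)) ((P n π).encode B) c ∧
          c ≤ q.eval (simulationInput π τ ((Q n π).encode A)).size) ∧
        (P n π).size B ≤ q.eval (n + (Q n π).size A)

/-- Two systems are polynomially equivalent if they `p`-simulate each other. -/
def PolyEquivalent (P Q : ∀ n : ℕ, Equiv.Perm (Fin n) → RefutationSystem n) : Prop :=
  PSimulates P Q ∧ PSimulates Q P

/-- `P` simulates `Q` in the weakest sense: whenever a contradictory CNF has a `Q`-refutation,
it has a `P`-refutation of size polynomial in the number of variables, the number of clauses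
and the size of the `Q`-refutation. The `P`-refutation need not be found efficiently. -/
def SizeSimulates (P Q : ∀ n : ℕ, RefutationSystem n) : Prop :=
  ∃ q : Polynomial ℕ, ∀ (n : ℕ) (τ : CNF n), τ.Contradictory →
    ∀ A : (Q n).Proof, (Q n).IsRefutation τ A →
      ∃ B : (P n).Proof, (P n).IsRefutation τ B ∧
        (P n).size B ≤ q.eval (n + τ.card + (Q n).size A)

end OrderedCDCL

open OrderedCDCL

/-!
From an ordered refutation, CDCL learns the lines one after another. To learn a resolvent `C` of
`E` and `F` on `x`, decide the variables below `x` in increasing order so that `C` becomes false;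
then `E` propagates `x`, which falsifies `F`, and conflict analysis yields `C`.

Conversely, every propagated literal used in a DECISION-L conflict analysis is implied by the
decisions before it, and these have smaller variables, since a decision takes the smallest
unassigned one. Hence a CDCL proof yields a derivation with weakening in which one of the two
clauses of each resolution obeys the order, and such a derivation can be searched for a falsified
clause of `τ`, reading the variables in the order `π`. The clauses the search can be at after
reading the `k` smallest variables form a row, and the rows, suitably labelled and read from the
last one to the first, are a `π`-ordered refutation.

For the separation, weaken each clause of the chain `1 → y₁ → ⋯ → yₘ → 0` by `xᵢ` and by `¬xᵢ`.
Resolving on the `xᵢ` first gives a refutation of linear size. If the `xᵢ` come before the `yⱼ`,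
then an ordered refutation must eliminate all the `yⱼ` first, and it contains a clause with the
literals `xᵢ = βᵢ` for each of the exponentially many `β`.
-/

namespace OrderedCDCL

/-! ### Polynomial bounds -/

theorem eval_mono (q : Polynomial ℕ) : Monotone fun a => q.eval a := by
  intro a b h
  induction q using Polynomial.induction_on' with
  | add p q hp hq => simpa using add_le_add hp hq
  | monomial k c => simpa using Nat.mul_le_mul_left c (Nat.pow_le_pow_left h k)

/-- `k` is bounded by a polynomial in the size measure `s`. -/
def PolyBdd {X : Type} (s k : X → ℕ) : Prop :=
  ∃ q : Polynomial ℕ, ∀ x, k x ≤ q.eval (s x)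

namespace PolyBdd

variable {X Y : Type} {s k m : X → ℕ}

theorem mono (h : PolyBdd s k) (hm : ∀ x, m x ≤ k x) : PolyBdd s m :=
  h.imp fun _ hq x => (hm x).trans (hq x)

theorem self : PolyBdd s s := ⟨Polynomial.X, fun x => by simp⟩

theorem const (c : ℕ) : PolyBdd s (fun _ => c) := ⟨Polynomial.C c, fun x => by simp⟩

theorem eval (q : Polynomial ℕ) (h : PolyBdd s k) : PolyBdd s (fun x => q.eval (k x)) := by
  obtain ⟨r, hr⟩ := h
  exact ⟨q.comp r, fun x => by simpa using eval_mono q (hr x)⟩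

theorem add (h : PolyBdd s k) (h' : PolyBdd s m) : PolyBdd s (fun x => k x + m x) := by
  obtain ⟨q, hq⟩ := h
  obtain ⟨r, hr⟩ := h'
  exact ⟨q + r, fun x => by simpa using add_le_add (hq x) (hr x)⟩

theorem mul (h : PolyBdd s k) (h' : PolyBdd s m) : PolyBdd s (fun x => k x * m x) := by
  obtain ⟨q, hq⟩ := h
  obtain ⟨r, hr⟩ := h'
  exact ⟨q * r, fun x => by simpa using Nat.mul_le_mul (hq x) (hr x)⟩

theorem trans (h : PolyBdd s k) (h' : PolyBdd k m) : PolyBdd s m := by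
  obtain ⟨r, hr⟩ := h'
  exact (h.eval r).mono hr

theorem comp (h : PolyBdd s k) (f : Y → X) : PolyBdd (fun y => s (f y)) (fun y => k (f y)) :=
  h.imp fun _ hq y => hq (f y)

end PolyBdd

/-! ### The size of encoded data -/

/-- Types whose elements are presented to programs as trees. -/
class DataEncodable (α : Type) where
  toData : α → Data
  toData_injective : Function.Injective toData

open DataEncodable

section Encodings

variable {n : ℕ} {α β : Type}

instance : DataEncodable Data := ⟨id, Function.injective_id⟩

instance : DataEncodable Bool := ⟨Data.ofBool, Data.ofBool_injective⟩

instance : DataEncodable ℕ := ⟨Data.ofNat, Data.ofNat_injective⟩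

instance : DataEncodable (Fin n) :=
  ⟨fun i => Data.ofNat i, Data.ofNat_injective.comp Fin.val_injective⟩

instance : DataEncodable (Literal n) := ⟨Literal.encode, Literal.encode_injective⟩

instance : DataEncodable (Clause n) := ⟨Clause.encode, Clause.encode_injective⟩

instance : DataEncodable (AnnAssignment n) :=
  ⟨AnnAssignment.encode, AnnAssignment.encode_injective⟩

instance : DataEncodable (Action n) := ⟨Action.encode, Action.encode_injective⟩

instance [DataEncodable α] : DataEncodable (List α) :=
  ⟨Data.ofList toData, Data.ofList_injective toData_injective⟩

instance [DataEncodable α] [DataEncodable β] : DataEncodable (α × β) where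
  toData p := Data.cons (toData p.1) (toData p.2)
  toData_injective p q h := by
    simp only [Data.cons.injEq] at h
    exact Prod.ext (toData_injective h.1) (toData_injective h.2)

instance {β : α → Type} [DataEncodable α] [∀ a, DataEncodable (β a)] :
    DataEncodable (Σ a, β a) where
  toData p := Data.cons (toData p.1) (toData p.2)
  toData_injective := by
    rintro ⟨a, b⟩ ⟨a', b'⟩ h
    simp only [Data.cons.injEq] at h
    obtain rfl := toData_injective h.1
    rw [toData_injective h.2]

end Encodings

theorem Data.size_pos (d : Data) : 0 < d.size := by
  cases d <;> simp [Data.size]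

theorem Data.size_hd_le (d : Data) : d.hd.size ≤ d.size := by
  cases d <;> simp only [Data.size, Data.hd] <;> omega

theorem Data.size_tl_le (d : Data) : d.tl.size ≤ d.size := by
  cases d <;> simp only [Data.size, Data.tl] <;> omega

theorem Data.size_ofBool_le (b : Bool) : (Data.ofBool b).size ≤ 3 := by
  cases b <;> simp [Data.size, Data.ofBool]

/-- The size of the tree that encodes `x`. -/
def dataSize {α : Type} [DataEncodable α] (x : α) : ℕ := (toData x).size

section DataSize

variable {α β : Type} [DataEncodable α] [DataEncodable β]

theorem dataSize_pos (x : α) : 0 < dataSize x := Data.size_pos _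

@[simp]
theorem dataSize_prod (x : α × β) : dataSize x = dataSize x.1 + dataSize x.2 + 1 := rfl

@[simp]
theorem dataSize_sigma {β : α → Type} [∀ a, DataEncodable (β a)] (x : Σ a, β a) :
    dataSize x = dataSize x.1 + dataSize x.2 + 1 := rfl

@[simp]
theorem dataSize_nil : dataSize ([] : List α) = 1 := rfl

@[simp]
theorem dataSize_cons (a : α) (l : List α) :
    dataSize (a :: l) = dataSize a + dataSize l + 1 := rfl

theorem dataSize_append (l m : List α) :
    dataSize (l ++ m) + 1 = dataSize l + dataSize m := by
  induction l with
  | nil => rw [List.nil_append, dataSize_nil, Nat.add_comm]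
  | cons a l ih => simp only [List.cons_append, dataSize_cons]; omega

theorem length_lt_dataSize (l : List α) : l.length < dataSize l := by
  induction l with
  | nil => simp
  | cons a l ih => simp only [dataSize_cons, List.length_cons]; omega

theorem dataSize_lt_of_mem {l : List α} {a : α} (h : a ∈ l) : dataSize a < dataSize l := by
  obtain ⟨l, m, rfl⟩ := List.append_of_mem h
  have hsize := dataSize_append l (a :: m)
  have := dataSize_pos l
  have := dataSize_pos m
  simp only [dataSize_cons] at hsize
  omega

theorem dataSize_le_of_suffix {l m : List α} (h : l <:+ m) : dataSize l ≤ dataSize m := by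
  obtain ⟨k, rfl⟩ := h
  have := dataSize_append k l
  have := dataSize_pos k
  omega

theorem dataSize_list_le {l : List α} {k : ℕ} (h : ∀ a ∈ l, dataSize a ≤ k) :
    dataSize l ≤ l.length * (k + 1) + 1 := by
  induction l with
  | nil => simp
  | cons a l ih =>
    have hl := ih fun b hb => h b (List.mem_cons_of_mem a hb)
    have ha := h a List.mem_cons_self
    simp only [dataSize_cons, List.length_cons, Nat.add_mul]
    omega

end DataSize

/-! ### Polynomial time computability -/

theorem Prog.Eval.input_size_le {M : Prog} {x y : Data} {c : ℕ} (h : M.Eval x y c) :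
    x.size ≤ c := by
  induction h <;> omega

theorem Prog.Eval.output_size_le {M : Prog} {x y : Data} {c : ℕ} (h : M.Eval x y c) :
    y.size ≤ c + 2 := by
  induction h with
  | id x => omega
  | nil x => have := x.size_pos; simp only [Data.size]; omega
  | hd x => have := x.size_hd_le; omega
  | tl x => have := x.size_tl_le; omega
  | eq x =>
    have := x.size_pos
    have := Data.size_ofBool_le (decide (x.hd = x.tl))
    omega
  | cons => omega
  | comp => omega
  | iteTrue => omega
  | iteFalse => omega
  | whileTrue => omega
  | whileFalse hb => have := hb.input_size_le; omega

/-- Some program computes `f x` from `x`, for every `x`, in polynomial time. The type of the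
result may depend on the input; a function of several arguments is presented as a function on
a product or sigma type. -/
def PolyTime {X : Type} {α : X → Type} [DataEncodable X] [∀ x, DataEncodable (α x)]
    (f : ∀ x, α x) : Prop :=
  ∃ (M : Prog) (c : X → ℕ), PolyBdd dataSize c ∧ ∀ x, M.Eval (toData x) (toData (f x)) (c x)

namespace PolyTime

variable {X : Type} [DataEncodable X]

section Basic

variable {α β : X → Type} [∀ x, DataEncodable (α x)] [∀ x, DataEncodable (β x)]

theorem congr_toData {f : ∀ x, α x} {g : ∀ x, β x} (hf : PolyTime f)
    (h : ∀ x, toData (f x) = toData (g x)) : PolyTime g := by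
  obtain ⟨M, c, hc, hM⟩ := hf
  exact ⟨M, c, hc, fun x => h x ▸ hM x⟩

theorem toData_iff {f : ∀ x, α x} : (PolyTime fun x => toData (f x)) ↔ PolyTime f := Iff.rfl

theorem congr {f g : ∀ x, α x} (hf : PolyTime f) (h : ∀ x, f x = g x) : PolyTime g :=
  funext h ▸ hf

theorem dataSize_bdd {f : ∀ x, α x} (hf : PolyTime f) :
    PolyBdd dataSize fun x => dataSize (f x) := by
  obtain ⟨M, c, hc, hM⟩ := hf
  exact (hc.add (.const 2)).mono fun x => (hM x).output_size_le

protected theorem id : PolyTime fun x : X => x := ⟨.id, _, .self, fun _ => .id _⟩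

theorem eval_comp {f : ∀ x, α x} {g : ∀ x, β x} (hf : PolyTime f) (M : Prog) {c : X → ℕ}
    (hc : PolyBdd dataSize c) (hM : ∀ x, ∃ d ≤ c x, M.Eval (toData (f x)) (toData (g x)) d) :
    PolyTime g := by
  obtain ⟨M₀, c₀, hc₀, hM₀⟩ := hf
  choose d hd hM using hM
  exact ⟨.comp M M₀, _, (hc₀.add (hc.mono hd)).add (.const 1), fun x => .comp (hM₀ x) (hM x)⟩

theorem comp {Y : Type} [DataEncodable Y] {f : ∀ x, α x} {g : Y → X} (hf : PolyTime f)
    (hg : PolyTime g) : PolyTime fun y => f (g y) := by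
  obtain ⟨M, c, hc, hM⟩ := hf
  exact hg.eval_comp M (hg.dataSize_bdd.trans (hc.comp g)) fun y => ⟨_, le_rfl, hM (g y)⟩

theorem hd {d : X → Data} (h : PolyTime d) : PolyTime fun x => (d x).hd :=
  h.eval_comp .hd h.dataSize_bdd fun _ => ⟨_, le_rfl, .hd _⟩

theorem tl {d : X → Data} (h : PolyTime d) : PolyTime fun x => (d x).tl :=
  h.eval_comp .tl h.dataSize_bdd fun _ => ⟨_, le_rfl, .tl _⟩

theorem pair {f : ∀ x, α x} {g : ∀ x, β x} (hf : PolyTime f) (hg : PolyTime g) :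
    PolyTime fun x => (f x, g x) := by
  have hsize := (hf.dataSize_bdd.add hg.dataSize_bdd).add (.const 1)
  obtain ⟨M, c, hc, hM⟩ := hf
  obtain ⟨N, d, hd, hN⟩ := hg
  exact ⟨.cons M N, _, (hc.add hd).add hsize, fun x => .cons (hM x) (hN x)⟩

theorem fst {f : ∀ x, α x × β x} (hf : PolyTime f) : PolyTime fun x => (f x).1 :=
  (toData_iff.2 hf).hd

theorem snd {f : ∀ x, α x × β x} (hf : PolyTime f) : PolyTime fun x => (f x).2 :=
  (toData_iff.2 hf).tl

theorem sigmaFst : PolyTime fun p : Σ x, α x => p.1 :=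
  (toData_iff.2 PolyTime.id).hd

theorem sigmaSnd : PolyTime fun p : Σ x, α x => p.2 :=
  (toData_iff.2 PolyTime.id).tl

theorem weaken {f : ∀ x, α x} (hf : PolyTime f) : PolyTime fun p : Σ x, β x => f p.1 :=
  hf.comp sigmaFst

theorem comp₂ {Y : Type} [DataEncodable Y] {f : ∀ x, α x → β x} {u : Y → X}
    {a : ∀ y, α (u y)} (hf : PolyTime fun p : Σ x, α x => f p.1 p.2) (hu : PolyTime u)
    (ha : PolyTime a) : PolyTime fun y => f (u y) (a y) :=
  hf.comp (g := fun y => ⟨u y, a y⟩) (hu.pair ha)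

protected theorem const {α : Type} [DataEncodable α] (a : α) : PolyTime fun _ : X => a := by
  suffices ∀ d : Data, PolyTime fun _ : X => d from
    this (toData a)
  intro d
  induction d with
  | nil => exact ⟨.nil, _, .self, fun _ => .nil _⟩
  | cons d e hd he => exact hd.pair he

theorem ite {p : X → Prop} [∀ x, Decidable (p x)] {f g : ∀ x, α x}
    (hp : PolyTime fun x => decide (p x)) (hf : PolyTime f) (hg : PolyTime g) :
    PolyTime fun x => if p x then f x else g x := by
  obtain ⟨B, b, hb, hB⟩ := hp
  obtain ⟨M, c, hc, hM⟩ := hf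
  obtain ⟨N, d, hd, hN⟩ := hg
  refine ⟨.ite B M N, fun x => if p x then b x + c x + 1 else b x + d x + 1,
    ((hb.add (hc.add hd)).add (.const 1)).mono fun x => ?_, fun x => ?_⟩
  · split_ifs <;> omega
  · have hBx := hB x
    by_cases hx : p x
    · simp only [hx, if_true, decide_true] at hBx ⊢
      exact .iteTrue hBx Data.noConfusion (hM x)
    · simp only [hx, if_false, decide_false] at hBx ⊢
      exact .iteFalse hBx (hN x)

theorem decide_eq {f g : ∀ x, α x} [∀ x, Decidable (f x = g x)] (hf : PolyTime f)
    (hg : PolyTime g) : PolyTime fun x => decide (f x = g x) :=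
  (hf.pair hg).eval_comp .eq (hf.pair hg).dataSize_bdd fun x => by
    refine ⟨_, le_rfl, ?_⟩
    rw [show toData (decide (f x = g x)) = Data.ofBool (decide (toData (f x) = toData (g x))) by
      simp only [toData_injective.eq_iff]; rfl]
    exact .eq (toData (f x, g x))

end Basic

section Bool

variable {b c : X → Bool}

theorem decide_eq_true (hb : PolyTime b) : PolyTime fun x => decide (b x = true) :=
  hb.congr fun _ => Bool.decide_eq_true.symm

theorem not (hb : PolyTime b) : PolyTime fun x => !b x :=
  (ite hb.decide_eq_true (.const false) (.const true)).congr fun x => by cases b x <;> rfl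

theorem and (hb : PolyTime b) (hc : PolyTime c) : PolyTime fun x => b x && c x :=
  (ite hb.decide_eq_true hc (.const false)).congr fun x => by cases b x <;> rfl

theorem or (hb : PolyTime b) (hc : PolyTime c) : PolyTime fun x => b x || c x :=
  (ite hb.decide_eq_true (.const true) hc).congr fun x => by cases b x <;> rfl

variable {p q : X → Prop} [∀ x, Decidable (p x)] [∀ x, Decidable (q x)]

theorem decide_and (hp : PolyTime fun x => decide (p x)) (hq : PolyTime fun x => decide (q x)) :
    PolyTime fun x => decide (p x ∧ q x) := by
  simpa using hp.and hq

theorem decide_or (hp : PolyTime fun x => decide (p x)) (hq : PolyTime fun x => decide (q x)) :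
    PolyTime fun x => decide (p x ∨ q x) := by
  simpa using hp.or hq

end Bool

section List

variable {α β : X → Type} [∀ x, DataEncodable (α x)] [∀ x, DataEncodable (β x)]
  {l m : ∀ x, List (α x)}

theorem nil : PolyTime fun x => ([] : List (α x)) :=
  PolyTime.const Data.nil

theorem cons {a : ∀ x, α x} (ha : PolyTime a) (hl : PolyTime l) :
    PolyTime fun x => a x :: l x :=
  ha.pair hl

theorem isEmpty (hl : PolyTime l) : PolyTime fun x => (l x).isEmpty := by
  classical
  exact (hl.decide_eq nil).congr fun x => by cases l x <;> simp

theorem headD {d : ∀ x, α x} (hl : PolyTime l) (hd : PolyTime d) :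
    PolyTime fun x => (l x).headD (d x) :=
  (ite hl.isEmpty.decide_eq_true (toData_iff.2 hd) (toData_iff.2 hl).hd).congr_toData fun x => by
    cases l x <;> rfl

theorem length_bdd (hl : PolyTime l) : PolyBdd dataSize fun x => (l x).length :=
  hl.dataSize_bdd.mono fun _ => (length_lt_dataSize _).le

end List

end PolyTime

open DataEncodable

/-! ### Loops over lists -/

theorem Prog.eval_while_foldl {X α β : Type} [DataEncodable X] [DataEncodable α]
    [DataEncodable β] {B M : Prog} {x : X} {step : β → α → β} {W : ℕ} (l : List α) (b : β)
    (hB : ∀ l₁ l₂, l = l₁ ++ l₂ → ∃ c ≤ W,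
      B.Eval (toData (x, l₁.foldl step b, l₂)) (toData l₂) c)
    (hM : ∀ l₁ a l₂, l = l₁ ++ a :: l₂ → ∃ c ≤ W,
      M.Eval (toData (x, l₁.foldl step b, a :: l₂))
        (toData (x, (l₁ ++ [a]).foldl step b, l₂)) c) :
    ∃ c ≤ (l.length + 1) * (2 * W + 1),
      (Prog.while B M).Eval (toData (x, b, l)) (toData (x, l.foldl step b, ([] : List α))) c := by
  induction l generalizing b with
  | nil =>
    obtain ⟨c, hc, h⟩ := hB [] [] rfl
    exact ⟨c + 1, by simp only [List.length_nil]; omega, .whileFalse h⟩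
  | cons a l ih =>
    obtain ⟨guardCost, hguard, guard⟩ := hB [] (a :: l) rfl
    obtain ⟨bodyCost, hbody, body⟩ := hM [] a l rfl
    obtain ⟨restCost, hrest, rest⟩ := ih (step b a)
      (fun l₁ l₂ hl => hB (a :: l₁) l₂ (congrArg (a :: ·) hl))
      (fun l₁ a' l₂ hl => hM (a :: l₁) a' l₂ (congrArg (a :: ·) hl))
    refine ⟨guardCost + bodyCost + restCost + 1, ?_,
      .whileTrue guard Data.noConfusion body rest⟩
    rw [List.length_cons, Nat.add_mul (l.length + 1)]
    omega

namespace PolyTime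

variable {X : Type} [DataEncodable X] {α β : X → Type} [∀ x, DataEncodable (α x)]
  [∀ x, DataEncodable (β x)] {l : ∀ x, List (α x)}

section Fold

variable {b₀ : ∀ x, β x} {step : ∀ x, β x → α x → β x}

theorem foldl (hl : PolyTime l) (h₀ : PolyTime b₀)
    (hs : PolyTime fun p : Σ x, β x × α x => step p.1 p.2.1 p.2.2) {k : X → ℕ}
    (hk : PolyBdd dataSize k)
    (hbd : ∀ x l₁, l₁ <+: l x → dataSize (l₁.foldl (step x) (b₀ x)) ≤ k x) :
    PolyTime fun x => (l x).foldl (step x) (b₀ x) := by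
  have body : PolyTime fun p : Σ x, β x × α x × List (α x) =>
      ((p.1, step p.1 p.2.1 p.2.2.1, p.2.2.2) : X × β p.1 × List (α p.1)) :=
    sigmaFst.pair ((hs.comp₂ (f := fun x (q : β x × α x) => step x q.1 q.2) sigmaFst
      (sigmaSnd.fst.pair sigmaSnd.snd.fst)).pair sigmaSnd.snd.snd)
  obtain ⟨B, cB, ⟨q, hq⟩, hB⟩ := (sigmaSnd.snd : PolyTime fun p : Σ x, β x × List (α x) => p.2.2)
  obtain ⟨M, cM, ⟨r, hr⟩, hM⟩ := body
  let stateBound : X → ℕ := fun x => dataSize x + k x + dataSize (l x) + 2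
  have stateBound_bdd : PolyBdd dataSize stateBound :=
    ((PolyBdd.self.add hk).add hl.dataSize_bdd).add (.const 2)
  have le_stateBound : ∀ x l₁ l₂, l x = l₁ ++ l₂ →
      dataSize (x, l₁.foldl (step x) (b₀ x), l₂) ≤ stateBound x := by
    intro x l₁ l₂ h
    have hacc := hbd x l₁ ⟨l₂, h.symm⟩
    have hrest := dataSize_le_of_suffix ⟨l₁, h.symm⟩
    simp only [dataSize_prod, stateBound]
    omega
  have loop : PolyTime fun x =>
      ((x, (l x).foldl (step x) (b₀ x), []) : X × β x × List (α x)) := by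
    refine (PolyTime.id.pair (h₀.pair hl)).eval_comp (.while B M)
      (c := fun x => ((l x).length + 1) *
        (2 * (q.eval (stateBound x) + r.eval (stateBound x)) + 1)) ?_ fun x => ?_
    · exact (hl.length_bdd.add (.const 1)).mul (((PolyBdd.const 2).mul
        ((stateBound_bdd.eval q).add (stateBound_bdd.eval r))).add (.const 1))
    · refine Prog.eval_while_foldl _ _ (fun l₁ l₂ h => ?_) fun l₁ a l₂ h => ?_
      · exact ⟨_, ((hq _).trans (eval_mono q (le_stateBound x l₁ l₂ h))).trans
          (Nat.le_add_right _ _), hB ⟨x, l₁.foldl (step x) (b₀ x), l₂⟩⟩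
      · rw [List.foldl_append]
        exact ⟨_, ((hr _).trans (eval_mono r (le_stateBound x l₁ (a :: l₂) h))).trans
          (Nat.le_add_left _ _), hM ⟨x, l₁.foldl (step x) (b₀ x), a, l₂⟩⟩
  exact loop.snd.fst

theorem dataSize_foldl_le {γ δ : Type} [DataEncodable γ] {step : γ → δ → γ} {k : ℕ}
    (l : List δ) (c : γ) (h : ∀ c, ∀ a ∈ l, dataSize (step c a) ≤ dataSize c + k) :
    dataSize (l.foldl step c) ≤ dataSize c + l.length * k := by
  induction l generalizing c with
  | nil => simp
  | cons a l ih =>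
    have hhead := h c a List.mem_cons_self
    have htail := ih (step c a) fun c b hb => h c b (List.mem_cons_of_mem a hb)
    simp only [List.foldl_cons, List.length_cons, Nat.add_mul]
    omega

theorem foldl_of_additive (hl : PolyTime l) (h₀ : PolyTime b₀)
    (hs : PolyTime fun p : Σ x, β x × α x => step p.1 p.2.1 p.2.2) {k : X → ℕ}
    (hk : PolyBdd dataSize k)
    (hbd : ∀ x b, ∀ a ∈ l x, dataSize (step x b a) ≤ dataSize b + k x) :
    PolyTime fun x => (l x).foldl (step x) (b₀ x) :=
  hl.foldl h₀ hs (h₀.dataSize_bdd.add (hl.length_bdd.mul hk)) fun x l₁ h =>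
    (dataSize_foldl_le l₁ (b₀ x) fun b a ha => hbd x b a (h.subset ha)).trans
      (Nat.add_le_add_left (Nat.mul_le_mul_right _ h.length_le) _)

end Fold

section List

theorem reverseAux {m : ∀ x, List (α x)} (hl : PolyTime l) (hm : PolyTime m) :
    PolyTime fun x => (l x).reverse ++ m x :=
  (hl.foldl_of_additive (step := fun _ b a => a :: b) hm (sigmaSnd.snd.cons sigmaSnd.fst)
    (hl.dataSize_bdd.add (.const 1)) fun x b a ha => by
      have := dataSize_lt_of_mem ha
      simp only [dataSize_cons]
      omega).congr fun x => by simp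

theorem reverse (hl : PolyTime l) : PolyTime fun x => (l x).reverse :=
  (hl.reverseAux nil).congr fun _ => List.append_nil _

theorem append {m : ∀ x, List (α x)} (hl : PolyTime l) (hm : PolyTime m) :
    PolyTime fun x => l x ++ m x :=
  (hl.reverse.reverseAux hm).congr fun x => by rw [List.reverse_reverse]

theorem dataSize_step_bdd {f : ∀ x, α x → β x} (hl : PolyTime l)
    (hf : PolyTime fun p : Σ x, α x => f p.1 p.2) :
    ∃ k : X → ℕ, PolyBdd dataSize k ∧ ∀ x, ∀ a ∈ l x, dataSize (f x a) ≤ k x := by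
  obtain ⟨q, hq⟩ := hf.dataSize_bdd
  refine ⟨fun x => q.eval (dataSize x + dataSize (l x) + 1),
    ((PolyBdd.self.add hl.dataSize_bdd).add (.const 1)).eval q, fun x a ha => ?_⟩
  have := dataSize_lt_of_mem ha
  exact (hq ⟨x, a⟩).trans (eval_mono q (by simp only [dataSize_sigma]; omega))

theorem flatMap {f : ∀ x, α x → List (β x)} (hl : PolyTime l)
    (hf : PolyTime fun p : Σ x, α x => f p.1 p.2) : PolyTime fun x => (l x).flatMap (f x) := by
  obtain ⟨k, hk, hbd⟩ := dataSize_step_bdd (f := f) hl hf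
  refine (hl.foldl_of_additive (β := fun x => List (β x)) (b₀ := fun _ => [])
    (step := fun x b a => b ++ f x a) nil
    (sigmaSnd.fst.append (comp₂ (f := f) hf sigmaFst sigmaSnd.snd)) hk fun x b a ha => ?_).congr
    fun x => (List.flatMap_eq_foldl ..).symm
  have hfa := hbd x a ha
  have happend := dataSize_append b (f x a)
  omega

theorem map {f : ∀ x, α x → β x} (hl : PolyTime l)
    (hf : PolyTime fun p : Σ x, α x => f p.1 p.2) : PolyTime fun x => (l x).map (f x) :=
  (hl.flatMap (hf.cons nil)).congr fun _ => List.map_eq_flatMap.symm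

variable {p : ∀ x, α x → Bool}

theorem filter (hl : PolyTime l) (hp : PolyTime fun q : Σ x, α x => p q.1 q.2) :
    PolyTime fun x => (l x).filter (p x) :=
  (hl.flatMap (f := fun x a => if p x a = true then [a] else [])
    (ite hp.decide_eq_true (sigmaSnd.cons nil) nil)).congr fun x => by
      induction l x with
      | nil => rfl
      | cons a l ih => by_cases h : p x a <;> simp [h, ih]

theorem any (hl : PolyTime l) (hp : PolyTime fun q : Σ x, α x => p q.1 q.2) :
    PolyTime fun x => (l x).any (p x) :=
  (hl.filter hp).isEmpty.not.congr fun x => by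
    rw [Bool.eq_iff_iff]
    simp

theorem all (hl : PolyTime l) (hp : PolyTime fun q : Σ x, α x => p q.1 q.2) :
    PolyTime fun x => (l x).all (p x) :=
  (hl.any (p := fun x a => !p x a) hp.not).not.congr fun x => by
    rw [Bool.eq_iff_iff]
    simp

theorem decide_mem {a : ∀ x, α x} [∀ x, Decidable (a x ∈ l x)] (hl : PolyTime l)
    (ha : PolyTime a) : PolyTime fun x => decide (a x ∈ l x) := by
  classical
  exact (hl.any (p := fun x b => decide (b = a x))
    (sigmaSnd.decide_eq ha.weaken)).congr fun x => by
      rw [Bool.eq_iff_iff]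
      simp

end List

end PolyTime

/-! ### Prefixes of a list -/

/-- The list of the pairs of a proper prefix of a list and the element that follows it. -/
def splits {α : Type} : List α → List (List α × α)
  | [] => []
  | a :: l => ([], a) :: (splits l).map fun p => (a :: p.1, p.2)

section Splits

variable {α : Type}

theorem mem_splits {l p : List α} {a : α} : (p, a) ∈ splits l ↔ ∃ s, l = p ++ a :: s := by
  induction l generalizing p with
  | nil => simp [splits]
  | cons b l ih => cases p <;> simp [splits, ih, eq_comm, and_comm]

theorem length_splits (l : List α) : (splits l).length = l.length := by
  induction l with
  | nil => rfl
  | cons a l ih => simp [splits, ih]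

theorem splits_replicate (k : ℕ) (a : α) :
    splits (List.replicate k a) = (List.range k).map fun i => (List.replicate i a, a) := by
  induction k with
  | zero => rfl
  | succ k ih =>
    rw [List.replicate_succ, splits, ih, List.range_succ_eq_map]
    simp [Function.comp_def, List.replicate_succ]

theorem splits_eq_foldl_reverse (l : List α) :
    splits l = l.reverse.foldl (fun b a => ([], a) :: b.map fun p => (a :: p.1, p.2)) [] := by
  rw [List.foldl_reverse]
  induction l with
  | nil => rfl
  | cons a l ih => rw [splits, ih, List.foldr_cons]

theorem dataSize_splits_le [DataEncodable α] (l : List α) :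
    dataSize (splits l) ≤ l.length * (2 * dataSize l + 2) + 1 := by
  rw [← length_splits]
  refine dataSize_list_le ?_
  rintro ⟨p, a⟩ hp
  obtain ⟨s, rfl⟩ := mem_splits.1 hp
  have hl := dataSize_append p (a :: s)
  have := dataSize_pos s
  rw [dataSize_prod]
  rw [dataSize_cons] at hl
  dsimp only
  omega

end Splits

namespace PolyTime

variable {X : Type} [DataEncodable X] {α : X → Type} [∀ x, DataEncodable (α x)]

theorem splits {l : ∀ x, List (α x)} (hl : PolyTime l) : PolyTime fun x => splits (l x) := by
  refine (hl.reverse.foldl (β := fun x => List (List (α x) × α x)) nil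
    ((nil.pair sigmaSnd.snd).cons (sigmaSnd.fst.map
      ((sigmaSnd.snd.weaken.cons sigmaSnd.fst).pair sigmaSnd.snd)))
    (k := fun x => (l x).length * (2 * dataSize (l x) + 2) + 1)
    ((hl.length_bdd.mul (((PolyBdd.const 2).mul hl.dataSize_bdd).add (.const 2))).add (.const 1))
    fun x l₁ h => ?_).congr fun x => (splits_eq_foldl_reverse (l x)).symm
  have hsuffix : l₁.reverse <:+ l x := by
    rw [← List.reverse_prefix, List.reverse_reverse]
    exact h
  rw [← List.reverse_reverse l₁, ← splits_eq_foldl_reverse]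
  refine (dataSize_splits_le l₁.reverse).trans (Nat.add_le_add_right ?_ 1)
  exact Nat.mul_le_mul hsuffix.length_le (by have := dataSize_le_of_suffix hsuffix; omega)

end PolyTime

/-! ### Literals and clauses as lists -/

section Literals

variable {n : ℕ}

@[simp]
theorem Literal.neg_neg (l : Literal n) : l.neg.neg = l := by
  simp [Literal.neg]

@[simp]
theorem Literal.neg_var (l : Literal n) : l.neg.var = l.var := rfl

theorem Literal.neg_ne (l : Literal n) : l.neg ≠ l :=
  fun h => Bool.not_ne_self l.sign (congrArg Literal.sign h)

theorem Literal.eq_or_eq_neg {l m : Literal n} (h : l.var = m.var) : l = m ∨ l = m.neg := by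
  obtain ⟨i, a⟩ := l
  obtain ⟨j, b⟩ := m
  obtain rfl : i = j := h
  cases a <;> cases b <;> simp [Literal.neg]

/-- The list of all the literals in `n` variables. -/
def allLits (n : ℕ) : List (Literal n) :=
  (List.finRange n).flatMap fun i => [⟨i, true⟩, ⟨i, false⟩]

theorem mem_allLits (l : Literal n) : l ∈ allLits n := by
  obtain ⟨i, b⟩ := l
  cases b <;> simp [allLits]

/-- The list of the literals of a clause. -/
def Clause.lits (C : Clause n) : List (Literal n) :=
  (allLits n).filter fun l => decide (l ∈ C.1)

@[simp]
theorem Clause.mem_lits {C : Clause n} {l : Literal n} : l ∈ C.lits ↔ l ∈ C.1 := by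
  simp [Clause.lits, mem_allLits]

/-- The clause that consists of the literals in the list `L`. If `L` contains complementary
literals, then only the positive one is kept. -/
def Clause.ofLits (L : List (Literal n)) : Clause n :=
  ⟨L.toFinset.filter fun l => l.sign = false → (⟨l.var, true⟩ : Literal n) ∉ L, by
    rintro ⟨i, b⟩ hl hneg
    cases b <;> simp_all [Literal.neg]⟩

theorem Clause.mem_ofLits {L : List (Literal n)} (hL : ∀ l ∈ L, l.neg ∉ L) {l : Literal n} :
    l ∈ (Clause.ofLits L).1 ↔ l ∈ L := by
  obtain ⟨i, b⟩ := l
  simp only [ofLits, Finset.mem_filter, List.mem_toFinset, and_iff_left_iff_imp]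
  rintro h rfl
  exact hL _ h

end Literals

section Encoding

open DataEncodable

variable {n : ℕ}

theorem toData_nat (k : ℕ) : toData k = toData (List.replicate k Data.nil) := by
  induction k with
  | zero => rfl
  | succ k ih => exact congrArg (Data.cons Data.nil) ih

theorem toData_map {α β : Type} [DataEncodable α] [DataEncodable β] {f : α → β}
    (h : ∀ a, toData (f a) = toData a) (l : List α) : toData (l.map f) = toData l := by
  induction l with
  | nil => rfl
  | cons a l ih => exact congrArg₂ Data.cons (h a) ih

theorem hd_iterate_tl_toData {α : Type} [DataEncodable α] (l : List α) (i : ℕ)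
    (hi : i < l.length) : (Data.tl^[i] (toData l)).hd = toData l[i] := by
  induction l generalizing i with
  | nil => simp at hi
  | cons a l ih =>
    cases i with
    | zero => rfl
    | succ i => exact ih i (Nat.lt_of_succ_lt_succ hi)

theorem foldl_replicate_tl (i : ℕ) (d : Data) :
    (List.replicate i Data.nil).foldl (fun b _ => b.tl) d = Data.tl^[i] d := by
  induction i generalizing d with
  | zero => rfl
  | succ _ ih => exact ih d.tl

theorem Clause.toData_eq (C : Clause n) :
    toData C = toData (List.ofFn fun i : Fin n =>
      if ⟨i, true⟩ ∈ C.1 then 2 else if ⟨i, false⟩ ∈ C.1 then 1 else 0) := rfl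

theorem Clause.toData_ofLits (L : List (Literal n)) :
    toData (Clause.ofLits L) = toData ((List.finRange n).map fun i =>
      if (⟨i, true⟩ : Literal n) ∈ L then 2
      else if (⟨i, false⟩ : Literal n) ∈ L then 1 else 0) := by
  rw [Clause.toData_eq, List.ofFn_eq_map]
  refine congrArg toData (List.map_congr_left fun i _ => ?_)
  by_cases hpos : (⟨i, true⟩ : Literal n) ∈ L <;> by_cases hneg : (⟨i, false⟩ : Literal n) ∈ L <;>
    simp [ofLits, hpos, hneg]

theorem Clause.mem_iff_occurrence (C : Clause n) (l : Literal n) :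
    l ∈ C.1 ↔ (if ⟨l.var, true⟩ ∈ C.1 then 2 else if ⟨l.var, false⟩ ∈ C.1 then 1 else 0) =
      if l.sign = true then 2 else 1 := by
  obtain ⟨i, b⟩ := l
  have hpos := C.2 ⟨i, true⟩
  simp only [Literal.neg, Bool.not_true] at hpos
  cases b <;> by_cases h : (⟨i, true⟩ : Literal n) ∈ C.1 <;>
    by_cases h' : (⟨i, false⟩ : Literal n) ∈ C.1 <;> simp_all

end Encoding

namespace PolyTime

open DataEncodable

variable {X : Type} [DataEncodable X] {n : X → ℕ}

theorem replicate_nil (hn : PolyTime n) : PolyTime fun x => List.replicate (n x) Data.nil :=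
  hn.congr_toData fun x => toData_nat (n x)

theorem finRange (hn : PolyTime n) : PolyTime fun x => List.finRange (n x) :=
  (hn.replicate_nil.splits.map (f := fun _ q => q.1) sigmaSnd.fst).congr_toData fun x => by
    rw [splits_replicate, List.map_map, ← List.map_coe_finRange_eq_range, List.map_map]
    refine toData_map (fun i => ?_) _
    exact (toData_nat i).symm

theorem nthData {d : X → Data} (hd : PolyTime d) (hn : PolyTime n) :
    PolyTime fun x => (Data.tl^[n x] (d x)).hd :=
  (hn.replicate_nil.foldl_of_additive (β := fun _ => Data) (step := fun _ b _ => b.tl) hd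
    sigmaSnd.fst.tl (.const 0) fun _ b _ _ => Data.size_tl_le b).hd.congr fun x => by
      rw [foldl_replicate_tl]

theorem apply_ofFn {α : X → Type} [∀ x, DataEncodable (α x)] {f : ∀ x, Fin (n x) → α x}
    {i : ∀ x, Fin (n x)} (hf : PolyTime fun x => List.ofFn (f x)) (hi : PolyTime i) :
    PolyTime fun x => f x (i x) :=
  ((toData_iff.2 hf).nthData (n := fun x => i x) hi).congr_toData fun x =>
    (hd_iterate_tl_toData _ _ (by simp)).trans (by simp)

section Literals

variable {l : ∀ x, Literal (n x)}

theorem var (hl : PolyTime l) : PolyTime fun x => (l x).var := (toData_iff.2 hl).hd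

theorem sign (hl : PolyTime l) : PolyTime fun x => (l x).sign := (toData_iff.2 hl).tl

theorem literal {v : ∀ x, Fin (n x)} {b : X → Bool} (hv : PolyTime v) (hb : PolyTime b) :
    PolyTime fun x => (⟨v x, b x⟩ : Literal (n x)) := hv.pair hb

theorem literal_snd (b : Bool) :
    PolyTime fun p : Σ x, Fin (n x) => (⟨p.2, b⟩ : Literal (n p.1)) :=
  literal (n := fun p : Σ x, Fin (n x) => n p.1) sigmaSnd (.const b)

theorem neg (hl : PolyTime l) : PolyTime fun x => (l x).neg := hl.var.literal hl.sign.not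

end Literals

theorem decide_mem_clause {C : ∀ x, Clause (n x)} {l : ∀ x, Literal (n x)} (hC : PolyTime C)
    (hl : PolyTime l) : PolyTime fun x => decide (l x ∈ (C x).1) := by
  have occurrence : PolyTime fun x =>
      if ⟨(l x).var, true⟩ ∈ (C x).1 then 2 else if ⟨(l x).var, false⟩ ∈ (C x).1 then 1 else 0 :=
    apply_ofFn (f := fun x i =>
      if ⟨i, true⟩ ∈ (C x).1 then 2 else if ⟨i, false⟩ ∈ (C x).1 then 1 else 0)
      (hC.congr_toData fun x => (C x).toData_eq) hl.var
  exact (occurrence.decide_eq (ite hl.sign.decide_eq_true (.const 2) (.const 1))).congr fun x =>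
    decide_eq_decide.2 ((C x).mem_iff_occurrence (l x)).symm

theorem allLits (hn : PolyTime n) : PolyTime fun x => allLits (n x) :=
  hn.finRange.flatMap
    ((literal_snd true).cons ((literal_snd false).cons nil))

theorem lits {C : ∀ x, Clause (n x)} (hn : PolyTime n) (hC : PolyTime C) :
    PolyTime fun x => (C x).lits :=
  hn.allLits.filter (hC.weaken.decide_mem_clause sigmaSnd)

theorem ofLits {L : ∀ x, List (Literal (n x))} (hn : PolyTime n) (hL : PolyTime L) :
    PolyTime fun x => Clause.ofLits (L x) := by
  have mem (b : Bool) : PolyTime fun p : Σ x, Fin (n x) =>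
      decide ((⟨p.2, b⟩ : Literal (n p.1)) ∈ L p.1) :=
    hL.weaken.decide_mem (literal_snd b)
  exact (hn.finRange.map (f := fun x i => if (⟨i, true⟩ : Literal (n x)) ∈ L x then 2
    else if (⟨i, false⟩ : Literal (n x)) ∈ L x then 1 else 0)
    (ite (mem true) (.const 2) (ite (mem false) (.const 1) (.const 0)))).congr_toData
    fun x => (Clause.toData_ofLits (L x)).symm

end PolyTime

/-! ### Derivations -/

/-- The side condition of `π`-ordered resolution on an inference that removes `l` and yields
`R`. -/
def OrderedSide {n : ℕ} (π : Equiv.Perm (Fin n)) (l : Literal n) (R : Clause n) : Prop :=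
  ∀ m ∈ R.1, π m.var < π l.var

/-- `C` may extend a derivation whose lines so far are those of `Q`: it belongs to `τ` or is
a resolvent of members of `Q`. -/
def Justified {n : ℕ} (side : Literal n → Clause n → Prop) (τ : CNF n) (Q : List (Clause n))
    (C : Clause n) : Prop :=
  C ∈ τ ∨ ∃ E ∈ Q, ∃ F ∈ Q, ∃ l, IsResolvent E F l C ∧ side l C

section Derivation

variable {n : ℕ} {side : Literal n → Clause n → Prop} {τ : CNF n} {P : List (Clause n)}

theorem Justified.mono {Q Q' : List (Clause n)} {C : Clause n} (h : Justified side τ Q C)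
    (hQ : Q ⊆ Q') : Justified side τ Q' C :=
  h.imp_right fun ⟨E, hE, F, hF, h⟩ => ⟨E, hQ hE, F, hQ hF, h⟩

theorem isDerivation_iff :
    IsDerivation side τ P ↔ ∀ Q C S, P = Q ++ C :: S → Justified side τ Q C := by
  constructor
  · rintro h Q C S rfl
    have hlen : Q.length < (Q ++ C :: S).length := by simp
    have hget (i : ℕ) (hi : i < Q.length) : (Q ++ C :: S)[i]'(hi.trans hlen) = Q[i] :=
      List.getElem_append_left hi
    have hC : (Q ++ C :: S)[Q.length]'hlen = C := by simp
    obtain hτ | ⟨i, j, hi, hj, l, hres, hside⟩ := h Q.length hlen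
    · exact .inl (hC ▸ hτ)
    · rw [hget i hi, hget j hj, hC] at hres
      exact .inr ⟨_, List.getElem_mem hi, _, List.getElem_mem hj, l, hres, hC ▸ hside⟩
  · intro h k hk
    have hsplit : P = P.take k ++ P[k] :: P.drop (k + 1) := by simp
    refine (h _ _ _ hsplit).imp_right ?_
    rintro ⟨E, hE, F, hF, l, hl⟩
    obtain ⟨i, hi, rfl⟩ := List.getElem_of_mem hE
    obtain ⟨j, hj, rfl⟩ := List.getElem_of_mem hF
    rw [List.length_take] at hi hj
    exact ⟨i, j, by omega, by omega, l, by simpa using hl⟩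

theorem IsDerivation.justified (h : IsDerivation side τ P) {C : Clause n} (hC : C ∈ P) :
    Justified side τ P C := by
  obtain ⟨Q, S, rfl⟩ := List.append_of_mem hC
  exact (isDerivation_iff.1 h Q C S rfl).mono (List.subset_append_left _ _)

theorem IsDerivation.append {R : List (Clause n)} (h : IsDerivation side τ P)
    (hR : ∀ C ∈ R, Justified side τ P C) : IsDerivation side τ (P ++ R) := by
  rw [isDerivation_iff] at h ⊢
  intro Q C S hQ
  obtain ⟨A, rfl, rfl⟩ | ⟨A, rfl, hA⟩ := List.append_eq_append_iff.1 hQ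
  · exact (hR C (by simp)).mono (List.subset_append_left _ _)
  · obtain ⟨rfl, hCR⟩ | ⟨A, rfl, _⟩ := List.cons_eq_append_iff.1 hA
    · simpa using hR C (by simp [hCR])
    · exact h Q C A rfl

theorem isDerivation_of_forall_mem (h : ∀ C ∈ P, C ∈ τ) : IsDerivation side τ P :=
  fun _ hk => .inl (h _ (List.getElem_mem hk))

end Derivation

/-! ### The variables in increasing order -/

/-- The variables, from the `π`-smallest to the `π`-largest one. -/
def varOrder {n : ℕ} (π : Equiv.Perm (Fin n)) : List (Fin n) := (List.finRange n).map π.symm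

section VarOrder

variable {n : ℕ} {π : Equiv.Perm (Fin n)}

theorem mem_varOrder (x : Fin n) : x ∈ varOrder π :=
  List.mem_map.2 ⟨π x, List.mem_finRange _, π.symm_apply_apply x⟩

theorem length_varOrder : (varOrder π).length = n := by simp [varOrder]

theorem pairwise_varOrder : (varOrder π).Pairwise fun x y => π x < π y := by
  rw [varOrder, List.pairwise_map]
  simpa using List.sortedLT_finRange n |>.pairwise

theorem nodup_varOrder : (varOrder π).Nodup :=
  pairwise_varOrder.imp fun h => by rintro rfl; exact h.false

theorem mem_prefix_varOrder {us ws : List (Fin n)} {w : Fin n} (h : varOrder π = us ++ w :: ws)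
    {y : Fin n} : y ∈ us ↔ π y < π w := by
  have hsorted := pairwise_varOrder (π := π)
  rw [h, List.pairwise_append, List.pairwise_cons] at hsorted
  refine ⟨fun hy => hsorted.2.2 y hy w (by simp), fun hlt => ?_⟩
  have hy := mem_varOrder (π := π) y
  rw [h, List.mem_append, List.mem_cons] at hy
  obtain hy | rfl | hy := hy
  · exact hy
  · exact absurd hlt (lt_irrefl _)
  · exact absurd hlt (hsorted.2.1.1 y hy).not_gt

end VarOrder

/-! ### Half-ordered derivations with weakening -/

/-- A sequence of literals, read as a disjunction. -/
abbrev Line (n : ℕ) : Type := List (Literal n)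

/-- The line `L` follows from `τ` and the lines in `Q`: all the literals of some line can be
removed or found in `L`, where a literal `l` is removed with the help of a line that consists
of the complement of `l` and of literals of `L` that are smaller than `l`. -/
def HalfJustified {n : ℕ} (π : Equiv.Perm (Fin n)) (τ : List (Clause n)) (Q : List (Line n))
    (L : Line n) : Prop :=
  ∃ C : Line n, (C ∈ Q ∨ ∃ D ∈ τ, C = D.lits) ∧ ∀ l ∈ C, l ∈ L ∨
    ∃ N ∈ Q, l.neg ∈ N ∧ ∀ m ∈ N, m ≠ l.neg → m ∈ L ∧ π m.var < π l.var

/-- A derivation by half-ordered resolution (only one of the two resolved clauses has to obey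
the order) with weakening. -/
def IsHalfDerivation {n : ℕ} (π : Equiv.Perm (Fin n)) (τ : List (Clause n))
    (P : List (Line n)) : Prop :=
  ∀ Q L S, P = Q ++ L :: S → HalfJustified π τ Q L

/-- If the literals in `T` are false, the line `M` reduces to the single literal `l`. -/
def IsUnitUnder {n : ℕ} (T M : Line n) (l : Literal n) : Prop :=
  l ∈ M ∧ ∀ m ∈ M, m ∈ l :: T

instance {n : ℕ} (T M : Line n) (l : Literal n) : Decidable (IsUnitUnder T M l) :=
  inferInstanceAs (Decidable (_ ∧ _))

/-- The literals known to be false after the variables `us` have been read, when the search for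
a falsified clause starts from a falsified line `L`: those of `L` and those whose complement
is forced by a line of `B`, the lines that precede `L`. -/
def falseLits {n : ℕ} (B : List (Line n)) (L : Line n) (us : List (Fin n)) : Line n :=
  us.foldl (fun T w => T ++ [(⟨w, true⟩ : Literal n), ⟨w, false⟩].filter fun l =>
    decide (l ∈ L) || B.any fun M => decide (IsUnitUnder T M l.neg)) []

section FalseLits

variable {n : ℕ} {B B' : List (Line n)} {L M T T' : Line n} {us ws : List (Fin n)} {w : Fin n}
  {l : Literal n}

theorem IsUnitUnder.mono (h : IsUnitUnder T M l) (hT : T ⊆ T') : IsUnitUnder T' M l :=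
  ⟨h.1, fun m hm => List.cons_subset_cons l hT (h.2 m hm)⟩

theorem mem_falseLits_append_singleton :
    l ∈ falseLits B L (us ++ [w]) ↔ l ∈ falseLits B L us ∨
      l.var = w ∧ (l ∈ L ∨ ∃ M ∈ B, IsUnitUnder (falseLits B L us) M l.neg) := by
  obtain ⟨v, b⟩ := l
  simp only [falseLits, List.foldl_append, List.foldl_cons, List.foldl_nil, List.mem_append,
    List.mem_filter, List.mem_cons, Literal.mk.injEq, List.not_mem_nil, or_false,
    Bool.or_eq_true, decide_eq_true_eq, List.any_eq_true]
  cases b <;> simp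

theorem falseLits_subset_append : falseLits B L us ⊆ falseLits B L (us ++ ws) := by
  induction ws using List.reverseRecOn with
  | nil => simp
  | append_singleton ws w ih =>
    rw [← List.append_assoc]
    exact fun l hl => mem_falseLits_append_singleton.2 (.inl (ih hl))

theorem var_mem_of_mem_falseLits (h : l ∈ falseLits B L us) : l.var ∈ us := by
  induction us using List.reverseRecOn with
  | nil => simp [falseLits] at h
  | append_singleton us w ih =>
    obtain h | ⟨rfl, -⟩ := mem_falseLits_append_singleton.1 h
    · simp [ih h]
    · simp

theorem mem_falseLits_of_mem (hl : l ∈ L) (hv : l.var ∈ us) : l ∈ falseLits B L us := by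
  obtain ⟨us, ws, rfl⟩ := List.append_of_mem hv
  rw [List.append_cons]
  exact falseLits_subset_append (mem_falseLits_append_singleton.2 (.inr ⟨rfl, .inl hl⟩))

theorem mem_falseLits_of_isUnitUnder (hM : M ∈ B) (h : IsUnitUnder (falseLits B L us) M l.neg) :
    l ∈ falseLits B L (us ++ l.var :: ws) := by
  rw [List.append_cons]
  exact falseLits_subset_append (mem_falseLits_append_singleton.2 (.inr ⟨rfl, .inr ⟨M, hM, h⟩⟩))

theorem falseLits_mono (hB : B' ⊆ B) (hus : us.Nodup)
    (hM : ∀ m ∈ M, m.var ∈ us → m ∈ falseLits B L us) :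
    falseLits B' M us ⊆ falseLits B L us := by
  induction us using List.reverseRecOn with
  | nil => simp [falseLits]
  | append_singleton us w ih =>
    obtain ⟨hus, hw⟩ : us.Nodup ∧ w ∉ us := by
      simpa [List.nodup_append, ← List.forall_mem_ne'] using hus
    have hsub := ih hus fun m hm hv =>
      (mem_falseLits_append_singleton.1 (hM m hm (by simp [hv]))).resolve_right
        fun h => hw (h.1 ▸ hv)
    intro l hl
    obtain hl | ⟨hlw, hl | ⟨N, hN, hunit⟩⟩ := mem_falseLits_append_singleton.1 hl
    · exact mem_falseLits_append_singleton.2 (.inl (hsub hl))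
    · exact hM l hl (by simp [hlw])
    · exact mem_falseLits_append_singleton.2 (.inr ⟨hlw, .inr ⟨N, hB hN, hunit.mono hsub⟩⟩)

theorem falseLits_append_singleton_subset {b : Bool} (hmono : falseLits B L us ⊆ T)
    (hL : ∀ l ∈ L, l.var = w → l ∈ ⟨w, b⟩ :: T) (hB : ∀ M ∈ B, ¬ IsUnitUnder T M ⟨w, b⟩) :
    falseLits B L (us ++ [w]) ⊆ ⟨w, b⟩ :: T := by
  intro l hl
  obtain hl | ⟨rfl, hl | ⟨M, hM, hunit⟩⟩ := mem_falseLits_append_singleton.1 hl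
  · exact List.mem_cons_of_mem _ (hmono hl)
  · exact hL l hl rfl
  · obtain heq | hneg := Literal.eq_or_eq_neg (l := l) (m := ⟨l.var, b⟩) rfl
    · exact heq ▸ List.mem_cons_self
    · rw [hneg, Literal.neg_neg] at hunit
      exact absurd (hunit.mono hmono) (hB M hM)

variable {π : Equiv.Perm (Fin n)} {τ : List (Clause n)} {P S : List (Line n)}

theorem mem_falseLits_of_smaller {N : Line n} (hN : N ∈ B) (hl : l.neg ∈ N)
    (hm : ∀ m ∈ N, m ≠ l.neg → m ∈ L ∧ π m.var < π l.var) :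
    l ∈ falseLits B L (varOrder π) := by
  obtain ⟨us, ws, hv⟩ := List.append_of_mem (mem_varOrder (π := π) l.var)
  rw [hv]
  refine mem_falseLits_of_isUnitUnder hN ⟨hl, fun m hmN => ?_⟩
  by_cases hml : m = l.neg
  · exact hml ▸ List.mem_cons_self
  · obtain ⟨hmL, hlt⟩ := hm m hmN hml
    exact List.mem_cons_of_mem _ (mem_falseLits_of_mem hmL ((mem_prefix_varOrder hv).2 hlt))

theorem IsHalfDerivation.exists_falsified (hP : IsHalfDerivation π τ P) (h : P = B ++ L :: S) :
    ∃ C ∈ τ, ∀ l ∈ C.1, l ∈ falseLits B L (varOrder π) := by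
  induction hk : B.length using Nat.strong_induction_on generalizing B L S with
  | _ k ih =>
    obtain ⟨C, hC, hjust⟩ := hP B L S h
    have hfalse : ∀ l ∈ C, l ∈ falseLits B L (varOrder π) := by
      intro l hlC
      obtain hl | ⟨N, hN, hl, hm⟩ := hjust l hlC
      · exact mem_falseLits_of_mem hl (mem_varOrder _)
      · exact mem_falseLits_of_smaller hN hl hm
    obtain hC | ⟨D, hD, rfl⟩ := hC
    · obtain ⟨B₁, B₂, rfl⟩ := List.append_of_mem hC
      obtain ⟨D, hD, hD'⟩ := ih B₁.length (by simp [← hk]) (B := B₁) (L := C)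
        (S := B₂ ++ L :: S) (by simp [h]) rfl
      exact ⟨D, hD, fun l hl => falseLits_mono (List.subset_append_left _ _) nodup_varOrder
        (fun m hm _ => hfalse m hm) (hD' l hl)⟩
    · exact ⟨D, hD, fun l hl => hfalse l (Clause.mem_lits.2 hl)⟩

end FalseLits

/-! ### From half-ordered derivations to ordered refutations -/

/-- The literals of the resolvent of `E` and `F` on the variable `w`. -/
def resLits {n : ℕ} (w : Fin n) (E F : Clause n) : Line n :=
  (E.lits.filter fun l => !decide (l = ⟨w, true⟩)) ++
    (F.lits.filter fun l => !decide (l = ⟨w, false⟩))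

/-- A clause from which `w` has been removed: one of `E`, `F` if possible, or else their resolvent
(if it is a clause in the variables `us`). -/
def mergeClauses {n : ℕ} (us : List (Fin n)) (w : Fin n) (E F : Clause n) : Clause n :=
  if (⟨w, true⟩ : Literal n) ∈ E.1 then
    if (⟨w, false⟩ : Literal n) ∈ F.1 then
      if (resLits w E F).all fun l => !decide (l.neg ∈ resLits w E F) && decide (l.var ∈ us) then
        Clause.ofLits (resLits w E F)
      else E
    else F
  else E

/-- One level of the branching program that searches for a falsified clause, given the values of
the variables in increasing order. It has one node for each line of a half-ordered derivation, and
each node is labelled by a clause. -/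
abbrev Row (n : ℕ) : Type := List (Line n × Clause n)

/-- The node to which the search proceeds from the node `c` if the literal `l` is false, where
`B` are the nodes before `c`, and the literals in `T` are already known to be false. -/
def searchTarget {n : ℕ} (T : Line n) (B : Row n) (c : Line n × Clause n) (l : Literal n) :
    Line n × Clause n :=
  (B.find? fun q => decide (IsUnitUnder T q.1 l)).getD c

/-- The level of the search at which the variables `us` have been read, given the level `row`
at which `us ++ [w]` have been read. -/
def resolveRow {n : ℕ} (us : List (Fin n)) (w : Fin n) (row : Row n) : Row n :=
  (splits row).map fun q =>
    (q.2.1, mergeClauses us w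
      (searchTarget (falseLits (q.1.map Prod.fst) q.2.1 us) q.1 q.2 ⟨w, true⟩).2
      (searchTarget (falseLits (q.1.map Prod.fst) q.2.1 us) q.1 q.2 ⟨w, false⟩).2)

/-- The level of the search at which the variables `vs` have been read, which should be all the
variables: the labels are falsified clauses of `τ`. -/
def leafRow {n : ℕ} (vs : List (Fin n)) (τ : List (Clause n)) (P : List (Line n)) : Row n :=
  (splits P).map fun q => (q.2, (τ.find? fun C =>
    C.lits.all fun l => decide (l ∈ falseLits q.1 q.2 vs)).getD (τ.headD (Clause.zero n)))

/-- The levels for all the prefixes of `vs`, from the shortest to the longest one, when `rs` are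
the levels from `vs` on. -/
def rowsAbove {n : ℕ} (vs : List (Fin n)) (rs : List (Row n)) : List (Row n) :=
  (splits vs).foldr (fun q rs => resolveRow q.1 q.2 (rs.headD []) :: rs) rs

/-- The labels, from the last level to the first one. -/
def rowClauses {n : ℕ} (rs : List (Row n)) : List (Clause n) :=
  rs.reverse.flatMap fun row => row.map Prod.snd

/-- The ordered refutation obtained from a half-ordered derivation `P`: the labels of the
branching program, upside down. -/
def orderedOfHalf {n : ℕ} (vs : List (Fin n)) (τ : List (Clause n)) (P : List (Line n)) :
    List (Clause n) :=
  rowClauses (rowsAbove vs [leafRow vs τ P])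

section Merge

variable {n : ℕ} {w : Fin n} {us : List (Fin n)} {E F : Clause n} {T : Line n} {l : Literal n}

theorem mem_resLits :
    l ∈ resLits w E F ↔ (l ∈ E.1 ∧ l ≠ ⟨w, true⟩) ∨ (l ∈ F.1 ∧ l ≠ ⟨w, false⟩) := by
  simp [resLits]

theorem isResolvent_ofLits_resLits
    (hE : (⟨w, true⟩ : Literal n) ∈ E.1) (hF : (⟨w, false⟩ : Literal n) ∈ F.1)
    (h : ∀ l ∈ resLits w E F, l.neg ∉ resLits w E F) :
    IsResolvent E F ⟨w, true⟩ (Clause.ofLits (resLits w E F)) := by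
  refine ⟨hE, hF, ?_⟩
  ext l
  rw [Clause.mem_ofLits h, mem_resLits]
  simp [Literal.neg, and_comm]

theorem mergeClauses_subset (hE : ∀ l ∈ E.1, l ∈ ⟨w, true⟩ :: T)
    (hF : ∀ l ∈ F.1, l ∈ ⟨w, false⟩ :: T) (hcons : ∀ l ∈ T, l.neg ∉ T)
    (hT : ∀ l ∈ T, l.var ∈ us) : ∀ l ∈ (mergeClauses us w E F).1, l ∈ T := by
  have hEw {l} (hl : l ∈ E.1) (hne : l ≠ ⟨w, true⟩) : l ∈ T := List.mem_of_ne_of_mem hne (hE l hl)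
  have hFw {l} (hl : l ∈ F.1) (hne : l ≠ ⟨w, false⟩) : l ∈ T := List.mem_of_ne_of_mem hne (hF l hl)
  have hres : ∀ l ∈ resLits w E F, l ∈ T := fun l hl =>
    (mem_resLits.1 hl).elim (fun h => hEw h.1 h.2) fun h => hFw h.1 h.2
  have hres_neg : ∀ l ∈ resLits w E F, l.neg ∉ resLits w E F :=
    fun l hl hneg => hcons l (hres l hl) (hres _ hneg)
  have hall : ((resLits w E F).all fun l =>
      !decide (l.neg ∈ resLits w E F) && decide (l.var ∈ us)) = true := by
    simpa using fun l hl => ⟨hres_neg l hl, hT l (hres l hl)⟩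
  intro l hl
  rw [mergeClauses, if_pos hall] at hl
  split_ifs at hl with hwE hwF
  · exact hres l ((Clause.mem_ofLits hres_neg).1 hl)
  · exact hFw hl fun h => hwF (h ▸ hl)
  · exact hEw hl fun h => hwE (h ▸ hl)

theorem justified_mergeClauses {π : Equiv.Perm (Fin n)} {τ : CNF n} {ws : List (Fin n)}
    {Q : List (Clause n)} (hv : varOrder π = us ++ w :: ws)
    (hQ : IsDerivation (OrderedSide π) τ Q) (hE : E ∈ Q) (hF : F ∈ Q) :
    Justified (OrderedSide π) τ Q (mergeClauses us w E F) := by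
  unfold mergeClauses
  split_ifs with hwE hwF hall
  · simp only [List.all_eq_true, Bool.and_eq_true, Bool.not_eq_true', decide_eq_false_iff_not,
      decide_eq_true_eq] at hall
    have hcons : ∀ l ∈ resLits w E F, l.neg ∉ resLits w E F := fun l hl => (hall l hl).1
    refine .inr ⟨E, hE, F, hF, _, isResolvent_ofLits_resLits hwE hwF hcons, fun m hm => ?_⟩
    exact (mem_prefix_varOrder hv).1 (hall m ((Clause.mem_ofLits hcons).1 hm)).2
  · exact hQ.justified hE
  · exact hQ.justified hF
  · exact hQ.justified hE

end Merge

section Splits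

variable {α β : Type}

theorem splits_append_singleton (l : List α) (a : α) :
    splits (l ++ [a]) = splits l ++ [(l, a)] := by
  induction l with
  | nil => rfl
  | cons b l ih => simp [splits, ih]

theorem map_snd_splits (l : List α) : (splits l).map Prod.snd = l := by
  induction l with
  | nil => rfl
  | cons a l ih => simp [splits, Function.comp_def, ih]

theorem map_splits_eq {f : List α × α → β} {l : List α} {B S : List β} {c : β}
    (h : (splits l).map f = B ++ c :: S) :
    ∃ Q a R, l = Q ++ a :: R ∧ B = (splits Q).map f ∧ c = f (Q, a) := by
  induction l using List.reverseRecOn generalizing S with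
  | nil => simp [splits] at h
  | append_singleton l a ih =>
    rw [splits_append_singleton, List.map_append, List.map_singleton] at h
    obtain rfl | ⟨S, d, rfl⟩ := List.eq_nil_or_concat S
    · obtain ⟨hB, hc⟩ := List.append_inj' h rfl
      exact ⟨l, a, [], rfl, hB.symm, (List.singleton_inj.1 hc).symm⟩
    · have hmap : (splits l).map f ++ [f (l, a)] = (B ++ c :: S) ++ [d] := by simpa using h
      obtain ⟨Q, b, R, rfl, hB, hc⟩ := ih (List.append_inj' hmap rfl).1
      exact ⟨Q, b, R ++ [a], by simp, hB, hc⟩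

end Splits

/-- The label of the node `c`, preceded by the nodes `B`, contains only literals known to be
false when the variables `us` have been read. -/
def NodeSound {n : ℕ} (us : List (Fin n)) (B : Row n) (c : Line n × Clause n) : Prop :=
  c.1 ⊆ falseLits (B.map Prod.fst) c.1 us →
    (∀ l ∈ falseLits (B.map Prod.fst) c.1 us, l.neg ∉ falseLits (B.map Prod.fst) c.1 us) →
      ∀ l ∈ c.2.1, l ∈ falseLits (B.map Prod.fst) c.1 us

/-- All the nodes of the row satisfy `NodeSound`. -/
def RowSound {n : ℕ} (us : List (Fin n)) (row : Row n) : Prop :=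
  ∀ B c S, row = B ++ c :: S → NodeSound us B c

section Rows

variable {n : ℕ} {π : Equiv.Perm (Fin n)} {τ : List (Clause n)} {P : List (Line n)}
  {us ws : List (Fin n)} {w : Fin n} {row B S : Row n} {rs : List (Row n)}
  {c : Line n × Clause n}

theorem map_fst_resolveRow : (resolveRow us w row).map Prod.fst = row.map Prod.fst := by
  conv_rhs => rw [← map_snd_splits row]
  simp [resolveRow, Function.comp_def]

theorem map_fst_leafRow (vs : List (Fin n)) : (leafRow vs τ P).map Prod.fst = P := by
  conv_rhs => rw [← map_snd_splits P]
  simp [leafRow, Function.comp_def]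

theorem searchTarget_mem (T : Line n) (l : Literal n) : searchTarget T B c l ∈ B ++ [c] := by
  unfold searchTarget
  cases h : B.find? fun q => decide (IsUnitUnder T q.1 l) with
  | none => simp
  | some q => exact List.mem_append_left _ (List.mem_of_find?_eq_some h)

theorem consistent_of_subset_cons {T T' : Line n} {l : Literal n} (hcons : ∀ m ∈ T, m.neg ∉ T)
    (hl : ∀ m ∈ T, m.var ≠ l.var) (hT' : T' ⊆ l :: T) : ∀ m ∈ T', m.neg ∉ T' := by
  intro m hm hneg
  obtain rfl | hmT := List.mem_cons.1 (hT' hm) <;>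
    obtain hml | hnegT := List.mem_cons.1 (hT' hneg)
  · exact Literal.neg_ne _ hml
  · exact hl _ hnegT rfl
  · exact hl m hmT (hml ▸ rfl)
  · exact hcons m hmT hnegT

theorem RowSound.searchTarget_subset (hrow : RowSound (us ++ [w]) (B ++ c :: S)) {T : Line n}
    (hT : T = falseLits (B.map Prod.fst) c.1 us) (hus : us.Nodup) (hw : w ∉ us) (hc : c.1 ⊆ T)
    (hcons : ∀ l ∈ T, l.neg ∉ T) (b : Bool) :
    ∀ l ∈ (searchTarget T B c ⟨w, b⟩).2.1, l ∈ ⟨w, b⟩ :: T := by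
  have hTus : ∀ l ∈ T, l.var ∈ us := fun l hl => var_mem_of_mem_falseLits (hT ▸ hl)
  have hcons_of_subset {T' : Line n} : T' ⊆ ⟨w, b⟩ :: T → ∀ l ∈ T', l.neg ∉ T' :=
    consistent_of_subset_cons hcons fun m hm h =>
      hw ((show m.var = w from h) ▸ hTus m hm)
  unfold searchTarget
  cases hfind : B.find? fun q => decide (IsUnitUnder T q.1 ⟨w, b⟩) with
  | none =>
    have hB : ∀ q ∈ B, ¬ IsUnitUnder T q.1 ⟨w, b⟩ := by simpa using hfind
    have hsub : falseLits (B.map Prod.fst) c.1 (us ++ [w]) ⊆ ⟨w, b⟩ :: T :=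
      falseLits_append_singleton_subset (hT ▸ List.Subset.refl _)
        (fun l hl _ => List.mem_cons_of_mem _ (hc hl)) (by simpa using hB)
    exact fun l hl => hsub (hrow B c S rfl
      (fun m hm => falseLits_subset_append (hT ▸ hc hm)) (hcons_of_subset hsub) l hl)
  | some q =>
    obtain ⟨hunit, B₁, B₂, rfl, hB₁⟩ := List.find?_eq_some_iff_append.1 hfind
    replace hunit : IsUnitUnder T q.1 ⟨w, b⟩ := of_decide_eq_true hunit
    have hmono : falseLits (B₁.map Prod.fst) q.1 us ⊆ T := hT ▸ falseLits_mono (by simp) hus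
      fun m hm hmus => hT ▸ List.mem_of_ne_of_mem (by rintro rfl; exact hw hmus) (hunit.2 m hm)
    have hsub : falseLits (B₁.map Prod.fst) q.1 (us ++ [w]) ⊆ ⟨w, b⟩ :: T :=
      falseLits_append_singleton_subset hmono (fun l hl _ => hunit.2 l hl) (by simpa using hB₁)
    have hq : q.1 ⊆ falseLits (B₁.map Prod.fst) q.1 (us ++ [w]) := by
      refine fun m hm => mem_falseLits_of_mem hm ?_
      obtain rfl | hmT := List.mem_cons.1 (hunit.2 m hm)
      · simp
      · simp [hTus m hmT]
    exact fun l hl => hsub (hrow B₁ q (B₂ ++ c :: S) (by simp) hq (hcons_of_subset hsub) l hl)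

theorem RowSound.resolveRow (hrow : RowSound (us ++ [w]) row) (hus : us.Nodup) (hw : w ∉ us) :
    RowSound us (resolveRow us w row) := by
  intro B c S h
  obtain ⟨B, c, S, rfl, rfl, rfl⟩ := map_splits_eq h
  have hB : ((splits B).map fun q => _).map Prod.fst = B.map Prod.fst :=
    map_fst_resolveRow (us := us) (w := w)
  unfold NodeSound
  rw [hB]
  intro hc hcons
  exact mergeClauses_subset (hrow.searchTarget_subset rfl hus hw hc hcons true)
    (hrow.searchTarget_subset rfl hus hw hc hcons false) hcons
    fun l hl => var_mem_of_mem_falseLits hl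

theorem IsHalfDerivation.rowSound_leafRow (hP : IsHalfDerivation π τ P) :
    RowSound (varOrder π) (leafRow (varOrder π) τ P) := by
  intro B c S h _ _
  obtain ⟨Q, L, R, rfl, rfl, rfl⟩ := map_splits_eq h
  have hQ : ((splits Q).map fun q => _).map Prod.fst = Q :=
    map_fst_leafRow (τ := τ) (varOrder π)
  rw [hQ]
  dsimp only
  cases hfind : τ.find? fun C => C.lits.all fun l => decide (l ∈ falseLits Q L (varOrder π)) with
  | none =>
    obtain ⟨C, hC, hfalse⟩ := hP.exists_falsified rfl
    exact absurd (by simpa using hfalse) (List.find?_eq_none.1 hfind C hC)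
  | some C => simpa using List.find?_some hfind

theorem rowClauses_cons : rowClauses (row :: rs) = rowClauses rs ++ row.map Prod.snd := by
  simp [rowClauses]

theorem rowsAbove_append_singleton :
    rowsAbove (us ++ [w]) rs = rowsAbove us (resolveRow us w (rs.headD []) :: rs) := by
  simp [rowsAbove, splits_append_singleton]

theorem isDerivation_rowClauses_resolveRow (hv : varOrder π = us ++ w :: ws)
    (h : IsDerivation (OrderedSide π) τ.toFinset (rowClauses (row :: rs))) :
    IsDerivation (OrderedSide π) τ.toFinset (rowClauses (resolveRow us w row :: row :: rs)) := by
  rw [rowClauses_cons]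
  refine h.append fun C hC => ?_
  simp only [resolveRow, List.map_map, List.mem_map, Function.comp_apply, Prod.exists] at hC
  obtain ⟨B, L, D, hsplit, rfl⟩ := hC
  obtain ⟨S, rfl⟩ := mem_splits.1 hsplit
  have htarget (T l) : (searchTarget T B (L, D) l).2 ∈ rowClauses ((B ++ (L, D) :: S) :: rs) := by
    rw [rowClauses_cons, List.append_cons]
    exact List.mem_append_right _
      (List.mem_map_of_mem (List.mem_append_left _ (searchTarget_mem T l)))
  exact justified_mergeClauses hv h (htarget _ _) (htarget _ _)

theorem exists_rowsAbove_eq_cons (hv : varOrder π = us ++ ws)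
    (hd : IsDerivation (OrderedSide π) τ.toFinset (rowClauses (row :: rs)))
    (hs : RowSound us row) (hP : row.map Prod.fst = P) :
    ∃ row' rs', rowsAbove us (row :: rs) = row' :: rs' ∧
      IsDerivation (OrderedSide π) τ.toFinset (rowClauses (row' :: rs')) ∧ RowSound [] row' ∧
      row'.map Prod.fst = P := by
  induction us using List.reverseRecOn generalizing ws row rs with
  | nil => exact ⟨row, rs, rfl, hd, hs, hP⟩
  | append_singleton us w ih =>
    rw [List.append_assoc, List.singleton_append] at hv
    have hw : w ∉ us := fun h => ((mem_prefix_varOrder hv).1 h).false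
    have hus : us.Nodup := (hv ▸ nodup_varOrder (π := π)).of_append_left
    rw [rowsAbove_append_singleton]
    exact ih hv (isDerivation_rowClauses_resolveRow hv hd) (hs.resolveRow hus hw)
      (map_fst_resolveRow.trans hP)

theorem isDerivation_leafRow (vs : List (Fin n)) (hτ : τ ≠ []) :
    IsDerivation (OrderedSide π) τ.toFinset (rowClauses [leafRow vs τ P]) := by
  refine isDerivation_of_forall_mem fun C hC => ?_
  simp only [rowClauses, List.reverse_singleton, List.flatMap_singleton, leafRow, List.map_map,
    List.mem_map, Function.comp_apply] at hC
  obtain ⟨q, -, rfl⟩ := hC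
  rw [List.mem_toFinset]
  cases hfind : τ.find? fun C => C.lits.all fun l => decide (l ∈ falseLits q.1 q.2 vs) with
  | none =>
    obtain ⟨C, τ, rfl⟩ := List.exists_cons_of_ne_nil hτ
    exact List.mem_cons_self
  | some C => exact List.mem_of_find?_eq_some hfind

theorem IsHalfDerivation.isOrderedRefutation (hP : IsHalfDerivation π τ P) (hτ : τ ≠ [])
    (h0 : [] ∈ P) : IsOrderedRefutation π τ.toFinset (orderedOfHalf (varOrder π) τ P) := by
  obtain ⟨row, rs, hrows, hderiv, hsound, rfl⟩ := exists_rowsAbove_eq_cons (List.append_nil _).symm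
    (isDerivation_leafRow (π := π) (varOrder π) hτ) hP.rowSound_leafRow (map_fst_leafRow _)
  rw [orderedOfHalf, hrows]
  refine ⟨hderiv, ?_⟩
  obtain ⟨c, hc, hc0⟩ := List.mem_map.1 h0
  obtain ⟨B, S, rfl⟩ := List.append_of_mem hc
  have hlabel : c.2 = Clause.zero n := Subtype.ext <| Finset.eq_empty_iff_forall_notMem.2
    fun l hl => List.not_mem_nil
      (hsound B c S rfl (hc0 ▸ List.nil_subset _) (fun _ h => absurd h List.not_mem_nil) l hl)
  rw [rowClauses_cons, List.mem_append, List.mem_map]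
  exact .inr ⟨c, hc, hlabel⟩

theorem map_fst_of_mem_foldr_resolveRow (l : List (List (Fin n) × Fin n))
    (hrow : row.map Prod.fst = P) :
    ∀ r ∈ l.foldr (fun q rs => resolveRow q.1 q.2 (rs.headD []) :: rs) [row],
      r.map Prod.fst = P := by
  induction l with
  | nil => simpa using hrow
  | cons q l ih =>
    rw [List.foldr_cons, List.forall_mem_cons]
    refine ⟨?_, ih⟩
    rw [map_fst_resolveRow]
    obtain ⟨r, rs, hrs⟩ : ∃ r rs,
        l.foldr (fun q rs => resolveRow q.1 q.2 (rs.headD []) :: rs) [row] = r :: rs := by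
      cases l <;> simp
    exact ih _ (by rw [hrs]; exact List.mem_cons_self)

theorem length_foldr_resolveRow (l : List (List (Fin n) × Fin n)) (rs : List (Row n)) :
    (l.foldr (fun q rs => resolveRow q.1 q.2 (rs.headD []) :: rs) rs).length =
      l.length + rs.length := by
  induction l with
  | nil => simp
  | cons q l ih => simp only [List.foldr_cons, List.length_cons, ih]; ring

theorem length_orderedOfHalf (vs : List (Fin n)) :
    (orderedOfHalf vs τ P).length = (vs.length + 1) * P.length := by
  have hlen : ∀ r ∈ rowsAbove vs [leafRow vs τ P], r.length = P.length := fun r hr => by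
    rw [← map_fst_of_mem_foldr_resolveRow _ (map_fst_leafRow vs) r hr, List.length_map]
  rw [orderedOfHalf, rowClauses, List.length_flatMap, List.map_reverse, List.sum_reverse,
    List.map_congr_left fun r hr => (List.length_map _).trans (hlen r hr), List.map_const',
    List.sum_replicate, rowsAbove, length_foldr_resolveRow, length_splits]
  rfl

end Rows

/-! ### The running time of the search -/

theorem varOrder_eq {n : ℕ} (π : Equiv.Perm (Fin n)) : varOrder π =
    (List.finRange n).map fun j => ((List.finRange n).find? fun i => decide (π i = j)).getD j := by
  refine List.map_congr_left fun j _ => ?_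
  cases hfind : (List.finRange n).find? fun i => decide (π i = j) with
  | none => exact absurd (List.find?_eq_none.1 hfind (π.symm j) (List.mem_finRange _)) (by simp)
  | some i => exact π.symm_apply_eq.2 (by simpa [eq_comm] using List.find?_some hfind)

section Size

variable {n : ℕ}

theorem dataSize_literal_le (w : Fin n) (b : Bool) :
    dataSize (⟨w, b⟩ : Literal n) ≤ dataSize w + 4 :=
  Nat.add_le_add_right (Nat.add_le_add_left (Data.size_ofBool_le b) _) 1

theorem dataSize_clause_le (C : Clause n) : dataSize C ≤ n * 6 + 1 := by
  have h := dataSize_list_le (k := 5) (l := List.ofFn fun i : Fin n =>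
    if (⟨i, true⟩ : Literal n) ∈ C.1 then 2 else if (⟨i, false⟩ : Literal n) ∈ C.1 then 1 else 0)
    (by
      intro a ha
      obtain ⟨i, rfl⟩ := (List.mem_ofFn' _ _).1 ha
      dsimp only
      split_ifs <;> decide)
  rwa [List.length_ofFn] at h

theorem le_dataSize (k : ℕ) : k ≤ dataSize k := by
  have h := length_lt_dataSize (List.replicate k Data.nil)
  rw [List.length_replicate, dataSize, ← toData_nat] at h
  exact h.le

end Size

namespace PolyTime

variable {X : Type} [DataEncodable X] {n : X → ℕ}

theorem nat_bdd {k : X → ℕ} (hk : PolyTime k) : PolyBdd dataSize k :=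
  hk.dataSize_bdd.mono fun _ => le_dataSize _

theorem find?_getD {α : X → Type} [∀ x, DataEncodable (α x)] {l : ∀ x, List (α x)}
    {p : ∀ x, α x → Bool} {d : ∀ x, α x} (hl : PolyTime l)
    (hp : PolyTime fun q : Σ x, α x => p q.1 q.2) (hd : PolyTime d) :
    PolyTime fun x => ((l x).find? (p x)).getD (d x) :=
  ((hl.filter hp).headD hd).congr fun x => by
    rw [List.headD_eq_head?_getD, List.head?_filter]

theorem varOrder {π : ∀ x, Equiv.Perm (Fin (n x))} (hn : PolyTime n)
    (hπ : PolyTime fun x => List.ofFn (π x)) : PolyTime fun x => varOrder (π x) := by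
  refine (hn.finRange.map ?_).congr fun x => (varOrder_eq (π x)).symm
  refine find?_getD (l := fun p : Σ x, Fin (n x) => List.finRange (n p.1)) hn.finRange.weaken ?_
    sigmaSnd
  exact (apply_ofFn (n := fun q : Σ p : Σ x, Fin (n x), Fin (n p.1) => n q.1.1)
    (f := fun q => π q.1.1) hπ.weaken.weaken sigmaSnd).decide_eq sigmaSnd.weaken

section Lines

variable {M L T : ∀ x, Line (n x)} {l : ∀ x, Literal (n x)} {B : ∀ x, List (Line (n x))}
  {us : ∀ x, List (Fin (n x))}

theorem decide_isUnitUnder (hT : PolyTime T) (hM : PolyTime M) (hl : PolyTime l) :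
    PolyTime fun x => decide (IsUnitUnder (T x) (M x) (l x)) :=
  ((hM.decide_mem hl).and (hM.all (p := fun x m => decide (m ∈ l x :: T x))
    ((hl.cons hT).weaken.decide_mem sigmaSnd))).congr fun x => by
      rw [Bool.eq_iff_iff]
      simp [IsUnitUnder]

theorem falseLits (hB : PolyTime B) (hL : PolyTime L) (hus : PolyTime us) :
    PolyTime fun x => falseLits (B x) (L x) (us x) := by
  refine hus.foldl_of_additive (β := fun x => Line (n x)) nil ?_
    (k := fun x => 2 * (dataSize (us x) + 4 + 1) + 1)
    (((PolyBdd.const 2).mul ((hus.dataSize_bdd.add (.const 4)).add (.const 1))).add (.const 1))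
    fun x T w hw => ?_
  · have lit (b : Bool) : PolyTime fun p : Σ x, Line (n x) × Fin (n x) =>
        (⟨p.2.2, b⟩ : Literal (n p.1)) :=
      literal (n := fun p : Σ x, Line (n x) × Fin (n x) => n p.1) sigmaSnd.snd (.const b)
    refine sigmaSnd.fst.append (((lit true).cons ((lit false).cons nil)).filter ?_)
    refine (hL.weaken.weaken.decide_mem sigmaSnd).or (hB.weaken.weaken.any ?_)
    have known : PolyTime fun p : Σ x, Line (n x) × Fin (n x) => p.2.1 := sigmaSnd.fst
    exact decide_isUnitUnder
      (n := fun r : Σ q : Σ p : Σ x, Line (n x) × Fin (n x), Literal (n p.1), Line (n q.1.1) =>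
        n r.1.1.1) known.weaken.weaken sigmaSnd
      (neg (n := fun q : Σ p : Σ x, Line (n x) × Fin (n x), Literal (n p.1) => n q.1.1)
        sigmaSnd).weaken
  · have hlits (p : Literal (n x) → Bool) :
        dataSize ([(⟨w, true⟩ : Literal (n x)), ⟨w, false⟩].filter p) ≤
          2 * (dataSize (us x) + 4 + 1) + 1 := by
      refine (dataSize_list_le (k := dataSize (us x) + 4) fun l hl => ?_).trans
        (Nat.add_le_add_right (Nat.mul_le_mul_right _ (List.length_filter_le ..)) 1)
      have hsize := dataSize_lt_of_mem hw
      have hl := List.mem_of_mem_filter hl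
      simp only [List.mem_cons, List.not_mem_nil, or_false] at hl
      obtain rfl | rfl := hl <;> exact (dataSize_literal_le ..).trans (by omega)
    exact Nat.le_of_succ_le ((dataSize_append ..).le.trans (Nat.add_le_add_left (hlits _) _))

end Lines

section Rows

variable {us : ∀ x, List (Fin (n x))} {w : ∀ x, Fin (n x)} {E F : ∀ x, Clause (n x)}

theorem resLits (hn : PolyTime n) (hw : PolyTime w) (hE : PolyTime E) (hF : PolyTime F) :
    PolyTime fun x => resLits (w x) (E x) (F x) := by
  have erase (b : Bool) {C : ∀ x, Clause (n x)} (hC : PolyTime C) : PolyTime fun x =>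
      (C x).lits.filter fun l => !decide (l = ⟨w x, b⟩) :=
    (lits hn hC).filter (sigmaSnd.decide_eq (hw.literal (.const b)).weaken).not
  exact (erase true hE).append (erase false hF)

theorem mergeClauses (hn : PolyTime n) (hus : PolyTime us) (hw : PolyTime w) (hE : PolyTime E)
    (hF : PolyTime F) : PolyTime fun x => mergeClauses (us x) (w x) (E x) (F x) := by
  have hres := resLits hn hw hE hF
  refine ite (hE.decide_mem_clause (hw.literal (.const true)))
    (ite (hF.decide_mem_clause (hw.literal (.const false)))
      (ite (hres.all ?_).decide_eq_true (ofLits hn hres) hE) hF) hE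
  exact (hres.weaken.decide_mem (neg (n := fun p : Σ x, Literal (n x) => n p.1) sigmaSnd)).not.and
    (hus.weaken.decide_mem (var (n := fun p : Σ x, Literal (n x) => n p.1) sigmaSnd))

theorem searchTarget {T : ∀ x, Line (n x)} {B : ∀ x, Row (n x)} {c : ∀ x, Line (n x) × Clause (n x)}
    {l : ∀ x, Literal (n x)} (hT : PolyTime T) (hB : PolyTime B) (hc : PolyTime c)
    (hl : PolyTime l) : PolyTime fun x => searchTarget (T x) (B x) (c x) (l x) :=
  hB.find?_getD (decide_isUnitUnder (n := fun p : Σ x, Line (n x) × Clause (n x) => n p.1)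
    hT.weaken sigmaSnd.fst hl.weaken) hc

theorem resolveRow {row : ∀ x, Row (n x)} (hn : PolyTime n) (hus : PolyTime us) (hw : PolyTime w)
    (hrow : PolyTime row) : PolyTime fun x => resolveRow (us x) (w x) (row x) := by
  refine hrow.splits.map (f := fun x q => (q.2.1, OrderedCDCL.mergeClauses (us x) (w x)
    (OrderedCDCL.searchTarget _ _ _ _).2 (OrderedCDCL.searchTarget _ _ _ _).2)) ?_
  let m : (Σ x, Row (n x) × Line (n x) × Clause (n x)) → ℕ := fun p => n p.1
  have hT : PolyTime fun p : Σ x, Row (n x) × Line (n x) × Clause (n x) =>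
      OrderedCDCL.falseLits (p.2.1.map Prod.fst) p.2.2.1 (us p.1) :=
    falseLits (n := m) (sigmaSnd.fst.map sigmaSnd.fst) sigmaSnd.snd.fst hus.weaken
  have target (b : Bool) : PolyTime fun p : Σ x, Row (n x) × Line (n x) × Clause (n x) =>
      (OrderedCDCL.searchTarget (OrderedCDCL.falseLits (p.2.1.map Prod.fst) p.2.2.1 (us p.1))
        p.2.1 p.2.2 ⟨w p.1, b⟩).2 :=
    (searchTarget (n := m) hT sigmaSnd.fst sigmaSnd.snd
      (literal (n := m) hw.weaken (.const b))).snd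
  exact sigmaSnd.snd.fst.pair
    (mergeClauses (n := m) hn.weaken hus.weaken hw.weaken (target true) (target false))

theorem zero (hn : PolyTime n) : PolyTime fun x => Clause.zero (n x) :=
  (ofLits (L := fun _ => []) hn nil).congr fun x => by simp [Clause.ofLits, Clause.zero]

variable {vs : ∀ x, List (Fin (n x))} {τ : ∀ x, List (Clause (n x))} {P : ∀ x, List (Line (n x))}

theorem leafRow (hn : PolyTime n) (hvs : PolyTime vs) (hτ : PolyTime τ) (hP : PolyTime P) :
    PolyTime fun x => leafRow (vs x) (τ x) (P x) := by
  refine hP.splits.map (sigmaSnd.snd.pair (hτ.weaken.find?_getD ?_ (hτ.headD hn.zero).weaken))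
  let X' : Type := Σ p : Σ x, List (Line (n x)) × Line (n x), Clause (n p.1)
  have hfalse : PolyTime fun p : Σ x, List (Line (n x)) × Line (n x) =>
      OrderedCDCL.falseLits p.2.1 p.2.2 (vs p.1) :=
    falseLits (n := fun p : Σ x, List (Line (n x)) × Line (n x) => n p.1)
      sigmaSnd.fst sigmaSnd.snd hvs.weaken
  exact (lits (n := fun q : X' => n q.1.1) hn.weaken.weaken sigmaSnd).all
    (hfalse.weaken.weaken.decide_mem sigmaSnd)

theorem dataSize_row_le {n : ℕ} {P : List (Line n)} {row : Row n} (h : row.map Prod.fst = P) :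
    dataSize row ≤ P.length * (dataSize P + (n * 6 + 1) + 1 + 1) + 1 := by
  rw [← congrArg List.length h, List.length_map]
  refine dataSize_list_le fun c hc => ?_
  have hline : dataSize c.1 < dataSize P := dataSize_lt_of_mem (h ▸ List.mem_map_of_mem hc)
  have hclause := dataSize_clause_le c.2
  rw [dataSize_prod]
  omega

theorem rowsAbove_leafRow (hn : PolyTime n) (hvs : PolyTime vs) (hτ : PolyTime τ)
    (hP : PolyTime P) :
    PolyTime fun x => rowsAbove (vs x) [OrderedCDCL.leafRow (vs x) (τ x) (P x)] := by
  let k : X → ℕ := fun x => (P x).length * (dataSize (P x) + (n x * 6 + 1) + 1 + 1) + 1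
  have hk : PolyBdd dataSize k :=
    (hP.length_bdd.mul ((((hP.dataSize_bdd.add ((hn.nat_bdd.mul (.const 6)).add (.const 1))).add
      (.const 1))).add (.const 1))).add (.const 1)
  refine (hvs.splits.reverse.foldl (β := fun x => List (Row (n x)))
    ((leafRow hn hvs hτ hP).cons nil)
    (step := fun _ rs q => OrderedCDCL.resolveRow q.1 q.2 (rs.headD []) :: rs) ?_
    (k := fun x => ((vs x).length + 1) * (k x + 1) + 1)
    (((hvs.length_bdd.add (.const 1)).mul (hk.add (.const 1))).add (.const 1))
    fun x l₁ h => ?_).congr fun x => List.foldl_reverse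
  · exact (resolveRow (n := fun p : Σ x, List (Row (n x)) × List (Fin (n x)) × Fin (n x) => n p.1)
      hn.weaken sigmaSnd.snd.fst sigmaSnd.snd.snd (sigmaSnd.fst.headD nil)).cons sigmaSnd.fst
  · have hlen : l₁.length ≤ (vs x).length := by
      simpa [length_splits] using h.length_le
    rw [List.foldl_eq_foldr_reverse]
    refine (dataSize_list_le fun r hr => dataSize_row_le
      (map_fst_of_mem_foldr_resolveRow _ (map_fst_leafRow _) r hr)).trans ?_
    rw [length_foldr_resolveRow, List.length_reverse]
    exact Nat.add_le_add_right (Nat.mul_le_mul_right _ (Nat.add_le_add_right hlen 1)) 1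

theorem orderedOfHalf (hn : PolyTime n) (hvs : PolyTime vs) (hτ : PolyTime τ) (hP : PolyTime P) :
    PolyTime fun x => orderedOfHalf (vs x) (τ x) (P x) :=
  (rowsAbove_leafRow hn hvs hτ hP).reverse.flatMap (sigmaSnd.map sigmaSnd.snd)

end Rows

end PolyTime

/-! ### Trails -/

section Trail

variable {n : ℕ} {C : Clause n} {t : Trail n} {l : Literal n}

theorem Trail.mem_lits_iff : l ∈ t.lits ↔ ∃ e ∈ t, e.lit = l := List.mem_map

theorem Trail.mem_lits_append_singleton {e : AnnAssignment n} :
    l ∈ Trail.lits (t ++ [e]) ↔ l ∈ t.lits ∨ l = e.lit := by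
  simp [Trail.lits]

theorem Trail.assigns_iff {x : Fin n} : t.Assigns x ↔ x ∈ t.map (·.lit.var) := by
  simp [Trail.Assigns]

theorem Trail.assigns_var_iff : t.Assigns l.var ↔ l ∈ t.lits ∨ l.neg ∈ t.lits := by
  simp only [Trail.Assigns, mem_lits_iff, ← exists_or, ← and_or_left]
  refine exists_congr fun e => and_congr_right fun _ => ⟨Literal.eq_or_eq_neg, ?_⟩
  rintro (h | h) <;> simp [h]

theorem Trail.neg_notMem_lits (hnd : (t.map (·.lit.var)).Nodup) (hl : l ∈ t.lits) :
    l.neg ∉ t.lits := by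
  intro hneg
  obtain ⟨e, he, rfl⟩ := mem_lits_iff.1 hl
  obtain ⟨f, hf, hfe⟩ := mem_lits_iff.1 hneg
  obtain rfl : e = f := List.inj_on_of_nodup_map hnd he hf (by simp [hfe])
  exact Literal.neg_ne _ hfe.symm

theorem Trail.exists_assignment (hnd : (t.map (·.lit.var)).Nodup) :
    ∃ v : Fin n → Bool, ∀ l ∈ t.lits, v l.var = l.sign := by
  refine ⟨fun x => decide ((⟨x, true⟩ : Literal n) ∈ t.lits), ?_⟩
  rintro ⟨x, _ | _⟩ hl
  · simpa [Literal.neg] using neg_notMem_lits hnd hl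
  · simpa using hl

theorem Clause.restrict_eq_none_iff : C.restrict t = none ↔ ∃ l ∈ C.1, l ∈ t.lits := by
  simp [Clause.restrict]

theorem Clause.restrict_eq_some_iff {S : Finset (Literal n)} : C.restrict t = some S ↔
    (∀ l ∈ C.1, l ∉ t.lits) ∧ (C.1.filter fun l => l.neg ∉ t.lits) = S := by
  simp [Clause.restrict]

theorem Clause.restrict_eq_empty_iff :
    C.restrict t = some ∅ ↔ ∀ l ∈ C.1, l ∉ t.lits ∧ l.neg ∈ t.lits := by
  simp [restrict_eq_some_iff, Finset.filter_eq_empty_iff, forall₂_and]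

theorem Clause.restrict_eq_unit_iff : C.restrict t = some {l} ↔
    l ∈ C.1 ∧ ¬ t.Assigns l.var ∧ ∀ m ∈ C.1, m ≠ l → m ∉ t.lits ∧ m.neg ∈ t.lits := by
  simp only [restrict_eq_some_iff, Finset.ext_iff, Finset.mem_filter, Finset.mem_singleton,
    Trail.assigns_var_iff]
  grind

end Trail

/-- In a trail produced with the amendment `π-D` every decision is minimal among the variables
that are unassigned when it is made. -/
structure OrderedTrail {n : ℕ} (π : Equiv.Perm (Fin n)) (t : Trail n) : Prop where
  nodup : (t.map (·.lit.var)).Nodup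
  decision_le : ∀ p e s, t = p ++ e :: s → e.ann = Ann.d →
    ∀ y, ¬ Trail.Assigns p y → π e.lit.var ≤ π y

namespace OrderedTrail

variable {n : ℕ} {π : Equiv.Perm (Fin n)} {t p s : Trail n} {e f : AnnAssignment n}

theorem nil : OrderedTrail π [] := ⟨by simp, by simp⟩

theorem of_isPrefix (h : OrderedTrail π t) (hp : p <+: t) : OrderedTrail π p := by
  obtain ⟨s, rfl⟩ := hp
  refine ⟨?_, fun q e r hq => h.decision_le q e (r ++ s) (by simp [hq])⟩
  exact (List.map_append ▸ h.nodup).of_append_left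

theorem append_singleton (h : OrderedTrail π t) (he : ¬ t.Assigns e.lit.var)
    (hd : e.ann = Ann.d → ∀ y, ¬ t.Assigns y → π e.lit.var ≤ π y) :
    OrderedTrail π (t ++ [e]) := by
  rw [Trail.assigns_iff] at he
  refine ⟨?_, fun p f s hp => ?_⟩
  · simpa [List.nodup_append, h.nodup] using fun f hf hfe => he (List.mem_map.2 ⟨f, hf, hfe⟩)
  · obtain rfl | ⟨s, g, rfl⟩ := List.eq_nil_or_concat s
    · obtain ⟨rfl, hef⟩ := List.append_inj' hp rfl
      obtain rfl : e = f := by simpa using hef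
      exact hd
    · rw [List.concat_eq_append, ← List.cons_append, ← List.append_assoc] at hp
      exact h.decision_le p f s (List.append_inj' hp rfl).1

theorem decision_lt (h : OrderedTrail π t) (ht : t = p ++ f :: s) (he : e ∈ p)
    (hd : e.ann = Ann.d) : π e.lit.var < π f.lit.var := by
  obtain ⟨p₁, p₂, rfl⟩ := List.append_of_mem he
  have hnd := h.nodup
  simp only [ht, List.map_append, List.map_cons, List.append_assoc, List.cons_append,
    List.nodup_append, List.nodup_cons] at hnd
  obtain ⟨-, ⟨he', -⟩, hdisj⟩ := hnd
  refine lt_of_le_of_ne (h.decision_le p₁ e (p₂ ++ f :: s) (by simp [ht]) hd _ ?_) ?_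
  · rw [Trail.assigns_iff]
    exact fun hf => hdisj _ hf _ (by simp) rfl
  · exact fun hef => he' (by simp [π.injective hef])

theorem length_le (h : OrderedTrail π t) : t.length ≤ n := by
  simpa using h.nodup.length_le_card

theorem transition {S : State n} (h : OrderedTrail π S.trail) {A : Action n}
    (hA : A ∈ S.actions) (hD : A ∉ orderedD π S) : OrderedTrail π (S.transition A).trail := by
  cases A with
  | decide l =>
    exact h.append_singleton hA fun _ y hy => not_lt.1 fun hlt => hD ⟨l, rfl, y, hy, hlt⟩
  | propagate l =>
    obtain ⟨C, -, hC⟩ := hA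
    exact h.append_singleton (Clause.restrict_eq_unit_iff.1 hC).2.1 (by simp)
  | learn C t =>
    obtain ⟨-, -, rfl⟩ | ⟨-, -, -, ht, -⟩ := hA
    · exact .nil
    · exact h.of_isPrefix ht

end OrderedTrail

/-! ### Conflict analysis -/

/-- The assignment `e`, made by a trail whose marked literals are the complements of those in
`T`, takes part in the derivation of `D` from the clauses in `K`. -/
def IsMarked {n : ℕ} (K : List (Clause n)) (D : Clause n) (T : Line n) (e : AnnAssignment n) :
    Prop :=
  if e.ann = Ann.u then ∃ C ∈ K, IsUnitUnder T C.lits e.lit else e.lit.neg ∈ D.1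

instance {n : ℕ} (K : List (Clause n)) (D : Clause n) (T : Line n) (e : AnnAssignment n) :
    Decidable (IsMarked K D T e) :=
  inferInstanceAs (Decidable (ite _ _ _))

/-- The complements of the marked literals of the trail, when `D` is learned: a decision is
marked if it falsifies a literal of `D`, a propagated literal if it has a reason in which all the
other literals are complements of marked ones. -/
def marked {n : ℕ} (K : List (Clause n)) (D : Clause n) (t : Trail n) : Line n :=
  t.foldl (fun T e => if IsMarked K D T e then T ++ [e.lit.neg] else T) []

/-- The complements of the marked decisions of the trail. -/
def markedDecisions {n : ℕ} (D : Clause n) (t : Trail n) : Line n :=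
  (t.filter fun e => decide (e.ann = Ann.d ∧ e.lit.neg ∈ D.1)).map (·.lit.neg)

/-- The lines that say that a marked propagated literal follows from the marked decisions
before it. -/
def trailLines {n : ℕ} (K : List (Clause n)) (D : Clause n) (t : Trail n) : List (Line n) :=
  ((splits t).filter fun q => decide (q.2.ann = Ann.u ∧ IsMarked K D (marked K D q.1) q.2)).map
    fun q => q.2.lit :: markedDecisions D q.1

section Marked

variable {n : ℕ} {π : Equiv.Perm (Fin n)} {K : List (Clause n)} {D : Clause n} {t p s : Trail n}
  {e : AnnAssignment n} {l : Literal n} {N : Line n}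

theorem mem_marked_append_singleton : l ∈ marked K D (t ++ [e]) ↔
    l ∈ marked K D t ∨ IsMarked K D (marked K D t) e ∧ l = e.lit.neg := by
  rw [marked, List.foldl_append, ← marked, List.foldl_cons, List.foldl_nil]
  split_ifs with h <;> simp [h]

theorem mem_marked : l ∈ marked K D t ↔
    ∃ q ∈ splits t, IsMarked K D (marked K D q.1) q.2 ∧ l = q.2.lit.neg := by
  induction t using List.reverseRecOn with
  | nil => simp [marked, splits]
  | append_singleton t e ih =>
    simp only [mem_marked_append_singleton, splits_append_singleton, List.mem_append,
      List.mem_singleton, or_and_right, exists_or, exists_eq_left, ih]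

theorem mem_markedDecisions :
    l ∈ markedDecisions D t ↔ ∃ e ∈ t, e.ann = Ann.d ∧ e.lit.neg ∈ D.1 ∧ e.lit.neg = l := by
  simp [markedDecisions, and_assoc]

theorem mem_trailLines : N ∈ trailLines K D t ↔ ∃ q ∈ splits t, q.2.ann = Ann.u ∧
    IsMarked K D (marked K D q.1) q.2 ∧ q.2.lit :: markedDecisions D q.1 = N := by
  simp [trailLines, and_assoc]

theorem mem_clause_of_mem_markedDecisions (h : l ∈ markedDecisions D t) : l ∈ D.1 := by
  obtain ⟨e, -, -, he, rfl⟩ := mem_markedDecisions.1 h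
  exact he

theorem length_trailLines_le : (trailLines K D t).length ≤ t.length := by
  rw [trailLines, List.length_map, ← length_splits t]
  exact List.length_filter_le _ _

theorem trailLines_append_singleton : trailLines K D (t ++ [e]) = trailLines K D t ++
    if e.ann = Ann.u ∧ IsMarked K D (marked K D t) e then [e.lit :: markedDecisions D t]
    else [] := by
  simp only [trailLines, splits_append_singleton, List.filter_append, List.map_append]
  split_ifs with h <;> simp [h]

theorem OrderedTrail.mem_markedDecisions_or_exists_trailLine (h : OrderedTrail π t)
    (hl : l ∈ marked K D t) : l ∈ markedDecisions D t ∨ ∃ N ∈ trailLines K D t, l.neg ∈ N ∧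
      ∀ m ∈ N, m ≠ l.neg → m ∈ markedDecisions D t ∧ π m.var < π l.var := by
  obtain ⟨⟨p, e⟩, hpe, hmark, rfl⟩ := mem_marked.1 hl
  obtain ⟨s, ht⟩ := mem_splits.1 hpe
  cases hann : e.ann with
  | d =>
    exact .inl (mem_markedDecisions.2
      ⟨e, by simp [ht], hann, by simpa [IsMarked, hann] using hmark, rfl⟩)
  | u =>
    refine .inr ⟨_, mem_trailLines.2 ⟨_, hpe, hann, hmark, rfl⟩, by simp, fun m hm hme => ?_⟩
    obtain ⟨f, hf, hfd, hfD, rfl⟩ :=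
      mem_markedDecisions.1 ((List.mem_cons.1 hm).resolve_left (by simpa using hme))
    exact ⟨mem_markedDecisions.2 ⟨f, by simp [ht, hf], hfd, hfD, rfl⟩, h.decision_lt ht hf hfd⟩

theorem OrderedTrail.halfJustified {τ : List (Clause n)} {Q : List (Line n)} {L : Line n}
    (h : OrderedTrail π t) (hK : ∀ C ∈ K, C ∈ τ ∨ C.lits ∈ Q) {C : Clause n} (hC : C ∈ K)
    (hCt : ∀ l ∈ C.1, l ∈ L ∨ l ∈ marked K D t) (hL : markedDecisions D t ⊆ L) :
    HalfJustified π τ (Q ++ trailLines K D t) L := by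
  refine ⟨C.lits, ?_, fun l hl => ?_⟩
  · exact (hK C hC).symm.imp (List.mem_append_left _) fun hτ => ⟨C, hτ, rfl⟩
  · obtain hlL | hl := hCt l (Clause.mem_lits.1 hl)
    · exact .inl hlL
    obtain hl | ⟨N, hN, hlN, hNt⟩ := h.mem_markedDecisions_or_exists_trailLine hl
    · exact .inl (hL hl)
    · exact .inr ⟨N, List.mem_append_right _ hN, hlN,
        fun m hm hml => (hNt m hm hml).imp_left fun hm => hL hm⟩

/-- The invariant of the conflict analysis that derives `D`, read forwards along the trail
`p ++ s`: of the clause `E` from which `D` is derived by resolving on propagated literals of `p`,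
only marked literals are falsified by `p`, and all its literals falsified by decisions in `s` have
survived in `D`. -/
structure MarkedUpTo {n : ℕ} (K : List (Clause n)) (D : Clause n) (p s : Trail n) (E : Clause n) :
    Prop where
  mem_marked : ∀ l ∈ E.1, l.neg ∈ p.lits → l ∈ marked K D p
  mem_learned : ∀ e ∈ s, e.ann = Ann.d → e.lit.neg ∈ E.1 → e.lit.neg ∈ D.1

theorem MarkedUpTo.step {E F : Clause n} (h : MarkedUpTo K D p (e :: s) E)
    (hnd : ((e :: s).map (·.lit.var)).Nodup) (hFE : ∀ l ∈ F.1, l ≠ e.lit.neg → l ∈ E.1)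
    (he : e.lit.neg ∈ F.1 → IsMarked K D (marked K D p) e) : MarkedUpTo K D (p ++ [e]) s F := by
  refine ⟨fun l hl hlp => ?_, fun f hf hfd hfF => ?_⟩
  · rw [mem_marked_append_singleton]
    by_cases hle : l = e.lit.neg
    · exact .inr ⟨he (hle ▸ hl), hle⟩
    · refine .inl (h.mem_marked l (hFE l hl hle) ?_)
      refine (Trail.mem_lits_append_singleton.1 hlp).resolve_right fun hneg => hle ?_
      rw [← hneg, Literal.neg_neg]
  · refine h.mem_learned f (List.mem_cons_of_mem _ hf) hfd (hFE _ hfF fun hfe => ?_)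
    have hvar : f.lit.var = e.lit.var := by simpa using congrArg Literal.var hfe
    rw [List.map_cons, List.nodup_cons] at hnd
    exact hnd.1 (hvar ▸ List.mem_map_of_mem hf)

theorem MarkedUpTo.isMarked_of_isResolvent {C E F : Clause n} (h : MarkedUpTo K D p s F)
    (hu : e.ann = Ann.u) (hC : C ∈ K) (hCp : C.restrict p = some {e.lit})
    (hres : IsResolvent C E e.lit F) : IsMarked K D (marked K D p) e := by
  obtain ⟨heC, -, hunit⟩ := Clause.restrict_eq_unit_iff.1 hCp
  rw [IsMarked, if_pos hu]
  refine ⟨C, hC, Clause.mem_lits.2 heC, fun l hl => List.mem_cons.2 (or_iff_not_imp_left.2 ?_)⟩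
  rw [Clause.mem_lits] at hl
  exact fun hle => h.mem_marked l (by simp [hres.2.2, hl, hle]) (hunit l hl hle).2

theorem exists_subset_marked {E : Clause n} (hnd : (s.map (·.lit.var)).Nodup)
    (hE : E ∈ learnableBack K.toFinset p s) (h : MarkedUpTo K D p s E) :
    ∃ C ∈ K, ∀ l ∈ C.1, l ∈ marked K D (p ++ s) := by
  induction s generalizing p E with
  | nil =>
    obtain ⟨hEK, hfalse⟩ := hE
    rw [Clause.restrict_eq_empty_iff] at hfalse
    rw [List.append_nil]
    exact ⟨E, by simpa using hEK, fun l hl => h.mem_marked l hl (hfalse l hl).2⟩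
  | cons e s ih =>
    rw [List.append_cons]
    have hnd' : (s.map (·.lit.var)).Nodup := hnd.of_cons
    rw [learnableBack, backStep] at hE
    split at hE
    next hd =>
      refine ih hnd' hE (h.step hnd (fun _ hl _ => hl) fun he => ?_)
      simpa [IsMarked, hd] using h.mem_learned e (by simp) hd he
    next hu =>
      obtain ⟨hE, hne⟩ | ⟨F, hF, -, C, hC, hCp, hres⟩ := hE
      · exact ih hnd' hE (h.step hnd (fun _ hl _ => hl) fun he => absurd he hne)
      · refine ih hnd' hF (h.step hnd (fun l hl hle => by simp [hres.2.2, hl, hle]) fun _ => ?_)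
        exact h.isMarked_of_isResolvent hu (by simpa using hC) hCp hres

end Marked

/-! ### Runs of CDCL -/

/-- The clauses learned by an action. -/
def Action.learned {n : ℕ} : Action n → List (Clause n)
  | .learn C _ => [C]
  | _ => []

/-- The effect of an action on the trail. -/
def Action.stepTrail {n : ℕ} (t : Trail n) : Action n → Trail n
  | .decide l => t ++ [⟨l, Ann.d⟩]
  | .propagate l => t ++ [⟨l, Ann.u⟩]
  | .learn _ t' => t'

/-- The trail after a sequence of actions that starts from the empty trail. -/
def runTrail {n : ℕ} (As : List (Action n)) : Trail n := As.foldl Action.stepTrail []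

/-- The clauses after a sequence of actions that starts from `τ`. -/
def runClauses {n : ℕ} (τ : List (Clause n)) (As : List (Action n)) : List (Clause n) :=
  τ ++ As.flatMap Action.learned

/-- The lines that derive all the clauses learned by a sequence of actions. -/
def runLines {n : ℕ} (τ : List (Clause n)) (As : List (Action n)) : List (Line n) :=
  (splits As).flatMap fun q => q.2.learned.flatMap fun D =>
    trailLines (runClauses τ q.1) D (runTrail q.1) ++ [D.lits]

/-- The half-ordered refutation obtained from a successful run. -/
def halfOfRun {n : ℕ} (τ : List (Clause n)) (As : List (Action n)) : List (Line n) :=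
  runLines τ As ++ [[]]

section HalfDerivation

variable {n : ℕ} {π : Equiv.Perm (Fin n)} {τ K : List (Clause n)} {Q : List (Line n)} {L : Line n}
  {D : Clause n} {t : Trail n}

theorem IsHalfDerivation.append_singleton (hQ : IsHalfDerivation π τ Q)
    (hL : HalfJustified π τ Q L) : IsHalfDerivation π τ (Q ++ [L]) := by
  intro R M S h
  obtain rfl | ⟨S, N, rfl⟩ := List.eq_nil_or_concat S
  · obtain ⟨rfl, hLM⟩ := List.append_inj' h rfl
    obtain rfl : L = M := by simpa using hLM
    exact hL
  · rw [List.concat_eq_append, ← List.cons_append, ← List.append_assoc] at h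
    exact hQ R M S (List.append_inj' h rfl).1

theorem IsHalfDerivation.append_trailLines (hQ : IsHalfDerivation π τ Q)
    (hK : ∀ C ∈ K, C ∈ τ ∨ C.lits ∈ Q) (ht : OrderedTrail π t) :
    IsHalfDerivation π τ (Q ++ trailLines K D t) := by
  induction t using List.reverseRecOn with
  | nil => simpa [trailLines, splits] using hQ
  | append_singleton t e ih =>
    have ht' : OrderedTrail π t := ht.of_isPrefix (List.prefix_append t [e])
    rw [trailLines_append_singleton]
    split_ifs with h
    · obtain ⟨hu, hmark⟩ := h
      rw [IsMarked, if_pos hu] at hmark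
      obtain ⟨C, hC, -, hunit⟩ := hmark
      rw [← List.append_assoc]
      refine (ih ht').append_singleton (ht'.halfJustified hK hC (fun l hl => ?_) (by simp))
      exact (List.mem_cons.1 (hunit l (Clause.mem_lits.2 hl))).imp_left fun hle => by simp [hle]
    · simpa using ih ht'

theorem IsHalfDerivation.append_learned (hQ : IsHalfDerivation π τ Q)
    (hK : ∀ C ∈ K, C ∈ τ ∨ C.lits ∈ Q) (ht : OrderedTrail π t)
    (hD : D ∈ learnableBack K.toFinset [] t) :
    IsHalfDerivation π τ (Q ++ (trailLines K D t ++ [D.lits])) := by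
  have start : MarkedUpTo K D [] t D := ⟨by simp [Trail.lits], fun _ _ _ he => he⟩
  obtain ⟨C, hC, hCt⟩ := exists_subset_marked ht.nodup hD start
  rw [← List.append_assoc]
  exact (hQ.append_trailLines hK ht).append_singleton (ht.halfJustified hK hC
    (fun l hl => .inr (hCt l hl)) fun l hl =>
      Clause.mem_lits.2 (mem_clause_of_mem_markedDecisions hl))

end HalfDerivation

theorem CNF.Contradictory.mono {n : ℕ} {τ K : CNF n} (hτ : τ.Contradictory) (hK : τ ⊆ K) :
    K.Contradictory := fun ⟨v, hv⟩ => hτ ⟨v, fun C hC => hv C (hK hC)⟩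

theorem State.Terminal.zero_mem {n : ℕ} {S : State n} (hS : S.Terminal)
    (hcontra : S.clauses.Contradictory) (hnd : (S.trail.map (·.lit.var)).Nodup) :
    Clause.zero n ∈ S.clauses := by
  refine hS.resolve_left fun hsat => ?_
  obtain ⟨v, hv⟩ := Trail.exists_assignment hnd
  refine hcontra ⟨v, fun C hC => ?_⟩
  obtain ⟨l, hl, hlt⟩ := Clause.restrict_eq_none_iff.1 (hsat C hC)
  exact ⟨l, hl, hv l hlt⟩

section Run

variable {n : ℕ} {am : List (Amendment n)} {S T : State n} {As Bs : List (Action n)}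

theorem isRun_append :
    IsRun am S (As ++ Bs) T ↔ ∃ U, IsRun am S As U ∧ IsRun am U Bs T := by
  induction As generalizing S with
  | nil => simp [IsRun]
  | cons A As ih => simp only [List.cons_append, IsRun, ih, exists_and_left, and_assoc]

theorem IsRun.trail_eq (h : IsRun am S As T) : T.trail = As.foldl Action.stepTrail S.trail := by
  induction As generalizing S with
  | nil => exact congrArg State.trail h.symm
  | cons A As ih =>
    rw [ih h.2.2.2]
    cases A <;> rfl

theorem IsRun.clauses_eq (h : IsRun am S As T) :
    T.clauses = S.clauses ∪ (As.flatMap Action.learned).toFinset := by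
  induction As generalizing S with
  | nil => simpa using congrArg State.clauses h.symm
  | cons A As ih =>
    rw [ih h.2.2.2]
    cases A <;> simp [State.transition, Action.learned]

theorem IsRun.orderedTrail {π : Equiv.Perm (Fin n)} (hπ : orderedD π ∈ am)
    (h : IsRun am S As T) (hS : OrderedTrail π S.trail) : OrderedTrail π T.trail := by
  induction As generalizing S with
  | nil => exact congrArg State.trail h ▸ hS
  | cons A As ih =>
    obtain ⟨-, hA, hAm, h⟩ := h
    exact ih h (hS.transition hA (hAm _ hπ))

end Run

section RunLines

variable {n : ℕ} {π : Equiv.Perm (Fin n)} {am : List (Amendment n)} {τ : List (Clause n)}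
  {As : List (Action n)} {T : State n}

theorem IsRun.trail_eq_runTrail (h : IsRun am ⟨τ.toFinset, []⟩ As T) : T.trail = runTrail As :=
  h.trail_eq

theorem IsRun.clauses_eq_runClauses (h : IsRun am ⟨τ.toFinset, []⟩ As T) :
    T.clauses = (runClauses τ As).toFinset := by
  rw [h.clauses_eq, runClauses, List.toFinset_append]

theorem mem_or_lits_mem_runLines : ∀ C ∈ runClauses τ As, C ∈ τ ∨ C.lits ∈ runLines τ As := by
  intro C hC
  refine (List.mem_append.1 hC).imp_right fun hC => ?_
  obtain ⟨A, hA, hCA⟩ := List.mem_flatMap.1 hC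
  obtain ⟨p, s, rfl⟩ := List.append_of_mem hA
  exact List.mem_flatMap.2
    ⟨(p, A), mem_splits.2 ⟨s, rfl⟩, List.mem_flatMap.2 ⟨C, hCA, by simp⟩⟩

theorem runLines_append_singleton (A : Action n) :
    runLines τ (As ++ [A]) = runLines τ As ++ A.learned.flatMap fun D =>
      trailLines (runClauses τ As) D (runTrail As) ++ [D.lits] := by
  simp [runLines, splits_append_singleton]

theorem IsRun.isHalfDerivation_runLines (hL : decisionL n ∈ am) (hπ : orderedD π ∈ am)
    (h : IsRun am ⟨τ.toFinset, []⟩ As T) : IsHalfDerivation π τ (runLines τ As) := by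
  induction As using List.reverseRecOn generalizing T with
  | nil =>
    intro Q L S hQ
    simp [runLines, splits] at hQ
  | append_singleton As A ih =>
    obtain ⟨U, hU, -, hA, hAm, -⟩ := isRun_append.1 h
    rw [runLines_append_singleton]
    cases A with
    | decide l => simpa [Action.learned] using ih hU
    | propagate l => simpa [Action.learned] using ih hU
    | learn C t =>
      have hC : C ∈ U.learnableAt 1 := by
        by_contra hC
        exact hAm _ hL ⟨C, t, rfl, hC⟩
      have hC' : C ∈ learnableBack (runClauses τ As).toFinset [] (runTrail As) := by
        rwa [← hU.clauses_eq_runClauses, ← hU.trail_eq_runTrail]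
      have ordered : OrderedTrail π (runTrail As) :=
        hU.trail_eq_runTrail ▸ hU.orderedTrail hπ .nil
      rw [Action.learned, List.flatMap_singleton]
      exact (ih hU).append_learned mem_or_lits_mem_runLines ordered hC'

theorem IsRun.length_runLines_le (hπ : orderedD π ∈ am) (h : IsRun am ⟨τ.toFinset, []⟩ As T) :
    (runLines τ As).length ≤ As.length * (n + 1) := by
  induction As using List.reverseRecOn generalizing T with
  | nil => simp [runLines, splits]
  | append_singleton As A ih =>
    obtain ⟨U, hU, -⟩ := isRun_append.1 h
    have ordered : OrderedTrail π (runTrail As) :=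
      hU.trail_eq_runTrail ▸ hU.orderedTrail hπ .nil
    have new : (A.learned.flatMap fun D =>
        trailLines (runClauses τ As) D (runTrail As) ++ [D.lits]).length ≤ n + 1 := by
      cases A with
      | decide l => simp [Action.learned]
      | propagate l => simp [Action.learned]
      | learn C t => simpa [Action.learned] using length_trailLines_le.trans ordered.length_le
    rw [runLines_append_singleton, List.length_append, List.length_append, List.length_singleton,
      Nat.succ_mul]
    exact Nat.add_le_add (ih hU) new

theorem IsSuccessfulRun.zero_mem_runClauses (hτ : CNF.Contradictory τ.toFinset)
    (hπ : orderedD π ∈ am) (h : IsSuccessfulRun am τ.toFinset As) :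
    Clause.zero n ∈ runClauses τ As := by
  obtain ⟨T, hT, hterm⟩ := h
  have hzero := hterm.zero_mem
    (hτ.mono (hT.clauses_eq ▸ Finset.subset_union_left)) (hT.orderedTrail hπ .nil).nodup
  exact List.mem_toFinset.1 (hT.clauses_eq_runClauses ▸ hzero)

theorem IsSuccessfulRun.isHalfDerivation_halfOfRun (hτ : CNF.Contradictory τ.toFinset)
    (hL : decisionL n ∈ am) (hπ : orderedD π ∈ am) (h : IsSuccessfulRun am τ.toFinset As) :
    IsHalfDerivation π τ (halfOfRun τ As) := by
  have hzero := mem_or_lits_mem_runLines _ (h.zero_mem_runClauses hτ hπ)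
  obtain ⟨T, hT, -⟩ := h
  refine (hT.isHalfDerivation_runLines hL hπ).append_singleton
    ⟨(Clause.zero n).lits, hzero.symm.imp_right fun hτ => ⟨_, hτ, rfl⟩, fun l hl => ?_⟩
  simp [Clause.zero] at hl

theorem IsSuccessfulRun.length_halfOfRun_le (hπ : orderedD π ∈ am)
    (h : IsSuccessfulRun am τ.toFinset As) :
    (halfOfRun τ As).length ≤ As.length * (n + 1) + 1 := by
  obtain ⟨T, hT, -⟩ := h
  simpa [halfOfRun] using hT.length_runLines_le hπ

end RunLines

namespace PolyTime

open DataEncodable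

variable {X : Type} [DataEncodable X] {n : X → ℕ}

section Actions

variable {e : ∀ x, AnnAssignment (n x)} {A : ∀ x, Action (n x)}

theorem decide_ann_eq_u (he : PolyTime e) : PolyTime fun x => decide ((e x).ann = Ann.u) :=
  (toData_iff.2 he).tl

theorem annLit (he : PolyTime e) : PolyTime fun x => (e x).lit := (toData_iff.2 he).hd

theorem annLit_neg (he : PolyTime e) : PolyTime fun x => (e x).lit.neg := he.annLit.neg

theorem learned (hA : PolyTime A) : PolyTime fun x => (A x).learned := by
  have code := toData_iff.2 hA
  refine (ite (code.hd.decide_eq (.const (Data.ofNat 2))) (code.tl.hd.cons nil) nil).congr_toData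
    fun x => ?_
  cases A x <;> rfl

theorem stepTrail {t : ∀ x, Trail (n x)} (ht : PolyTime t) (hA : PolyTime A) :
    PolyTime fun x => (A x).stepTrail (t x) := by
  have code := toData_iff.2 hA
  have entries : PolyTime fun x => (t x).map toData :=
    ht.congr_toData fun x =>
      (toData_map (f := (toData : AnnAssignment (n x) → Data)) (fun _ => rfl) (t x)).symm
  have newEntry : PolyTime fun x => Data.cons (toData (A x)).tl
      (Data.ofBool (decide ((toData (A x)).hd = Data.ofNat 1))) :=
    code.tl.pair (code.hd.decide_eq (.const (Data.ofNat 1)))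
  refine (ite (code.hd.decide_eq (.const (Data.ofNat 2))) code.tl.tl
    (toData_iff.2 (entries.append (newEntry.cons nil)))).congr_toData fun x => ?_
  have toData_concat (e : AnnAssignment (n x)) :
      toData ((t x).map toData ++ [toData e]) = toData (t x ++ [e]) := by
    rw [← toData_map (f := (toData : AnnAssignment (n x) → Data)) (fun _ => rfl) (t x ++ [e]),
      List.map_append, List.map_singleton]
  cases A x with
  | decide l => exact toData_concat ⟨l, Ann.d⟩
  | propagate l => exact toData_concat ⟨l, Ann.u⟩
  | learn C t' => rfl

end Actions

theorem dataSize_stepTrail_le {n : ℕ} (t : Trail n) (A : Action n) :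
    dataSize (A.stepTrail t) ≤ dataSize t + (dataSize A + 5) := by
  have dataSize_concat (l : Literal n) (a : Ann) (hl : dataSize l ≤ dataSize A) :
      dataSize (t ++ [(⟨l, a⟩ : AnnAssignment n)]) ≤ dataSize t + (dataSize A + 5) := by
    have happend := dataSize_append t [(⟨l, a⟩ : AnnAssignment n)]
    have hann := Data.size_ofBool_le (decide (a = Ann.u))
    have hentry : dataSize (⟨l, a⟩ : AnnAssignment n) =
      dataSize l + (Data.ofBool (decide (a = Ann.u))).size + 1 := rfl
    simp only [dataSize_cons, dataSize_nil] at happend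
    omega
  have htl : (toData A).tl.size ≤ dataSize A := Data.size_tl_le _
  cases A with
  | decide l => exact dataSize_concat l _ htl
  | propagate l => exact dataSize_concat l _ htl
  | learn C t' =>
    exact (Data.size_tl_le _).trans (htl.trans ((Nat.le_add_right ..).trans (Nat.le_add_left ..)))

section Runs

variable {τ K : ∀ x, List (Clause (n x))} {As : ∀ x, List (Action (n x))}
  {D : ∀ x, Clause (n x)} {t : ∀ x, Trail (n x)} {T : ∀ x, Line (n x)}
  {e : ∀ x, AnnAssignment (n x)}

theorem runTrail (hAs : PolyTime As) : PolyTime fun x => runTrail (As x) :=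
  hAs.foldl_of_additive (β := fun x => Trail (n x)) nil
    (stepTrail (n := fun p : Σ x, Trail (n x) × Action (n x) => n p.1) sigmaSnd.fst sigmaSnd.snd)
    (hAs.dataSize_bdd.add (.const 5)) fun _ t A hA => (dataSize_stepTrail_le t A).trans
      (Nat.add_le_add_left (Nat.add_le_add_right (dataSize_lt_of_mem hA).le _) _)

theorem runClauses (hτ : PolyTime τ) (hAs : PolyTime As) :
    PolyTime fun x => runClauses (τ x) (As x) :=
  hτ.append (hAs.flatMap (learned (n := fun p : Σ x, Action (n x) => n p.1) sigmaSnd))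

theorem decide_isMarked (hn : PolyTime n) (hK : PolyTime K) (hD : PolyTime D) (hT : PolyTime T)
    (he : PolyTime e) : PolyTime fun x => decide (IsMarked (K x) (D x) (T x) (e x)) := by
  have reason := hK.any (p := fun x C => decide (IsUnitUnder (T x) C.lits (e x).lit))
    (decide_isUnitUnder (n := fun p : Σ x, Clause (n x) => n p.1) hT.weaken
      (lits (n := fun p : Σ x, Clause (n x) => n p.1) hn.weaken sigmaSnd) he.annLit.weaken)
  refine (ite he.decide_ann_eq_u reason (hD.decide_mem_clause he.annLit_neg)).congr fun x => ?_
  rw [Bool.eq_iff_iff, decide_eq_true_iff, IsMarked]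
  split_ifs <;> simp only [List.any_eq_true, decide_eq_true_iff]

theorem marked (hn : PolyTime n) (hK : PolyTime K) (hD : PolyTime D) (ht : PolyTime t) :
    PolyTime fun x => marked (K x) (D x) (t x) := by
  let m : (Σ x, Line (n x) × AnnAssignment (n x)) → ℕ := fun p => n p.1
  have entry : PolyTime fun p : Σ x, Line (n x) × AnnAssignment (n x) => p.2.2 := sigmaSnd.snd
  refine ht.foldl_of_additive (β := fun x => Line (n x)) nil
    (ite (decide_isMarked (n := m) hn.weaken hK.weaken hD.weaken sigmaSnd.fst entry)
      (sigmaSnd.fst.append ((annLit_neg (n := m) entry).cons nil)) sigmaSnd.fst)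
    (ht.dataSize_bdd.add (.const 5)) fun x T e he => ?_
  have hvar : dataSize e.lit.var < dataSize (t x) :=
    ((Data.size_hd_le _).trans (Data.size_hd_le (toData e))).trans_lt (dataSize_lt_of_mem he)
  have hneg : dataSize e.lit.neg ≤ _ := dataSize_literal_le e.lit.var (!e.lit.sign)
  have happend := dataSize_append T [e.lit.neg]
  simp only [dataSize_cons, dataSize_nil] at happend
  split_ifs <;> omega

theorem markedDecisions (hD : PolyTime D) (ht : PolyTime t) :
    PolyTime fun x => markedDecisions (D x) (t x) := by
  let m : (Σ x, AnnAssignment (n x)) → ℕ := fun p => n p.1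
  have neg_lit : PolyTime fun p : Σ x, AnnAssignment (n x) => p.2.lit.neg :=
    annLit_neg (n := m) sigmaSnd
  refine (ht.filter ?_).map neg_lit
  refine ((decide_ann_eq_u (n := m) sigmaSnd).not.and
    (decide_mem_clause (n := m) hD.weaken neg_lit)).congr fun p => ?_
  rw [Bool.eq_iff_iff]
  cases p.2.ann <;> simp

theorem trailLines (hn : PolyTime n) (hK : PolyTime K) (hD : PolyTime D) (ht : PolyTime t) :
    PolyTime fun x => trailLines (K x) (D x) (t x) := by
  let m : (Σ x, Trail (n x) × AnnAssignment (n x)) → ℕ := fun p => n p.1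
  have entry : PolyTime fun p : Σ x, Trail (n x) × AnnAssignment (n x) => p.2.2 := sigmaSnd.snd
  have before : PolyTime fun p : Σ x, Trail (n x) × AnnAssignment (n x) => p.2.1 := sigmaSnd.fst
  refine (ht.splits.filter ?_).map
    ((annLit (n := m) entry).cons (markedDecisions (n := m) hD.weaken before))
  exact ((decide_ann_eq_u (n := m) entry).and (decide_isMarked (n := m) hn.weaken hK.weaken
    hD.weaken (marked (n := m) hn.weaken hK.weaken hD.weaken before) entry)).congr
      fun p => (Bool.decide_and ..).symm

theorem halfOfRun (hn : PolyTime n) (hτ : PolyTime τ) (hAs : PolyTime As) :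
    PolyTime fun x => halfOfRun (τ x) (As x) := by
  let m : (Σ x, List (Action (n x)) × Action (n x)) → ℕ := fun p => n p.1
  let k : (Σ p : Σ x, List (Action (n x)) × Action (n x), Clause (m p)) → ℕ := fun p => m p.1
  have before : PolyTime fun p : Σ x, List (Action (n x)) × Action (n x) => p.2.1 := sigmaSnd.fst
  refine (hAs.splits.flatMap ((learned (n := m) sigmaSnd.snd).flatMap ?_)).append (nil.cons nil)
  exact (trailLines (n := k) hn.weaken.weaken
    (runClauses (n := m) hτ.weaken before).weaken sigmaSnd
    (runTrail (n := m) before).weaken).append ((lits (n := k) hn.weaken.weaken sigmaSnd).cons nil)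

end Runs

end PolyTime

/-! ### Simulations by polynomial time functions -/

/-- An input of a simulation of `Q`. -/
structure SimInput (Q : ∀ n : ℕ, Equiv.Perm (Fin n) → RefutationSystem n) where
  n : ℕ
  perm : Equiv.Perm (Fin n)
  clauses : List (Clause n)
  contradictory : CNF.Contradictory clauses.toFinset
  proof : (Q n perm).Proof
  isRefutation : (Q n perm).IsRefutation clauses.toFinset proof

section SimInput

open DataEncodable

variable {P Q : ∀ n : ℕ, Equiv.Perm (Fin n) → RefutationSystem n}

instance : DataEncodable (SimInput Q) where
  toData x := simulationInput x.perm x.clauses ((Q x.n x.perm).encode x.proof)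
  toData_injective := by
    rintro ⟨n, π, τ, hτ, A, hA⟩ ⟨n', π', τ', hτ', A', hA'⟩ h
    simp only [simulationInput, Data.cons.injEq] at h
    obtain ⟨hn, hπ, hclauses, hproof⟩ := h
    obtain rfl := Data.ofNat_injective hn
    obtain rfl : π = π' := Equiv.coe_fn_injective
      (List.ofFn_injective (Data.ofList_injective (Data.ofNat_injective.comp Fin.val_injective) hπ))
    obtain rfl := Data.ofList_injective Clause.encode_injective hclauses
    obtain rfl := (Q n π).encode_injective hproof
    rfl

namespace SimInput

theorem polyTime_n : PolyTime fun x : SimInput Q => x.n := (PolyTime.toData_iff.2 .id).hd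

theorem polyTime_perm : PolyTime fun x : SimInput Q => List.ofFn x.perm :=
  (PolyTime.toData_iff.2 .id).tl.hd

theorem polyTime_clauses : PolyTime fun x : SimInput Q => x.clauses :=
  (PolyTime.toData_iff.2 .id).tl.tl.hd

theorem polyTime_encode_proof : PolyTime fun x : SimInput Q => (Q x.n x.perm).encode x.proof :=
  (PolyTime.toData_iff.2 .id).tl.tl.tl

theorem clauses_ne_nil (x : SimInput Q) : x.clauses ≠ [] := fun h =>
  x.contradictory ⟨fun _ => true, by simp [h]⟩

end SimInput

theorem PSimulates.of_function (f : ∀ x : SimInput Q, (P x.n x.perm).Proof)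
    (hf : ∀ x, (P x.n x.perm).IsRefutation x.clauses.toFinset (f x))
    (hpoly : PolyTime fun x => (P x.n x.perm).encode (f x)) (q : Polynomial ℕ)
    (hsize : ∀ x, (P x.n x.perm).size (f x) ≤ q.eval (x.n + (Q x.n x.perm).size x.proof)) :
    PSimulates P Q := by
  obtain ⟨M, c, ⟨r, hr⟩, hM⟩ := hpoly
  refine ⟨M, q + r, fun n π τ hτ A hA => ?_⟩
  let x : SimInput Q := ⟨n, π, τ, hτ, A, hA⟩
  simp only [Polynomial.eval_add]
  exact ⟨f x, hf x, ⟨c x, hM x, (hr x).trans (Nat.le_add_left ..)⟩,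
    (hsize x).trans (Nat.le_add_right ..)⟩

end SimInput

theorem orderedResolution_pSimulates_cdcl :
    PSimulates (fun _ π => orderedResolution π) (fun n π => cdcl [decisionL n, orderedD π]) := by
  refine .of_function
    (fun x => orderedOfHalf (varOrder x.perm) x.clauses (halfOfRun x.clauses x.proof))
    (fun x => ?_) ?_ ((Polynomial.X + 1) * (Polynomial.X * (Polynomial.X + 1) + 1)) fun x => ?_
  · exact (IsSuccessfulRun.isHalfDerivation_halfOfRun x.contradictory (by simp) (by simp)
      x.isRefutation).isOrderedRefutation x.clauses_ne_nil (by simp [halfOfRun])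
  · let n : SimInput (fun n π => cdcl [decisionL n, orderedD π]) → ℕ := fun x => x.n
    exact PolyTime.orderedOfHalf (n := n) SimInput.polyTime_n
      (.varOrder (n := n) SimInput.polyTime_n SimInput.polyTime_perm) SimInput.polyTime_clauses
      (.halfOfRun (n := n) SimInput.polyTime_n SimInput.polyTime_clauses
        SimInput.polyTime_encode_proof)
  · have hlength := IsSuccessfulRun.length_halfOfRun_le (π := x.perm) (by simp) x.isRefutation
    refine (length_orderedOfHalf _).le.trans ?_
    simp only [length_varOrder, Polynomial.eval_mul, Polynomial.eval_add, Polynomial.eval_X,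
      Polynomial.eval_one]
    refine Nat.mul_le_mul (by omega) (hlength.trans (Nat.add_le_add_right ?_ 1))
    exact Nat.mul_le_mul (Nat.le_add_left ..) (by omega)

/-! ### From ordered refutations to CDCL runs -/

/-- The assignment of `y` that falsifies the literal of `R` with this variable, if there is one. -/
def falseLit {n : ℕ} (R : Clause n) (y : Fin n) : Literal n := ⟨y, !decide (⟨y, true⟩ ∈ R.1)⟩

/-- The variable `x` can be resolved in clauses of `K` to derive `R`, where `us` are the variables
below `x`. -/
def IsPivot {n : ℕ} (K : List (Clause n)) (R : Clause n) (us : List (Fin n)) (x : Fin n) : Prop :=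
  ∃ E ∈ K, ∃ F ∈ K, IsResolvent E F ⟨x, true⟩ R ∧ ∀ l ∈ R.1, l.var ∈ us

instance {n : ℕ} (E F : Clause n) (l : Literal n) (R : Clause n) :
    Decidable (IsResolvent E F l R) := inferInstanceAs (Decidable (_ ∧ _))

instance {n : ℕ} (K : List (Clause n)) (R : Clause n) (us : List (Fin n)) (x : Fin n) :
    Decidable (IsPivot K R us x) :=
  inferInstanceAs (Decidable (∃ E ∈ K, ∃ F ∈ K, _ ∧ _))

/-- The clause learned in order to derive `R` by resolving `x`. The empty clause has to be learned
as soon as it can be, and this is the case if the conflict involves two unit clauses. -/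
def learnedClause {n : ℕ} (K : List (Clause n)) (R : Clause n) (x : Fin n) : Clause n :=
  if Clause.ofLits [⟨x, true⟩] ∈ K ∧ Clause.ofLits [⟨x, false⟩] ∈ K then Clause.zero n else R

/-- The actions that learn `R` by resolving `x`, where `us` are the variables below `x`. -/
def learnActions {n : ℕ} (K : List (Clause n)) (R : Clause n) (us : List (Fin n)) (x : Fin n) :
    List (Action n) :=
  us.map (fun y => Action.decide (falseLit R y)) ++
    [Action.propagate ⟨x, true⟩, Action.learn (learnedClause K R x) []]

/-- The actions after a further line `R` of an ordered refutation. -/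
def runStep {n : ℕ} (vs : List (Fin n)) (τ : List (Clause n)) (As : List (Action n))
    (R : Clause n) : List (Action n) :=
  if Clause.zero n ∈ runClauses τ As ∨ R ∈ runClauses τ As then As
  else As ++ ((splits vs).find? fun q => IsPivot (runClauses τ As) R q.1 q.2).elim []
    fun q => learnActions (runClauses τ As) R q.1 q.2

/-- The run obtained from an ordered refutation `P`, where `vs` are the variables in increasing
order. -/
def runOfOrdered {n : ℕ} (vs : List (Fin n)) (τ P : List (Clause n)) : List (Action n) :=
  P.foldl (runStep vs τ) []

/-- The trail that falsifies the literals of `R` with variables in `us` by decisions. -/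
def decisionTrail {n : ℕ} (R : Clause n) (us : List (Fin n)) : Trail n :=
  us.map fun y => ⟨falseLit R y, Ann.d⟩

section Resolvent

variable {n : ℕ} {E F R : Clause n} {l m : Literal n}

theorem IsResolvent.symm (h : IsResolvent E F l R) : IsResolvent F E l.neg R :=
  ⟨h.2.1, by simpa using h.1, by simp [h.2.2, Finset.union_comm]⟩

theorem IsResolvent.mem_of_mem_left (h : IsResolvent E F l R) (hm : m ∈ E.1) (hne : m ≠ l) :
    m ∈ R.1 := h.2.2 ▸ Finset.mem_union_left _ (Finset.mem_erase.2 ⟨hne, hm⟩)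

theorem IsResolvent.mem_of_mem_right (h : IsResolvent E F l R) (hm : m ∈ F.1) (hne : m ≠ l.neg) :
    m ∈ R.1 := h.symm.mem_of_mem_left hm hne

theorem Clause.ofLits_singleton (l : Literal n) : (Clause.ofLits [l]).1 = {l} := by
  ext m
  rw [mem_ofLits] <;> simp [Literal.neg_ne]

theorem isResolvent_zero_iff : IsResolvent E F l (Clause.zero n) ↔
    E = Clause.ofLits [l] ∧ F = Clause.ofLits [l.neg] := by
  simp only [IsResolvent, Clause.zero, Subtype.ext_iff, Clause.ofLits_singleton,
    eq_comm (a := (∅ : Finset (Literal n))), Finset.union_eq_empty, Finset.erase_eq_empty_iff]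
  grind

end Resolvent

section Conflict

variable {n : ℕ} {C R : Clause n} {us : List (Fin n)} {x : Fin n} {l : Literal n}

theorem falseLit_eq_neg (hl : l ∈ R.1) : falseLit R l.var = l.neg := by
  obtain ⟨y, _ | _⟩ := l
  · simpa [falseLit, Literal.neg] using R.2 _ hl
  · simp [falseLit, Literal.neg, hl]

theorem mem_lits_decisionTrail :
    l ∈ (decisionTrail R us).lits ↔ l.var ∈ us ∧ falseLit R l.var = l := by
  simp only [decisionTrail, Trail.lits, List.map_map, List.mem_map, Function.comp_apply]
  constructor
  · rintro ⟨y, hy, rfl⟩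
    exact ⟨hy, rfl⟩
  · exact fun ⟨hl, h⟩ => ⟨l.var, hl, h⟩

theorem map_var_decisionTrail : (decisionTrail R us).map (·.lit.var) = us := by
  simp [decisionTrail, Function.comp_def, falseLit]

theorem falsified_decisionTrail (hl : l ∈ R.1) (hus : l.var ∈ us) :
    l ∉ (decisionTrail R us).lits ∧ l.neg ∈ (decisionTrail R us).lits :=
  ⟨fun h => Literal.neg_ne l (falseLit_eq_neg hl ▸ (mem_lits_decisionTrail.1 h).2),
    mem_lits_decisionTrail.2 ⟨hus, falseLit_eq_neg hl⟩⟩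

variable {K : CNF n}

theorem mem_learnableBack_of_isResolvent {E F : Clause n} (hE : E ∈ K) (hF : F ∈ K)
    (hres : IsResolvent E F ⟨x, true⟩ C) (hC : ∀ l ∈ C.1, l ∈ R.1 ∧ l.var ∈ us) (hx : x ∉ us) :
    C ∈ learnableBack K (decisionTrail R us) [⟨⟨x, true⟩, Ann.u⟩] := by
  have falsified : ∀ l ∈ C.1, l ∉ (decisionTrail R us).lits ∧ l.neg ∈ (decisionTrail R us).lits :=
    fun l hl => falsified_decisionTrail (hC l hl).1 (hC l hl).2
  have unit : E.restrict (decisionTrail R us) = some {⟨x, true⟩} := by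
    rw [Clause.restrict_eq_unit_iff, Trail.assigns_iff, map_var_decisionTrail]
    exact ⟨hres.1, hx, fun m hm hne => falsified m (hres.mem_of_mem_left hm hne)⟩
  have conflict : F.restrict (decisionTrail R us ++ [⟨⟨x, true⟩, Ann.u⟩]) = some ∅ := by
    refine Clause.restrict_eq_empty_iff.2 fun m hm => ?_
    simp only [Trail.mem_lits_append_singleton, not_or]
    by_cases hne : m = Literal.neg ⟨x, true⟩
    · subst hne
      exact ⟨⟨fun h => hx (mem_lits_decisionTrail.1 h).1, Literal.neg_ne _⟩, .inr (by simp)⟩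
    · have hmC := hres.mem_of_mem_right hm hne
      refine ⟨⟨(falsified m hmC).1, ?_⟩, .inl (falsified m hmC).2⟩
      rintro rfl
      exact hx (hC _ hmC).2
  exact .inr ⟨F, ⟨hF, conflict⟩, hres.2.1, E, hE, unit, hres⟩

theorem zero_mem_learnableBack_iff (h0 : Clause.zero n ∉ K) (hx : x ∉ us) :
    Clause.zero n ∈ learnableBack K (decisionTrail R us) [⟨⟨x, true⟩, Ann.u⟩] ↔
      Clause.ofLits [⟨x, true⟩] ∈ K ∧ Clause.ofLits [⟨x, false⟩] ∈ K := by
  constructor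
  · rintro (⟨⟨h, -⟩, -⟩ | ⟨F, ⟨hF, -⟩, -, E, hE, -, hres⟩)
    · exact absurd h h0
    · obtain ⟨rfl, rfl⟩ := isResolvent_zero_iff.1 hres
      exact ⟨hE, hF⟩
  · rintro ⟨hE, hF⟩
    exact mem_learnableBack_of_isResolvent hE hF (isResolvent_zero_iff.2 ⟨rfl, rfl⟩)
      (by simp [Clause.zero]) hx

theorem learnableBack_append_of_decisions {p t s : Trail n} (ht : ∀ e ∈ t, e.ann = Ann.d) :
    learnableBack K p (t ++ s) = learnableBack K (p ++ t) s := by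
  induction t generalizing p with
  | nil => simp
  | cons e t ih =>
    obtain ⟨he, ht⟩ := List.forall_mem_cons.1 ht
    rw [List.cons_append, learnableBack, backStep, he, ih ht, List.append_assoc]
    rfl

theorem learnableAt_of_decisions {t : Trail n} {e : AnnAssignment n} {k : ℕ}
    (ht : ∀ e ∈ t, e.ann = Ann.d) (hk : k ≤ t.length + 1) :
    State.learnableAt ⟨K, t ++ [e]⟩ k = learnableBack K t [e] := by
  have hk' : k - 1 ≤ t.length := Nat.sub_le_of_le_add hk
  rw [State.learnableAt, List.drop_append_of_le_length hk', List.take_append_of_le_length hk',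
    learnableBack_append_of_decisions fun f hf => ht f (List.mem_of_mem_drop hf),
    List.take_append_drop]

theorem learnable_of_decisions {t : Trail n} {e : AnnAssignment n} (ht : ∀ e ∈ t, e.ann = Ann.d) :
    State.learnable ⟨K, t ++ [e]⟩ = learnableBack K t [e] := by
  ext D
  constructor
  · rintro ⟨k, -, hk, hD⟩
    rwa [learnableAt_of_decisions ht (by simpa using hk)] at hD
  · intro hD
    exact ⟨1, le_rfl, by simp, by rwa [learnableAt_of_decisions ht (by simp)]⟩

end Conflict

section LearnActions

variable {n : ℕ} {π : Equiv.Perm (Fin n)} {K : List (Clause n)} {R : Clause n}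
  {us ws : List (Fin n)} {x : Fin n}

theorem isRun_decisions (hK : CNF.Contradictory K.toFinset) (h0 : Clause.zero n ∉ K)
    (hvs : varOrder π = us ++ ws) :
    IsRun [decisionL n, orderedD π] ⟨K.toFinset, []⟩
      (us.map fun y => Action.decide (falseLit R y)) ⟨K.toFinset, decisionTrail R us⟩ := by
  induction us using List.reverseRecOn generalizing ws with
  | nil => exact rfl
  | append_singleton us y ih =>
    rw [List.append_assoc, List.singleton_append] at hvs
    have hnd := List.nodup_append.1 (hvs ▸ nodup_varOrder : (us ++ y :: ws).Nodup)
    rw [List.map_append, List.map_singleton, isRun_append]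
    refine ⟨_, ih hvs, fun hterm => h0 (List.mem_toFinset.1 (hterm.zero_mem hK ?_)), ?_, ?_, ?_⟩
    · rw [map_var_decisionTrail]
      exact hnd.1
    · change ¬ Trail.Assigns _ _
      rw [Trail.assigns_iff, map_var_decisionTrail]
      exact fun h => hnd.2.2 y h y (by simp) rfl
    · refine List.forall_mem_cons.2 ⟨by rintro ⟨_, _, ⟨⟩, -⟩, List.forall_mem_singleton.2 ?_⟩
      rintro ⟨_, ⟨⟩, z, hz, hlt⟩
      rw [Trail.assigns_iff, map_var_decisionTrail] at hz
      exact hz ((mem_prefix_varOrder hvs).2 hlt)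
    · simp [IsRun, State.transition, decisionTrail]

theorem learnedClause_mem_learnable (h0 : Clause.zero n ∉ K) (hx : x ∉ us)
    (hpivot : IsPivot K R us x) : learnedClause K R x ∈
      learnableBack K.toFinset (decisionTrail R us) [⟨⟨x, true⟩, Ann.u⟩] := by
  obtain ⟨E, hE, F, hF, hres, hR⟩ := hpivot
  rw [learnedClause]
  split_ifs with hunits
  · exact (zero_mem_learnableBack_iff (by simpa using h0) hx).2 (by simpa using hunits)
  · exact mem_learnableBack_of_isResolvent (by simpa using hE) (by simpa using hF) hres
      (fun l hl => ⟨hl, hR l hl⟩) hx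

theorem learn_learnedClause_mem_actions (h0 : Clause.zero n ∉ K) (hR : R ∉ K) (hx : x ∉ us)
    (hpivot : IsPivot K R us x) : Action.learn (learnedClause K R x) [] ∈
      State.actions ⟨K.toFinset, decisionTrail R us ++ [⟨⟨x, true⟩, Ann.u⟩]⟩ := by
  have decisions : ∀ e ∈ decisionTrail R us, e.ann = Ann.d := by simp [decisionTrail]
  have learnable := learnedClause_mem_learnable h0 hx hpivot
  have zero_iff := zero_mem_learnableBack_iff (R := R) (us := us) (x := x)
    (K := K.toFinset) (by simpa using h0) hx
  simp only [List.mem_toFinset] at zero_iff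
  rw [State.actions, Set.mem_ofPred_eq, learnable_of_decisions decisions, zero_iff]
  by_cases hunits : Clause.ofLits [⟨x, true⟩] ∈ K ∧ Clause.ofLits [⟨x, false⟩] ∈ K
  · exact .inl ⟨hunits, if_pos hunits, rfl⟩
  · have hne : R ≠ Clause.zero n := by
      rintro rfl
      exact hunits (zero_iff.1 (by rwa [learnedClause, if_neg hunits] at learnable))
    refine .inr ⟨hunits, learnable, by simpa [learnedClause, if_neg hunits] using hR,
      List.nil_prefix, ?_⟩
    simpa [learnedClause, if_neg hunits, Clause.restrict, Trail.lits, Clause.zero,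
      Subtype.ext_iff] using hne

theorem isRun_learnActions (hK : CNF.Contradictory K.toFinset) (h0 : Clause.zero n ∉ K)
    (hR : R ∉ K) (hvs : varOrder π = us ++ x :: ws) (hpivot : IsPivot K R us x) :
    IsRun [decisionL n, orderedD π] ⟨K.toFinset, []⟩ (learnActions K R us x)
      ⟨insert (learnedClause K R x) K.toFinset, []⟩ := by
  have hnd : (us ++ x :: ws).Nodup := hvs ▸ nodup_varOrder
  have hx : x ∉ us := fun h => (List.nodup_append.1 hnd).2.2 x h x (by simp) rfl
  have nonterminal {t : Trail n} (ht : (t.map (·.lit.var)).Nodup) :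
      ¬ State.Terminal ⟨K.toFinset, t⟩ := fun hterm =>
    h0 (List.mem_toFinset.1 (hterm.zero_mem hK ht))
  have decisions : ∀ e ∈ decisionTrail R us, e.ann = Ann.d := by simp [decisionTrail]
  refine isRun_append.2 ⟨_, isRun_decisions hK h0 hvs, nonterminal ?_, ?_, ?_, nonterminal ?_,
    learn_learnedClause_mem_actions h0 hR hx hpivot, ?_, rfl⟩
  · exact map_var_decisionTrail ▸ hnd.of_append_left
  · obtain ⟨E, hE, F, -, hres, hRus⟩ := hpivot
    refine ⟨E, by simpa using hE, Clause.restrict_eq_unit_iff.2 ⟨hres.1, ?_, fun m hm hne => ?_⟩⟩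
    · rwa [Trail.assigns_iff, map_var_decisionTrail]
    · have hmR := hres.mem_of_mem_left hm hne
      exact falsified_decisionTrail hmR (hRus m hmR)
  · exact List.forall_mem_cons.2 ⟨by rintro ⟨_, _, ⟨⟩, -⟩, List.forall_mem_singleton.2
      (by rintro ⟨_, ⟨⟩, -⟩)⟩
  · rw [List.map_append, map_var_decisionTrail]
    exact List.Nodup.of_append_left (l₂ := ws) (by simpa using hnd)
  · refine List.forall_mem_cons.2 ⟨?_, List.forall_mem_singleton.2 (by rintro ⟨_, ⟨⟩, -⟩)⟩
    rintro ⟨_, _, ⟨⟩, hlearn⟩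
    exact hlearn ((learnableAt_of_decisions decisions (Nat.le_add_left ..)).symm ▸
      learnedClause_mem_learnable h0 hx hpivot)

end LearnActions

section RunOfOrdered

variable {n : ℕ} {π : Equiv.Perm (Fin n)} {τ P K : List (Clause n)} {R : Clause n}
  {As : List (Action n)} {vs us : List (Fin n)} {x : Fin n}

theorem runClauses_append {Bs : List (Action n)} :
    runClauses τ (As ++ Bs) = runClauses τ As ++ Bs.flatMap Action.learned := by
  simp [runClauses]

theorem flatMap_learned_learnActions :
    (learnActions K R us x).flatMap Action.learned = [learnedClause K R x] := by
  simp [learnActions, Action.learned, List.flatMap_map]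

theorem exists_isPivot {E F : Clause n} {l : Literal n} (hE : E ∈ K) (hF : F ∈ K)
    (hres : IsResolvent E F l R) (hside : OrderedSide π l R) :
    ∃ q ∈ splits (varOrder π), IsPivot K R q.1 q.2 := by
  obtain ⟨us, ws, hvs⟩ := List.append_of_mem (mem_varOrder (π := π) l.var)
  refine ⟨(us, l.var), mem_splits.2 ⟨ws, hvs⟩, ?_⟩
  have hus : ∀ m ∈ R.1, m.var ∈ us := fun m hm => (mem_prefix_varOrder hvs).2 (hside m hm)
  obtain ⟨y, _ | _⟩ := l
  · exact ⟨F, hF, E, hE, hres.symm, hus⟩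
  · exact ⟨E, hE, F, hF, hres, hus⟩

theorem runClauses_subset_runStep : runClauses τ As ⊆ runClauses τ (runStep vs τ As R) := by
  rw [runStep]
  split_ifs
  · exact List.Subset.refl _
  · rw [runClauses_append]
    exact List.subset_append_left _ _

theorem isRun_runStep (hτ : CNF.Contradictory τ.toFinset)
    (hrun : IsRun [decisionL n, orderedD π] ⟨τ.toFinset, []⟩ As
      ⟨(runClauses τ As).toFinset, []⟩) :
    IsRun [decisionL n, orderedD π] ⟨τ.toFinset, []⟩ (runStep (varOrder π) τ As R)
      ⟨(runClauses τ (runStep (varOrder π) τ As R)).toFinset, []⟩ := by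
  rw [runStep]
  split_ifs with hdone
  · exact hrun
  obtain ⟨h0, hR⟩ := not_or.1 hdone
  cases hfind : (splits (varOrder π)).find? fun q => IsPivot (runClauses τ As) R q.1 q.2 with
  | none => simpa using hrun
  | some q =>
    obtain ⟨ws, hvs⟩ := mem_splits.1 (List.mem_of_find?_eq_some hfind)
    have hK : CNF.Contradictory (runClauses τ As).toFinset := hτ.mono fun C hC => by
      simp only [runClauses, List.mem_toFinset, List.mem_append] at hC ⊢
      exact .inl hC
    have hpivot : IsPivot (runClauses τ As) R q.1 q.2 := by simpa using List.find?_some hfind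
    have hlearn := isRun_learnActions hK h0 hR hvs hpivot
    rw [Option.elim_some, isRun_append, runClauses_append, flatMap_learned_learnActions]
    refine ⟨_, hrun, ?_⟩
    convert hlearn using 2
    ext C
    simp

theorem mem_runClauses_runStep (hP : P ⊆ runClauses τ As)
    (hR : Justified (OrderedSide π) τ.toFinset P R) :
    Clause.zero n ∈ runClauses τ (runStep (varOrder π) τ As R) ∨
      R ∈ runClauses τ (runStep (varOrder π) τ As R) := by
  rw [runStep]
  split_ifs with hdone
  · exact hdone
  have hRτ : R ∉ τ.toFinset := fun h =>
    hdone (.inr (List.mem_append_left _ (List.mem_toFinset.1 h)))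
  obtain ⟨E, hE, F, hF, l, hres, hside⟩ := hR.resolve_left hRτ
  obtain ⟨q, hq, hpivot⟩ := exists_isPivot (hP hE) (hP hF) hres hside
  obtain ⟨q', hfind⟩ : ∃ q', ((splits (varOrder π)).find? fun q =>
      IsPivot (runClauses τ As) R q.1 q.2) = some q' :=
    Option.isSome_iff_exists.1 (List.find?_isSome.2 ⟨q, hq, by simpa using hpivot⟩)
  rw [hfind, Option.elim_some, runClauses_append, flatMap_learned_learnActions, learnedClause]
  split_ifs <;> simp

theorem isRun_runOfOrdered (hτ : CNF.Contradictory τ.toFinset) :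
    IsRun [decisionL n, orderedD π] ⟨τ.toFinset, []⟩ (runOfOrdered (varOrder π) τ P)
      ⟨(runClauses τ (runOfOrdered (varOrder π) τ P)).toFinset, []⟩ := by
  induction P using List.reverseRecOn with
  | nil => simp [runOfOrdered, runClauses, IsRun]
  | append_singleton P R ih =>
    rw [runOfOrdered, List.foldl_append]
    exact isRun_runStep hτ ih

theorem subset_runClauses_runOfOrdered (hP : IsDerivation (OrderedSide π) τ.toFinset P) :
    Clause.zero n ∈ runClauses τ (runOfOrdered (varOrder π) τ P) ∨
      P ⊆ runClauses τ (runOfOrdered (varOrder π) τ P) := by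
  induction P using List.reverseRecOn with
  | nil => simp
  | append_singleton P R ih =>
    rw [isDerivation_iff] at hP
    have hPQ := ih (isDerivation_iff.2 fun Q C S h => hP Q C (S ++ [R]) (by simp [h]))
    rw [runOfOrdered, List.foldl_append]
    change Clause.zero n ∈ runClauses τ (runStep (varOrder π) τ (runOfOrdered _ τ P) R) ∨ _ ⊆
      runClauses τ (runStep (varOrder π) τ (runOfOrdered _ τ P) R)
    by_cases h0 : Clause.zero n ∈ runClauses τ (runOfOrdered (varOrder π) τ P)
    · exact .inl (runClauses_subset_runStep h0)
    · have hsub := hPQ.resolve_left h0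
      refine (mem_runClauses_runStep hsub (hP P R [] rfl)).imp_right fun hR => ?_
      exact List.append_subset.2 ⟨List.Subset.trans hsub runClauses_subset_runStep,
        by simpa using hR⟩

theorem IsOrderedRefutation.isSuccessfulRun_runOfOrdered (hτ : CNF.Contradictory τ.toFinset)
    (hP : IsOrderedRefutation π τ.toFinset P) :
    IsSuccessfulRun [decisionL n, orderedD π] τ.toFinset (runOfOrdered (varOrder π) τ P) :=
  ⟨_, isRun_runOfOrdered hτ, .inr (List.mem_toFinset.2
    ((subset_runClauses_runOfOrdered hP.1).elim id fun hsub => hsub hP.2))⟩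

theorem length_runStep_le :
    (runStep vs τ As R).length ≤ As.length + (vs.length + 1) := by
  rw [runStep]
  split_ifs
  · exact Nat.le_add_right ..
  cases hfind : (splits vs).find? fun q => IsPivot (runClauses τ As) R q.1 q.2 with
  | none => simp
  | some q =>
    obtain ⟨ws, rfl⟩ := mem_splits.1 (List.mem_of_find?_eq_some hfind)
    simp [learnActions]

theorem length_runOfOrdered_le :
    (runOfOrdered vs τ P).length ≤ P.length * (vs.length + 1) := by
  induction P using List.reverseRecOn with
  | nil => simp [runOfOrdered]
  | append_singleton P R ih =>
    rw [runOfOrdered, List.foldl_append, List.length_append, List.length_singleton, Nat.succ_mul]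
    exact length_runStep_le.trans (Nat.add_le_add_right ih _)

end RunOfOrdered

/-! ### The running time of the construction of the run -/

theorem isResolvent_pos_iff {n : ℕ} {E F R : Clause n} {x : Fin n} :
    IsResolvent E F ⟨x, true⟩ R ↔ ⟨x, true⟩ ∈ E.1 ∧ ⟨x, false⟩ ∈ F.1 ∧
      (∀ l ∈ resLits x E F, l ∈ R.1) ∧ ∀ l ∈ R.lits, l ∈ resLits x E F := by
  have resolvent_eq : R.1 = E.1.erase ⟨x, true⟩ ∪ F.1.erase (Literal.neg ⟨x, true⟩) ↔
      ∀ l, l ∈ R.1 ↔ l ∈ resLits x E F := by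
    simp only [Finset.ext_iff, Finset.mem_union, Finset.mem_erase, mem_resLits, Literal.neg,
      Bool.not_true, and_comm]
  rw [IsResolvent, resolvent_eq]
  refine and_congr_right' (and_congr_right' ?_)
  simp only [Clause.mem_lits, iff_def, forall_and, and_comm]

namespace PolyTime

variable {X : Type} [DataEncodable X] {n : X → ℕ}

theorem find?_elim_nil {α β : X → Type} [∀ x, DataEncodable (α x)] [∀ x, DataEncodable (β x)]
    {l : ∀ x, List (α x)} {p : ∀ x, α x → Bool} {f : ∀ x, α x → List (β x)} (hl : PolyTime l)
    (hp : PolyTime fun q : Σ x, α x => p q.1 q.2) (hf : PolyTime fun q : Σ x, α x => f q.1 q.2) :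
    PolyTime fun x => ((l x).find? (p x)).elim [] (f x) :=
  (((hl.filter hp).map hf).headD nil).congr fun x => by
    rw [List.headD_eq_head?_getD, List.head?_map, List.head?_filter]
    cases (l x).find? (p x) <;> rfl

section Actions

variable {l : ∀ x, Literal (n x)} {C : ∀ x, Clause (n x)} {t : ∀ x, Trail (n x)}

theorem decideAction (hl : PolyTime l) : PolyTime fun x => Action.decide (l x) :=
  ((PolyTime.const (Data.ofNat 0)).pair hl).congr_toData fun _ => rfl

theorem propagateAction (hl : PolyTime l) : PolyTime fun x => Action.propagate (l x) :=
  ((PolyTime.const (Data.ofNat 1)).pair hl).congr_toData fun _ => rfl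

theorem learnAction (hC : PolyTime C) (ht : PolyTime t) :
    PolyTime fun x => Action.learn (C x) (t x) :=
  ((PolyTime.const (Data.ofNat 2)).pair (hC.pair ht)).congr_toData fun _ => rfl

end Actions

variable {vs us : ∀ x, List (Fin (n x))} {v : ∀ x, Fin (n x)} {E F R : ∀ x, Clause (n x)}
  {τ K P : ∀ x, List (Clause (n x))} {As : ∀ x, List (Action (n x))}

theorem falseLit (hR : PolyTime R) (hv : PolyTime v) : PolyTime fun x => falseLit (R x) (v x) :=
  hv.literal (hR.decide_mem_clause (hv.literal (.const true))).not

theorem decide_isResolvent (hn : PolyTime n) (hE : PolyTime E) (hF : PolyTime F) (hv : PolyTime v)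
    (hR : PolyTime R) : PolyTime fun x => decide (IsResolvent (E x) (F x) ⟨v x, true⟩ (R x)) := by
  have hres := resLits hn hv hE hF
  have sound := hres.all (p := fun x l => decide (l ∈ (R x).1))
    (decide_mem_clause (n := fun p : Σ x, Literal (n x) => n p.1) hR.weaken sigmaSnd)
  have complete := (lits hn hR).all
    (p := fun x l => decide (l ∈ OrderedCDCL.resLits (v x) (E x) (F x)))
    (hres.weaken.decide_mem sigmaSnd)
  refine ((hE.decide_mem_clause (hv.literal (.const true))).and
    ((hF.decide_mem_clause (hv.literal (.const false))).and (sound.and complete))).congr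
      fun x => ?_
  rw [Bool.eq_iff_iff, decide_eq_true_iff, isResolvent_pos_iff]
  simp only [Bool.and_eq_true, decide_eq_true_iff, List.all_eq_true]

theorem decide_isPivot (hn : PolyTime n) (hK : PolyTime K) (hR : PolyTime R) (hus : PolyTime us)
    (hv : PolyTime v) : PolyTime fun x => decide (IsPivot (K x) (R x) (us x) (v x)) := by
  let m : (Σ p : Σ x, Clause (n x), Clause (n p.1)) → ℕ := fun p => n p.1.1
  have left : PolyTime fun p : Σ p : Σ x, Clause (n x), Clause (n p.1) => p.1.2 := sigmaSnd.weaken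
  have resolvable := hK.any
    (p := fun x E => (K x).any fun F => decide (IsResolvent E F ⟨v x, true⟩ (R x)))
    (hK.weaken.any (decide_isResolvent (n := m) hn.weaken.weaken left sigmaSnd hv.weaken.weaken
      hR.weaken.weaken))
  have below := (lits hn hR).all (p := fun x l => decide (l.var ∈ us x))
    (hus.weaken.decide_mem (var (n := fun p : Σ x, Literal (n x) => n p.1) sigmaSnd))
  refine (resolvable.and below).congr fun x => ?_
  rw [Bool.eq_iff_iff, decide_eq_true_iff, IsPivot]
  simp only [Bool.and_eq_true, List.any_eq_true, List.all_eq_true, decide_eq_true_iff,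
    Clause.mem_lits]
  grind

theorem learnedClause (hn : PolyTime n) (hK : PolyTime K) (hR : PolyTime R) (hv : PolyTime v) :
    PolyTime fun x => learnedClause (K x) (R x) (v x) := by
  have unit_mem (b : Bool) : PolyTime fun x => decide (Clause.ofLits [⟨v x, b⟩] ∈ K x) :=
    hK.decide_mem (ofLits hn ((hv.literal (.const b)).cons nil))
  exact ite (decide_and (unit_mem true) (unit_mem false)) hn.zero hR

theorem learnActions (hn : PolyTime n) (hK : PolyTime K) (hR : PolyTime R) (hus : PolyTime us)
    (hv : PolyTime v) : PolyTime fun x => learnActions (K x) (R x) (us x) (v x) := by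
  let m : (Σ x, Fin (n x)) → ℕ := fun p => n p.1
  exact (hus.map (decideAction (n := m) (falseLit (n := m) hR.weaken sigmaSnd))).append
    ((propagateAction (hv.literal (.const true))).cons
      (((learnedClause hn hK hR hv).learnAction nil).cons nil))

theorem runStep (hn : PolyTime n) (hvs : PolyTime vs) (hτ : PolyTime τ) (hAs : PolyTime As)
    (hR : PolyTime R) : PolyTime fun x => runStep (vs x) (τ x) (As x) (R x) := by
  let m : (Σ x, List (Fin (n x)) × Fin (n x)) → ℕ := fun p => n p.1
  have hK := runClauses hτ hAs
  refine ite (decide_or (hK.decide_mem hn.zero) (hK.decide_mem hR)) hAs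
    (hAs.append (find?_elim_nil hvs.splits ?_ ?_))
  · exact decide_isPivot (n := m) hn.weaken hK.weaken hR.weaken sigmaSnd.fst sigmaSnd.snd
  · exact learnActions (n := m) hn.weaken hK.weaken hR.weaken sigmaSnd.fst sigmaSnd.snd

end PolyTime

section Size

variable {n : ℕ}

theorem dataSize_decide_le (l : Literal n) : dataSize (Action.decide l) ≤ dataSize l + 2 := by
  change (Data.ofNat 0).size + dataSize l + 1 ≤ _
  rw [show (Data.ofNat 0).size = 1 from rfl]
  omega

theorem dataSize_propagate_le (l : Literal n) : dataSize (Action.propagate l) ≤ dataSize l + 4 := by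
  change (Data.ofNat 1).size + dataSize l + 1 ≤ _
  rw [show (Data.ofNat 1).size = 3 from rfl]
  omega

theorem dataSize_learn_nil_le (C : Clause n) : dataSize (Action.learn C []) ≤ dataSize C + 8 := by
  change (Data.ofNat 2).size + (dataSize C + 1 + 1) + 1 ≤ _
  rw [show (Data.ofNat 2).size = 5 from rfl]
  omega

theorem dataSize_learnActions_le {K : List (Clause n)} {R : Clause n} {us : List (Fin n)}
    {x : Fin n} {k : ℕ} (hus : ∀ y ∈ us, dataSize y ≤ k) (hx : dataSize x ≤ k) :
    dataSize (learnActions K R us x) ≤ (us.length + 2) * (k + n * 6 + 10) + 1 := by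
  have hsize : ∀ A ∈ learnActions K R us x, dataSize A ≤ k + n * 6 + 9 := by
    simp only [learnActions, List.forall_mem_append, List.forall_mem_map, List.forall_mem_cons]
    refine ⟨fun y hy => ?_, ?_, ?_, by simp⟩
    · have hA := dataSize_decide_le (falseLit R y)
      have hlit : dataSize (falseLit R y) ≤ _ := dataSize_literal_le y _
      have hvar := hus y hy
      omega
    · have hA := dataSize_propagate_le ⟨x, true⟩
      have hlit := dataSize_literal_le x true
      omega
    · have hA := dataSize_learn_nil_le (learnedClause K R x)
      have hclause := dataSize_clause_le (learnedClause K R x)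
      omega
  simpa [learnActions, Nat.add_assoc] using dataSize_list_le hsize

theorem dataSize_runStep_le (vs : List (Fin n)) (τ : List (Clause n)) (As : List (Action n))
    (R : Clause n) : dataSize (runStep vs τ As R) ≤
      dataSize As + ((vs.length + 1) * (dataSize vs + n * 6 + 10) + 1) := by
  rw [runStep]
  split_ifs
  · exact Nat.le_add_right ..
  cases hfind : (splits vs).find? fun q => IsPivot (runClauses τ As) R q.1 q.2 with
  | none => simp
  | some q =>
    obtain ⟨ws, hvs⟩ := mem_splits.1 (List.mem_of_find?_eq_some hfind)
    have hmem (y : Fin n) (hy : y ∈ q.1 ∨ y = q.2) : dataSize y ≤ dataSize vs :=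
      (dataSize_lt_of_mem (by rw [hvs]; grind)).le
    have hlength : q.1.length + 2 ≤ vs.length + 1 := by
      rw [hvs, List.length_append, List.length_cons]
      omega
    have hactions := (dataSize_learnActions_le (K := runClauses τ As) (R := R)
      (fun y hy => hmem y (.inl hy)) (hmem q.2 (.inr rfl))).trans
        (Nat.add_le_add_right (Nat.mul_le_mul_right _ hlength) 1)
    have happend := dataSize_append As (learnActions (runClauses τ As) R q.1 q.2)
    simp only [Option.elim_some]
    omega

end Size

theorem PolyTime.runOfOrdered {X : Type} [DataEncodable X] {n : X → ℕ}
    {vs : ∀ x, List (Fin (n x))} {τ P : ∀ x, List (Clause (n x))} (hn : PolyTime n)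
    (hvs : PolyTime vs) (hτ : PolyTime τ) (hP : PolyTime P) :
    PolyTime fun x => runOfOrdered (vs x) (τ x) (P x) :=
  hP.foldl_of_additive (β := fun x => List (Action (n x))) nil
    (runStep (n := fun p : Σ x, List (Action (n x)) × Clause (n x) => n p.1)
      hn.weaken hvs.weaken hτ.weaken sigmaSnd.fst sigmaSnd.snd)
    (((hvs.length_bdd.add (.const 1)).mul
      ((hvs.dataSize_bdd.add (hn.nat_bdd.mul (.const 6))).add (.const 10))).add (.const 1))
    fun _ As R _ => dataSize_runStep_le _ _ As R

theorem cdcl_pSimulates_orderedResolution :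
    PSimulates (fun n π => cdcl [decisionL n, orderedD π]) (fun _ π => orderedResolution π) := by
  refine .of_function (fun x => runOfOrdered (varOrder x.perm) x.clauses x.proof)
    (fun x => x.isRefutation.isSuccessfulRun_runOfOrdered x.contradictory) ?_
    (Polynomial.X * (Polynomial.X + 1)) fun x => ?_
  · let n : SimInput (fun _ π => orderedResolution π) → ℕ := fun x => x.n
    exact PolyTime.runOfOrdered (n := n) SimInput.polyTime_n
      (.varOrder (n := n) SimInput.polyTime_n SimInput.polyTime_perm) SimInput.polyTime_clauses
      SimInput.polyTime_encode_proof
  · refine length_runOfOrdered_le.trans ?_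
    simp only [length_varOrder, Polynomial.eval_mul, Polynomial.eval_add, Polynomial.eval_X,
      Polynomial.eval_one]
    exact Nat.mul_le_mul (Nat.le_add_left ..) (by omega)

/-! ### A separation of ordered from general resolution -/

section Derivation

variable {n : ℕ} {side : Literal n → Clause n → Prop} {τ : CNF n} {P : List (Clause n)}

theorem IsDerivation.induction {p : Clause n → Prop} (h : IsDerivation side τ P)
    (of_mem : ∀ C ∈ P, C ∈ τ → p C)
    (resolvent : ∀ E ∈ P, ∀ F ∈ P, ∀ C ∈ P, ∀ l, p E → p F → IsResolvent E F l C → side l C → p C) :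
    ∀ C ∈ P, p C := by
  suffices ∀ (k : ℕ) (hk : k < P.length), p P[k] by
    intro C hC
    obtain ⟨k, hk, rfl⟩ := List.getElem_of_mem hC
    exact this k hk
  intro k
  induction k using Nat.strongRec with
  | ind k ih =>
    intro hk
    obtain hmem | ⟨i, j, hi, hj, l, hres, hside⟩ := h k hk
    · exact of_mem _ (List.getElem_mem hk) hmem
    · exact resolvent _ (List.getElem_mem _) _ (List.getElem_mem _) _ (List.getElem_mem hk) l
        (ih i hi _) (ih j hj _) hres hside

theorem IsDerivation.append_map_finRange {k : ℕ} {f : Fin k → Clause n}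
    (h : IsDerivation side τ P)
    (hf : ∀ i Q, P ⊆ Q → (∀ j < i, f j ∈ Q) → Justified side τ Q (f i)) :
    IsDerivation side τ (P ++ (List.finRange k).map f) := by
  induction k with
  | zero => simpa using h
  | succ k ih =>
    have hfirst := ih (f := fun i => f i.castSucc) fun i Q hPQ hQ => hf i.castSucc Q hPQ
      fun j hj => by
        obtain ⟨j, rfl⟩ := Fin.exists_castSucc_eq.2 (Fin.ne_last_of_lt hj)
        exact hQ j hj
    rw [List.finRange_succ_last, List.map_append, List.map_map, ← List.append_assoc]
    refine hfirst.append fun C hC => ?_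
    obtain rfl := List.mem_singleton.1 hC
    refine hf _ _ (List.subset_append_left _ _) fun j hj => List.mem_append_right _ ?_
    obtain ⟨j, rfl⟩ := Fin.exists_castSucc_eq.2 hj.ne
    exact List.mem_map_of_mem (f := fun i => f i.castSucc) (List.mem_finRange j)

end Derivation

section Consistent

variable {n : ℕ} {M N R : Line n} {l : Literal n}

theorem forall_mem_cons_neg_notMem (hM : ∀ m ∈ M, m.neg ∉ M) (hl : ∀ m ∈ M, m.var ≠ l.var) :
    ∀ m ∈ l :: M, m.neg ∉ l :: M := by
  have l_neg_notMem : l.neg ∉ M := fun h => hl _ h rfl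
  have neg_ne_l : ∀ m ∈ M, m.neg ≠ l := fun m hm h => hl m hm (by rw [← Literal.neg_var, h])
  simp only [List.mem_cons, not_or]
  rintro m (rfl | hm)
  · exact ⟨Literal.neg_ne m, l_neg_notMem⟩
  · exact ⟨neg_ne_l m hm, hM m hm⟩

theorem isResolvent_ofLits_cons (hR : ∀ m ∈ R, m.neg ∉ R) (hl : ∀ m ∈ R, m.var ≠ l.var)
    (hMN : ∀ m, m ∈ R ↔ m ∈ M ∨ m ∈ N) :
    IsResolvent (Clause.ofLits (l :: M)) (Clause.ofLits (l.neg :: N)) l (Clause.ofLits R) := by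
  have hM : ∀ m ∈ M, m ∈ R := fun m hm => (hMN m).2 (.inl hm)
  have hN : ∀ m ∈ N, m ∈ R := fun m hm => (hMN m).2 (.inr hm)
  have mem_left {m : Literal n} : m ∈ (Clause.ofLits (l :: M)).1 ↔ m = l ∨ m ∈ M := by
    rw [Clause.mem_ofLits (forall_mem_cons_neg_notMem (fun m hm h => hR m (hM m hm) (hM _ h))
      fun m hm => hl m (hM m hm)), List.mem_cons]
  have mem_right {m : Literal n} : m ∈ (Clause.ofLits (l.neg :: N)).1 ↔ m = l.neg ∨ m ∈ N := by
    rw [Clause.mem_ofLits (forall_mem_cons_neg_notMem (l := l.neg)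
      (fun m hm h => hR m (hN m hm) (hN _ h)) fun m hm => hl m (hN m hm)), List.mem_cons]
  refine ⟨mem_left.2 (.inl rfl), mem_right.2 (.inl rfl), ?_⟩
  ext m
  have ne_of_mem (hm : m ∈ R) : m ≠ l ∧ m ≠ l.neg :=
    ⟨fun h => hl m hm (by rw [h]), fun h => hl m hm (by rw [h, Literal.neg_var])⟩
  rw [Clause.mem_ofLits hR, Finset.mem_union, Finset.mem_erase, Finset.mem_erase, mem_left,
    mem_right]
  grind

end Consistent

/-- The total assignment `v` satisfies one of the literals of `M`. -/
def Holds {n : ℕ} (v : Fin n → Bool) (M : Line n) : Prop := ∃ l ∈ M, v l.var = l.sign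

/-- The line `L i` weakened by a literal of the variable `x i`. -/
def weakening {n k : ℕ} (x : Fin k → Fin n) (L : Fin k → Line n) (i : Fin k) (b : Bool) :
    Clause n :=
  Clause.ofLits (⟨x i, b⟩ :: L i)

/-- The CNF obtained from the lines `L i` by weakening each of them in both ways. -/
def weakenings {n k : ℕ} (x : Fin k → Fin n) (L : Fin k → Line n) : List (Clause n) :=
  (List.finRange k).flatMap fun i => [weakening x L i true, weakening x L i false]

/-- The lines `L i` stand for clauses that do not contain the variables `x j`. -/
structure AvoidsVars {n k : ℕ} (x : Fin k → Fin n) (L : Fin k → Line n) : Prop where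
  neg_notMem : ∀ i, ∀ l ∈ L i, l.neg ∉ L i
  var_notMem : ∀ i, ∀ l ∈ L i, l.var ∉ Set.range x

/-- The literals of `E` in variables other than the `x i` follow from those lines `L i` whose
variable `x i` occurs in `E`. -/
def IsEntailed {n k : ℕ} (x : Fin k → Fin n) (L : Fin k → Line n) (E : Clause n) : Prop :=
  ∀ v : Fin n → Bool, (∀ i b, ⟨x i, b⟩ ∈ E.1 → Holds v (L i)) →
    ∃ l ∈ E.1, l.var ∉ Set.range x ∧ v l.var = l.sign

section Weakening

variable {n k : ℕ} {x : Fin k → Fin n} {L : Fin k → Line n} {i : Fin k} {b : Bool}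
  {C E F R : Clause n} {l : Literal n} {P : List (Clause n)}

theorem length_weakenings : (weakenings x L).length = 2 * k := by
  simp [weakenings, mul_comm]

theorem mem_weakenings : C ∈ weakenings x L ↔ ∃ i b, C = weakening x L i b := by
  simp [weakenings, or_comm]

theorem AvoidsVars.var_ne (h : AvoidsVars x L) : ∀ l ∈ L i, l.var ≠ x i :=
  fun l hl hi => h.var_notMem i l hl ⟨i, hi.symm⟩

theorem AvoidsVars.mem_weakening (h : AvoidsVars x L) :
    l ∈ (weakening x L i b).1 ↔ l = ⟨x i, b⟩ ∨ l ∈ L i := by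
  rw [weakening, Clause.mem_ofLits (forall_mem_cons_neg_notMem (h.neg_notMem i) h.var_ne),
    List.mem_cons]

theorem AvoidsVars.isResolvent_weakening (h : AvoidsVars x L) (i : Fin k) :
    IsResolvent (weakening x L i true) (weakening x L i false) ⟨x i, true⟩
      (Clause.ofLits (L i)) :=
  isResolvent_ofLits_cons (h.neg_notMem i) h.var_ne fun _ => (or_self_iff).symm

theorem AvoidsVars.contradictory_weakenings (h : AvoidsVars x L)
    (hL : ∀ v : Fin n → Bool, ∃ i, ¬ Holds v (L i)) :
    CNF.Contradictory (weakenings x L).toFinset := by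
  rintro ⟨v, hv⟩
  obtain ⟨i, hi⟩ := hL v
  obtain ⟨l, hl, hvl⟩ := hv (weakening x L i (!v (x i)))
    (List.mem_toFinset.2 (mem_weakenings.2 ⟨i, _, rfl⟩))
  obtain rfl | hl := h.mem_weakening.1 hl
  · simp at hvl
  · exact hi ⟨l, hl, hvl⟩

theorem AvoidsVars.isEntailed_weakening (h : AvoidsVars x L) :
    IsEntailed x L (weakening x L i b) := by
  intro v hv
  obtain ⟨l, hl, hvl⟩ := hv i b (h.mem_weakening.2 (.inl rfl))
  exact ⟨l, h.mem_weakening.2 (.inr hl), h.var_notMem i l hl, hvl⟩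

theorem IsEntailed.resolvent (hE : IsEntailed x L E) (hF : IsEntailed x L F)
    (hres : IsResolvent E F l R) (hl : l.var ∉ Set.range x) : IsEntailed x L R := by
  intro v hv
  obtain ⟨m, hm, hmx, hvm⟩ := hE v fun i b hi =>
    hv i b (hres.mem_of_mem_left hi fun h => hl ⟨i, congrArg Literal.var h⟩)
  obtain rfl | hne := eq_or_ne m l
  · obtain ⟨m', hm', hmx', hvm'⟩ := hF v fun i b hi =>
      hv i b (hres.mem_of_mem_right hi fun h => hl ⟨i, congrArg Literal.var h⟩)
    refine ⟨m', hres.mem_of_mem_right hm' ?_, hmx', hvm'⟩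
    rintro rfl
    rw [Literal.neg_var, hvm] at hvm'
    simp [Literal.neg] at hvm'
  · exact ⟨m, hres.mem_of_mem_left hm hne, hmx, hvm⟩

theorem IsEntailed.mem_of_forall_mem_range {β : Fin k → Bool} (hE : IsEntailed x L E)
    (hx : Function.Injective x) (hmin : ∃ v, ∀ j ≠ i, Holds v (L j))
    (hβ : ∀ l ∈ E.1, l ∈ Set.range fun j => (⟨x j, β j⟩ : Literal n)) : ⟨x i, β i⟩ ∈ E.1 := by
  obtain ⟨v, hv⟩ := hmin
  by_contra hi
  obtain ⟨l, hl, hlx, -⟩ := hE v fun j b hj => hv j fun hji => by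
    obtain ⟨j', hj'⟩ := hβ _ hj
    obtain rfl : j' = j := hx (congrArg Literal.var hj')
    exact hi (by rwa [← hji, show β j' = b from congrArg Literal.sign hj'])
  obtain ⟨j, rfl⟩ := hβ l hl
  exact hlx ⟨j, rfl⟩

variable {π : Equiv.Perm (Fin n)}

theorem AvoidsVars.isEntailed_of_mem (h : AvoidsVars x L)
    (hlower : ∀ i y, π y < π (x i) → y ∈ Set.range x)
    (hP : IsDerivation (OrderedSide π) (weakenings x L).toFinset P) (hE : E ∈ P) (hl : l ∈ E.1)
    (hlx : l.var ∉ Set.range x) : IsEntailed x L E := by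
  suffices ∀ E ∈ P, (∃ l ∈ E.1, l.var ∉ Set.range x) → IsEntailed x L E from
    this E hE ⟨l, hl, hlx⟩
  refine hP.induction (fun C _ hC _ => ?_) ?_
  · obtain ⟨i, b, rfl⟩ := mem_weakenings.1 (List.mem_toFinset.1 hC)
    exact h.isEntailed_weakening
  · rintro E - F - C - m hE hF hres hside ⟨l, hl, hlx⟩
    have hm : m.var ∉ Set.range x := by
      rintro ⟨i, hi⟩
      exact hlx (hlower i _ (hi ▸ hside l hl))
    exact (hE ⟨m, hres.1, hm⟩).resolvent (hF ⟨m.neg, hres.2.1, hm⟩) hres hm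

theorem AvoidsVars.exists_forall_mem (h : AvoidsVars x L) (hx : Function.Injective x)
    (hlower : ∀ i y, π y < π (x i) → y ∈ Set.range x)
    (hmin : ∀ i, ∃ v, ∀ j ≠ i, Holds v (L j))
    (hP : IsOrderedRefutation π (weakenings x L).toFinset P) (β : Fin k → Bool) :
    ∃ E ∈ P, ∀ i, ⟨x i, β i⟩ ∈ E.1 := by
  by_contra! hfull
  have not_entailed : ∀ E ∈ P, IsEntailed x L E →
      ¬ ∀ l ∈ E.1, l ∈ Set.range fun i => (⟨x i, β i⟩ : Literal n) := fun E hE hent hβ => by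
    obtain ⟨i, hi⟩ := hfull E hE
    exact hi (hent.mem_of_forall_mem_range hx (hmin i) hβ)
  suffices ∀ E ∈ P, ¬ ∀ l ∈ E.1, l ∈ Set.range fun i => (⟨x i, β i⟩ : Literal n) from
    this _ hP.2 (by simp [Clause.zero])
  refine hP.1.induction (fun C hC hCτ => ?_) fun E hE F hF C hC l hEβ hFβ hres _ hCβ => ?_
  · obtain ⟨i, b, rfl⟩ := mem_weakenings.1 (List.mem_toFinset.1 hCτ)
    exact not_entailed _ hC h.isEntailed_weakening
  · by_cases hl : l.var ∈ Set.range x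
    · obtain ⟨i, hi⟩ := hl
      obtain hli | hli := Literal.eq_or_eq_neg (l := l) (m := ⟨x i, β i⟩) hi.symm
      · refine hEβ fun m hm => (eq_or_ne m l).elim (fun hml => ⟨i, ?_⟩)
          fun hne => hCβ m (hres.mem_of_mem_left hm hne)
        rw [hml, hli]
      · refine hFβ fun m hm => (eq_or_ne m l.neg).elim (fun hml => ⟨i, ?_⟩)
          fun hne => hCβ m (hres.mem_of_mem_right hm hne)
        rw [hml, hli, Literal.neg_neg]
    · exact not_entailed C hC ((h.isEntailed_of_mem hlower hP.1 hE hres.1 hl).resolvent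
        (h.isEntailed_of_mem hlower hP.1 hF hres.2.1 hl) hres hl) hCβ

theorem AvoidsVars.two_pow_le_length (h : AvoidsVars x L) (hx : Function.Injective x)
    (hlower : ∀ i y, π y < π (x i) → y ∈ Set.range x)
    (hmin : ∀ i, ∃ v, ∀ j ≠ i, Holds v (L j))
    (hP : IsOrderedRefutation π (weakenings x L).toFinset P) : 2 ^ k ≤ P.length := by
  choose E hE hmem using h.exists_forall_mem hx hlower hmin hP
  have hinj : Function.Injective E := by
    intro β β' hββ'
    funext i
    by_contra hne
    refine (E β).2 _ (hmem β i) ?_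
    have hneg : Literal.neg ⟨x i, β i⟩ = ⟨x i, β' i⟩ := by
      rw [Literal.neg, Bool.not_eq.2 hne]
    rw [hneg, hββ']
    exact hmem β' i
  calc 2 ^ k = (Finset.univ.image E).card := by
        rw [Finset.card_image_of_injective _ hinj]
        simp
    _ ≤ P.toFinset.card := Finset.card_le_card fun C hC => by
        obtain ⟨β, -, rfl⟩ := Finset.mem_image.1 hC
        exact List.mem_toFinset.2 (hE β)
    _ ≤ P.length := P.toFinset_card_le

end Weakening

/-- The unit clause `y i`, or the empty clause for `i = m`. -/
def chainConclusion {n m : ℕ} (y : Fin m → Fin n) (i : Fin (m + 1)) : Line n :=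
  Fin.lastCases (motive := fun _ => Line n) [] (fun j => [⟨y j, true⟩]) i

/-- The `i`-th clause of the chain of implications `1 → y 0 → ⋯ → y (m - 1) → 0`. -/
def chainLine {n m : ℕ} (y : Fin m → Fin n) (i : Fin (m + 1)) : Line n :=
  Fin.cases (motive := fun _ => Line n) [] (fun j => [⟨y j, false⟩]) i ++ chainConclusion y i

/-- A refutation of the weakenings of the chain of implications in general resolution. -/
def chainRefutation {n m : ℕ} (x : Fin (m + 1) → Fin n) (y : Fin m → Fin n) : List (Clause n) :=
  weakenings x (chainLine y) ++
    (List.finRange (m + 1)).map (fun i => Clause.ofLits (chainLine y i)) ++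
    (List.finRange (m + 1)).map (fun i => Clause.ofLits (chainConclusion y i))

section Chain

variable {n m : ℕ} {x : Fin (m + 1) → Fin n} {y : Fin m → Fin n} {i : Fin (m + 1)}
  {l : Literal n}

theorem mem_chainConclusion :
    l ∈ chainConclusion y i ↔ ∃ j : Fin m, i = j.castSucc ∧ l = ⟨y j, true⟩ := by
  cases i using Fin.lastCases <;> simp [chainConclusion, Fin.castSucc_ne_last, eq_comm]

theorem mem_chainLine : l ∈ chainLine y i ↔
    (∃ j : Fin m, i = j.succ ∧ l = ⟨y j, false⟩) ∨
      ∃ j : Fin m, i = j.castSucc ∧ l = ⟨y j, true⟩ := by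
  rw [chainLine, List.mem_append, mem_chainConclusion]
  refine or_congr_left ?_
  cases i using Fin.cases <;> simp [eq_comm]

theorem avoidsVars_chainLine (hy : Function.Injective y) (hxy : ∀ i j, x i ≠ y j) :
    AvoidsVars x (chainLine y) where
  neg_notMem i l hl hneg := by
    obtain ⟨j, hi, rfl⟩ | ⟨j, hi, rfl⟩ := mem_chainLine.1 hl <;>
      obtain ⟨j', hi', h⟩ | ⟨j', hi', h⟩ := mem_chainLine.1 hneg <;>
      simp only [Literal.neg, Literal.mk.injEq, Bool.not_false, Bool.not_true, reduceCtorEq,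
        and_false, and_true] at h <;>
      · obtain rfl := hy h
        simp [Fin.ext_iff, hi] at hi'
  var_notMem i l hl := by
    rintro ⟨i', hi'⟩
    obtain ⟨j, -, rfl⟩ | ⟨j, -, rfl⟩ := mem_chainLine.1 hl <;> exact hxy _ _ hi'

theorem exists_not_holds_chainLine (y : Fin m → Fin n) (v : Fin n → Bool) :
    ∃ i, ¬ Holds v (chainLine y i) := by
  by_contra! h
  have conclusion (i : Fin (m + 1)) : Holds v (chainConclusion y i) := by
    induction i using Fin.induction with
    | zero => exact h 0
    | succ j ih =>
      obtain ⟨l, hl, hv⟩ := ih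
      obtain ⟨j', hj, rfl⟩ := mem_chainConclusion.1 hl
      obtain rfl := Fin.castSucc_injective m hj
      obtain ⟨l, hl, hv'⟩ := h j.succ
      obtain ⟨j', hj, rfl⟩ | hl := mem_chainLine.1 hl
      · obtain rfl := Fin.succ_injective m hj
        exact Bool.noConfusion (hv.symm.trans hv')
      · exact ⟨l, mem_chainConclusion.2 hl, hv'⟩
  obtain ⟨l, hl, -⟩ := conclusion (Fin.last m)
  simp [chainConclusion] at hl

theorem exists_forall_ne_holds_chainLine (hy : Function.Injective y) (i : Fin (m + 1)) :
    ∃ v, ∀ i' ≠ i, Holds v (chainLine y i') := by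
  refine ⟨fun z => decide (∃ j : Fin m, j.castSucc < i ∧ y j = z), fun i' hi' => ?_⟩
  have value (j : Fin m) : (∃ j' : Fin m, j'.castSucc < i ∧ y j' = y j) ↔ j.castSucc < i :=
    ⟨fun ⟨j', hj', h⟩ => hy h ▸ hj', fun h => ⟨j, h, rfl⟩⟩
  obtain hlt | hlt := hi'.lt_or_gt
  · obtain ⟨j, rfl⟩ := Fin.exists_castSucc_eq.2 (Fin.ne_last_of_lt hlt)
    refine ⟨_, mem_chainLine.2 (.inr ⟨j, rfl, rfl⟩), ?_⟩
    simpa only [value, decide_eq_true_iff] using hlt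
  · obtain ⟨j, rfl⟩ := Fin.exists_succ_eq.2 (Fin.ne_zero_of_lt hlt)
    refine ⟨_, mem_chainLine.2 (.inl ⟨j, rfl, rfl⟩), ?_⟩
    simpa only [value, decide_eq_false_iff_not, not_lt] using Fin.le_castSucc_iff.2 hlt

theorem length_chainRefutation : (chainRefutation x y).length = 4 * (m + 1) := by
  simp only [chainRefutation, List.length_append, length_weakenings, List.length_map,
    List.length_finRange]
  ring

theorem isResolvent_chainConclusion (hy : Function.Injective y) (j : Fin m) :
    IsResolvent (Clause.ofLits (chainConclusion y j.castSucc))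
      (Clause.ofLits (chainLine y j.succ)) ⟨y j, true⟩
      (Clause.ofLits (chainConclusion y j.succ)) := by
  have hunit : chainConclusion y j.castSucc = [⟨y j, true⟩] := by simp [chainConclusion]
  rw [hunit]
  refine isResolvent_ofLits_cons (fun l hl hneg => ?_) (fun l hl hvar => ?_) fun l => by simp
  · obtain ⟨i, -, rfl⟩ := mem_chainConclusion.1 hl
    obtain ⟨i', -, h⟩ := mem_chainConclusion.1 hneg
    simp [Literal.neg] at h
  · obtain ⟨i, hi, rfl⟩ := mem_chainConclusion.1 hl
    obtain rfl := hy hvar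
    simp [Fin.ext_iff] at hi

theorem isResRefutation_chainRefutation (hy : Function.Injective y) (hxy : ∀ i j, x i ≠ y j) :
    IsResRefutation (weakenings x (chainLine y)).toFinset (chainRefutation x y) := by
  have hlines : IsDerivation (fun _ _ => True) (weakenings x (chainLine y)).toFinset
      (weakenings x (chainLine y) ++
        (List.finRange (m + 1)).map fun i => Clause.ofLits (chainLine y i)) := by
    refine (isDerivation_of_forall_mem fun C hC => List.mem_toFinset.2 hC).append_map_finRange
      fun i Q hQ _ => .inr ⟨_, hQ (mem_weakenings.2 ⟨i, true, rfl⟩), _,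
        hQ (mem_weakenings.2 ⟨i, false, rfl⟩), _,
        (avoidsVars_chainLine hy hxy).isResolvent_weakening i, trivial⟩
  have mem_lines (i : Fin (m + 1)) : Clause.ofLits (chainLine y i) ∈ weakenings x (chainLine y) ++
      (List.finRange (m + 1)).map fun i => Clause.ofLits (chainLine y i) :=
    List.mem_append_right _ (List.mem_map_of_mem (f := fun i => Clause.ofLits (chainLine y i))
      (List.mem_finRange i))
  refine ⟨hlines.append_map_finRange fun i Q hQ hprev => ?_, ?_⟩
  · cases i using Fin.cases with
    | zero => exact (hlines.justified (mem_lines 0)).mono hQ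
    | succ j =>
      exact .inr ⟨_, hprev j.castSucc j.castSucc_lt_succ, _, hQ (mem_lines j.succ), _,
        isResolvent_chainConclusion hy j, trivial⟩
  · refine List.mem_append_right _ (List.mem_map.2 ⟨Fin.last m, List.mem_finRange _, ?_⟩)
    simp [chainConclusion, Clause.ofLits, Clause.zero]

end Chain

theorem exists_eval_lt_two_pow (q : Polynomial ℕ) : ∃ m, q.eval m < 2 ^ (m + 1) := by
  have hlittle : (fun m : ℕ => ((q.eval m : ℕ) : ℝ)) =o[Filter.atTop] fun m => (2 : ℝ) ^ m := by
    simp only [Polynomial.eval_eq_sum_range, Nat.cast_sum, Nat.cast_mul, Nat.cast_pow]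
    exact .fun_sum fun i _ =>
      (isLittleO_pow_const_const_pow_of_one_lt i one_lt_two).const_mul_left _
  obtain ⟨m, hm⟩ := (hlittle.def one_pos).exists
  refine ⟨m, lt_of_le_of_lt ?_ (Nat.pow_lt_pow_right one_lt_two m.lt_succ_self)⟩
  rw [Real.norm_natCast, norm_pow, Real.norm_ofNat, one_mul] at hm
  exact_mod_cast hm

theorem exists_resolution_exponentially_shorter (m : ℕ)
    (π : Equiv.Perm (Fin (m + 1 + m))) : ∃ τ A : List (Clause (m + 1 + m)),
      CNF.Contradictory τ.toFinset ∧ τ.length = 2 * (m + 1) ∧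
      IsResRefutation τ.toFinset A ∧ A.length = 4 * (m + 1) ∧
      ∀ P, IsOrderedRefutation π τ.toFinset P → 2 ^ (m + 1) ≤ P.length := by
  let x : Fin (m + 1) → Fin (m + 1 + m) := fun i => π.symm (Fin.castAdd m i)
  let y : Fin m → Fin (m + 1 + m) := fun j => π.symm (Fin.natAdd (m + 1) j)
  have hx : Function.Injective x := π.symm.injective.comp (Fin.castAdd_injective _ _)
  have hy : Function.Injective y := π.symm.injective.comp (Fin.natAdd_injective _ _)
  have hxy : ∀ i j, x i ≠ y j := fun i j h => by
    have := congrArg Fin.val (π.symm.injective h)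
    simp only [Fin.val_castAdd, Fin.val_natAdd] at this
    omega
  have hlower : ∀ i z, π z < π (x i) → z ∈ Set.range x := fun i z hz => by
    rw [Equiv.apply_symm_apply, Fin.lt_def, Fin.val_castAdd] at hz
    exact ⟨⟨π z, hz.trans i.2⟩, π.symm_apply_apply z⟩
  have havoids := avoidsVars_chainLine hy hxy
  exact ⟨weakenings x (chainLine y), chainRefutation x y,
    havoids.contradictory_weakenings (exists_not_holds_chainLine y), length_weakenings,
    isResRefutation_chainRefutation hy hxy, length_chainRefutation,
    fun P => havoids.two_pow_le_length hx hlower (exists_forall_ne_holds_chainLine hy)⟩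

theorem not_sizeSimulates (π : ∀ n : ℕ, Equiv.Perm (Fin n)) :
    ¬ SizeSimulates (fun n => cdcl [decisionL n, orderedD (π n)]) resolution := by
  rintro ⟨q, hq⟩
  obtain ⟨M, r, hr⟩ := orderedResolution_pSimulates_cdcl
  obtain ⟨m, hlt⟩ := exists_eval_lt_two_pow (r.comp (2 * .X + 1 + q.comp (8 * .X + 7)))
  obtain ⟨τ, A, hτ, hτlen, hA, hAlen, hlower⟩ := exists_resolution_exponentially_shorter m (π _)
  obtain ⟨B, hB, hBsize⟩ := hq _ τ.toFinset hτ A hA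
  obtain ⟨P, hP, -, hPsize⟩ := hr _ (π _) τ hτ B hB
  refine hlt.not_ge ((hlower P hP).trans (hPsize.trans ?_))
  simp only [Polynomial.eval_comp, Polynomial.eval_add, Polynomial.eval_mul, Polynomial.eval_X,
    Polynomial.eval_ofNat, Polynomial.eval_one]
  have hcard := τ.toFinset_card_le
  have hsize : (resolution (m + 1 + m)).size A = 4 * (m + 1) := hAlen
  have hB := hBsize.trans (eval_mono q (b := 8 * m + 7) (by omega))
  exact eval_mono r (Nat.add_le_add (by omega) hB)

end OrderedCDCL

theorem theorem2p2 :
    PolyEquivalent (fun n π => cdcl [decisionL n, orderedD π]) (fun _ π => orderedResolution π) ∧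
      ∀ π : ∀ n : ℕ, Equiv.Perm (Fin n),
        ¬ SizeSimulates (fun n => cdcl [decisionL n, orderedD (π n)]) resolution :=
  ⟨⟨cdcl_pSimulates_orderedResolution, orderedResolution_pSimulates_cdcl⟩, not_sizeSimulates⟩
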